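/- For a finite set $\mathcal T$ of ordered triples from $[n]$, $n\ge 1$, a map $f:[n]\to\mathbb R$ satisfies the constraint $(u,v,w)\in\mathcal T$ if $|f(u)-f(v)|<|f(u)-f(w)|$. The instance $([n],\mathcal T)$ of Line Learning with Ordinal Constraints is dense if every triple in $\mathcal T$ consists of three distinct points and, for all distinct $u,v,w\in[n]$, exactly one of $(u,v,w)$ and $(u,w,v)$ belongs to $\mathcal T$. Theorem. There are a (deterministic) algorithm and an absolute constant $C>0$ such that the following holds for every $n\ge 1$, every dense instance $([n],\mathcal T)$ and every real $\varepsilon$ with $0<\varepsilon\le 1$. If some map $f:[n]\to\mathbb R$ satisfies at least $(1-\varepsilon)|\mathcal T|$ of the constraints, then the algorithm, given $n$, $\mathcal T$ (as a table of $n^3$ bits) and the integer $\lfloor 1/\varepsilon\rfloor$, outputs a map $[n]\to\mathbb R$ (with integer values) that satisfies at least $(1-C\varepsilon^{1/8})|\mathcal T|$ of the constraints, and it halts within $$C\,n^7+(1/\varepsilon)^{C/\varepsilon^{1/8}}\,n$$ steps. Steps are counted on the uniform-cost random access machine with integer cells, whose unit-cost operations are loading a constant, addition, subtraction, indirect reading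 and writing, and testing whether a cell is positive. -/

import Mathlib

/-! ### Random access machine

The machine has one integer memory cell for every integer address. Its operations are the classical
ones of the uniform-cost random access machine with addition and subtraction: loading a constant,
adding and subtracting two cells, reading and writing through an address held in a cell, and testing
whether a cell is positive. Each of them costs one step. Programs are written in structured form
(sequencing, branching, loops), so that no program counter is needed; they are finite and do not
depend on the input. There is no unit-cost multiplication. -/

namespace RAM

/-- A memory: the content of every cell. All but finitely many cells hold `0` in what follows. -/
abbrev Memory := ℤ → ℤ

/-- Programs. The arguments `a b c` are fixed addresses, `k` is a fixed integer constant. -/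
inductive Prog : Type
  /-- do nothing -/
  | skip : Prog
  /-- `M[a] ← k` -/
  | const (a k : ℤ) : Prog
  /-- `M[a] ← M[b] + M[c]` -/
  | add (a b c : ℤ) : Prog
  /-- `M[a] ← M[b] - M[c]` -/
  | sub (a b c : ℤ) : Prog
  /-- `M[a] ← M[M[b]]` -/
  | load (a b : ℤ) : Prog
  /-- `M[M[a]] ← M[b]` -/
  | store (a b : ℤ) : Prog
  /-- first `P`, then `Q` -/
  | seq (P Q : Prog) : Prog
  /-- if `M[a] > 0` then `P` else `Q` -/
  | ifPos (a : ℤ) (P Q : Prog) : Prog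
  /-- while `M[a] > 0` do `P` -/
  | whilePos (a : ℤ) (P : Prog) : Prog

/-- `Exec P M t M'`: the program `P`, started with memory `M`, halts after exactly `t` steps, and
the memory is then `M'`. Every elementary operation and every test of a branch or of a loop
(including the last test of a loop, which fails) is one step. -/
inductive Exec : Prog → Memory → ℕ → Memory → Prop
  | skip (M : Memory) : Exec .skip M 1 M
  | const (a k : ℤ) (M : Memory) : Exec (.const a k) M 1 (Function.update M a k)
  | add (a b c : ℤ) (M : Memory) : Exec (.add a b c) M 1 (Function.update M a (M b + M c))
  | sub (a b c : ℤ) (M : Memory) : Exec (.sub a b c) M 1 (Function.update M a (M b - M c))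
  | load (a b : ℤ) (M : Memory) : Exec (.load a b) M 1 (Function.update M a (M (M b)))
  | store (a b : ℤ) (M : Memory) : Exec (.store a b) M 1 (Function.update M (M a) (M b))
  | seq {P Q : Prog} {M M₁ M₂ : Memory} {t₁ t₂ : ℕ} :
      Exec P M t₁ M₁ → Exec Q M₁ t₂ M₂ → Exec (.seq P Q) M (t₁ + t₂) M₂
  | ifPos_true {a : ℤ} {P Q : Prog} {M M₁ : Memory} {t : ℕ} :
      0 < M a → Exec P M t M₁ → Exec (.ifPos a P Q) M (t + 1) M₁
  | ifPos_false {a : ℤ} {P Q : Prog} {M M₁ : Memory} {t : ℕ} :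
      ¬ 0 < M a → Exec Q M t M₁ → Exec (.ifPos a P Q) M (t + 1) M₁
  | whilePos_true {a : ℤ} {P : Prog} {M M₁ M₂ : Memory} {t₁ t₂ : ℕ} :
      0 < M a → Exec P M t₁ M₁ → Exec (.whilePos a P) M₁ t₂ M₂ →
        Exec (.whilePos a P) M (t₁ + t₂ + 1) M₂
  | whilePos_false {a : ℤ} {P : Prog} {M : Memory} :
      ¬ 0 < M a → Exec (.whilePos a P) M 1 M

/-- The machine is deterministic: running time and final memory are determined by the program and
the initial memory. -/
theorem Exec.deterministic {P : Prog} {M M₁ M₂ : Memory} {t₁ t₂ : ℕ}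
    (h₁ : Exec P M t₁ M₁) (h₂ : Exec P M t₂ M₂) : t₁ = t₂ ∧ M₁ = M₂ := by
  induction h₁ generalizing t₂ M₂ with
  | skip | const | add | sub | load | store => cases h₂; exact ⟨rfl, rfl⟩
  | seq _ _ ih₁ ih₂ =>
    cases h₂ with
    | seq k₁ k₂ =>
      obtain ⟨rfl, rfl⟩ := ih₁ k₁
      obtain ⟨rfl, rfl⟩ := ih₂ k₂
      exact ⟨rfl, rfl⟩
  | ifPos_true h _ ih =>
    cases h₂ with
    | ifPos_true _ k => obtain ⟨rfl, rfl⟩ := ih k; exact ⟨rfl, rfl⟩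
    | ifPos_false k _ => exact absurd h k
  | ifPos_false h _ ih =>
    cases h₂ with
    | ifPos_true k _ => exact absurd k h
    | ifPos_false _ k => obtain ⟨rfl, rfl⟩ := ih k; exact ⟨rfl, rfl⟩
  | whilePos_true h _ _ ih₁ ih₂ =>
    cases h₂ with
    | whilePos_true _ k₁ k₂ =>
      obtain ⟨rfl, rfl⟩ := ih₁ k₁
      obtain ⟨rfl, rfl⟩ := ih₂ k₂
      exact ⟨rfl, rfl⟩
    | whilePos_false k => exact absurd h k
  | whilePos_false h =>
    cases h₂ with
    | whilePos_true k _ _ => exact absurd k h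
    | whilePos_false _ => exact ⟨rfl, rfl⟩

end RAM

/-! ### Line learning with ordinal constraints -/

namespace LLOC

/-- A set of constraints on the points `0, …, n - 1`. The triple `(u, v, w)` is the constraint
`|f u - f v| < |f u - f w|` on a map `f` to the real line. -/
abbrev Constraints (n : ℕ) := Finset (Fin n × Fin n × Fin n)

/-- The map `f` satisfies the constraint `(u, v, w)`. -/
def Satisfies {n : ℕ} (f : Fin n → ℝ) (c : Fin n × Fin n × Fin n) : Prop :=
  |f c.1 - f c.2.1| < |f c.1 - f c.2.2|

/-- Dense instances: all constraints are on three distinct points, and for all distinct `u, v, w`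
exactly one of `(u, v, w)` and `(u, w, v)` is a constraint. -/
structure IsDense {n : ℕ} (T : Constraints n) : Prop where
  distinct : ∀ u v w : Fin n, (u, v, w) ∈ T → u ≠ v ∧ u ≠ w ∧ v ≠ w
  exactly_one : ∀ u v w : Fin n, u ≠ v → u ≠ w → v ≠ w → ((u, v, w) ∈ T ↔ (u, w, v) ∉ T)

open Classical in
/-- The map `f` satisfies at least an `α`-fraction of the constraints in `T`. -/
def SatisfiesFraction {n : ℕ} (T : Constraints n) (f : Fin n → ℝ) (α : ℝ) : Prop :=
  α * (T.card : ℝ) ≤ ((T.filter (fun c => Satisfies f c)).card : ℝ)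

open Classical in
/-- The initial memory for the constraints `T` on `n` points and the parameter `k`: cell `0` holds
`n`, cell `1` holds `k`, cell `2 + (u * n + v) * n + w` holds `1` or `0` according to whether
`(u, v, w)` is a constraint, and all other cells hold `0`. -/
noncomputable def input {n : ℕ} (T : Constraints n) (k : ℕ) : RAM.Memory := fun a =>
  if a = 0 then (n : ℤ)
  else if a = 1 then (k : ℤ)
  else if ∃ u v w : Fin n, (u, v, w) ∈ T ∧
      a = 2 + (((u : ℕ) : ℤ) * (n : ℤ) + ((v : ℕ) : ℤ)) * (n : ℤ) + ((w : ℕ) : ℤ) then 1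
  else 0

/-- The map that a final memory represents: the image of the point `u` is the content of cell `u`.
(Integers suffice as images, as multiplying a map by a positive constant preserves all constraints
that it satisfies.) -/
def output (n : ℕ) (M : RAM.Memory) : Fin n → ℝ := fun u => (M ((u : ℕ) : ℤ) : ℝ)

end LLOC

/-! ### A language of bounded loops and its compilation to the random access machine -/

/-! Write `d = ε^(1/8)`. The algorithm guesses a center `u`, sorts the other points into `m ≈ 1/d`
buckets by the number of points that the constraints declare farther from `u`, guesses an
arrangement of the `m + 1` buckets on the line (`u` has its own), and keeps the best of all
candidates.

Why a good candidate exists: let `f` be a good map, injective without loss of generality. Take for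
`u` a point with an at most average number of violated constraints among the `d^4 n` rightmost
points. For a point `v` to the left of these, "farther from `u` than `v`" means "left of `v`", up to
violated constraints and the few points near `u`. So the count differs from the rank of `v` by
`O(d^2 n)`, except for `O(d^2 n)` points with many violated constraints at `u`. A point lands in a
wrong bucket only if it is among these exceptions or its rank is close to one of the `m` bucket
boundaries; in total these are `O(d n)` points and `O(d n^3)` triples. It remains to see that
collapsing each bucket to one of its points changes few constraints (`card_ambiguous_le`). If the
three points are in different buckets, the order is preserved, and only the comparison of the pivot
with the midpoint of the two others can flip. The triples where it flips in a given direction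
contain no two that differ by a large shift of ranks along `(-1, 1, 1)`, hence there are `O(n^2 ·
n/m)` of them. This is `exists_placement`.

Why arrangements can be enumerated: only the signs of `y p + y q - y r - y s` matter. The
coefficient vectors that are positive at a given arrangement `F` lie in an open half space. Let `p`
be the point of their convex hull nearest to `0`; it is a normal of a separating hyperplane. By
Carathéodory it is a combination of at most `B = m + 1` of these vectors, and since their Gram
matrix is integral, Cramer's rule bounds `‖p‖²` from below. Summing greedily, each time a vector of
this list with least inner product with the current sum, gives after `N` steps a sum within `8√N` of
`N p`, as in the analysis of the perceptron. For `N = steps B` this integral sum has the required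
signs (`exists_greedy_pattern`). Thus an arrangement is encoded by `B + 1` quadruples, with
`m^(O(m))` possibilities, and is recovered by additions only.

The running time is that of `n` centers, `N` codes for each, and `O(N^3 + n^3)` steps per code. The
program is written in a language of bounded loops with an explicit cost function, and
`Cmd.comp_spec` transfers result and cost to the machine. -/

namespace LoopLang

open RAM

/-- The arrays of a loop program; `inp` occupies the nonnegative addresses of the machine. -/
inductive Arr
  | inp | pos | bucket | best
  deriving DecidableEq

/-- The variables of the program. -/
inductive Var
  | size | param | parts | width | places | bound
  | center | start | code | record
  | count | quot | prod₁ | prod₂ | prod₃ | base | expo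
  | point | idx | dig₁ | dig₂ | dig₃ | dig₄ | val | least | fresh | arg₁ | arg₂ | arg₃ | arg₄
  | sat | ptr | pt₁ | pt₂ | pt₃ | dist₁ | dist₂
  deriving DecidableEq

/-- A state of a loop program: integer variables and integer arrays. -/
structure State where
  v : Var → ℤ
  a : Arr → ℕ → ℤ

inductive Expr
  | var (x : Var) : Expr
  | lit (k : ℤ) : Expr
  | plus (e f : Expr) : Expr
  | minus (e f : Expr) : Expr
  | get (A : Arr) (e : Expr) : Expr

/-- The number of rounds of `loop e c` is the value of `e` on entry, so every command terminates and
`run` and `cost` are total functions. -/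
inductive Cmd
  | skip : Cmd
  | assign (x : Var) (e : Expr) : Cmd
  | store (A : Arr) (e f : Expr) : Cmd
  | seq (c d : Cmd) : Cmd
  | ite (e : Expr) (c d : Cmd) : Cmd
  | loop (e : Expr) (c : Cmd) : Cmd

def Expr.eval (σ : State) : Expr → ℤ
  | .var x => σ.v x
  | .lit k => k
  | .plus e f => e.eval σ + f.eval σ
  | .minus e f => e.eval σ - f.eval σ
  | .get A e => σ.a A (e.eval σ).toNat

/-- An upper bound for the compiled code. A variable is copied by adding a zero cell, hence 2; an
array access spends at most 7 steps on the address and one on the access. -/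
def Expr.cost : Expr → ℕ
  | .var _ => 2
  | .lit _ => 1
  | .plus e f => e.cost + f.cost + 1
  | .minus e f => e.cost + f.cost + 1
  | .get _ e => e.cost + 8

def Cmd.run : Cmd → State → State
  | .skip, σ => σ
  | .assign x e, σ => { σ with v := Function.update σ.v x (e.eval σ) }
  | .store A e f, σ =>
    { σ with a := Function.update σ.a A (Function.update (σ.a A) (e.eval σ).toNat (f.eval σ)) }
  | .seq c d, σ => d.run (c.run σ)
  | .ite e c d, σ => if 0 < e.eval σ then c.run σ else d.run σ
  | .loop e c, σ => c.run^[(e.eval σ).toNat] σ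

/-- In a loop, 3 covers the two steps that set the counter and the last test; each round pays 3 more
for its test and for decrementing the counter. -/
def Cmd.cost : Cmd → State → ℕ
  | .skip, _ => 1
  | .assign _ e, _ => e.cost + 2
  | .store _ e f, _ => e.cost + f.cost + 8
  | .seq c d, σ => c.cost σ + d.cost (c.run σ)
  | .ite e c d, σ => e.cost + 1 + if 0 < e.eval σ then c.cost σ else d.cost σ
  | .loop e c, σ =>
    e.cost + 3 + ∑ i ∈ Finset.range (e.eval σ).toNat, (c.cost (c.run^[i] σ) + 3)

/-- The variables that a command may change. -/
def Cmd.writes : Cmd → List Var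
  | .skip => []
  | .assign x _ => [x]
  | .store _ _ _ => []
  | .seq c d => c.writes ++ d.writes
  | .ite _ c d => c.writes ++ d.writes
  | .loop _ c => c.writes

/-- The arrays that a command may change. -/
def Cmd.arrWrites : Cmd → List Arr
  | .skip => []
  | .assign _ _ => []
  | .store A _ _ => [A]
  | .seq c d => c.arrWrites ++ d.arrWrites
  | .ite _ c d => c.arrWrites ++ d.arrWrites
  | .loop _ c => c.arrWrites

/-- A frame rule. For concrete commands the hypothesis is closed by `decide`, so no specification
has to list what it preserves. -/
theorem Cmd.run_v_of_notMem {x : Var} (c : Cmd) (σ : State) (h : x ∉ c.writes) :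
    (c.run σ).v x = σ.v x := by
  induction c generalizing σ with
  | skip => rfl
  | assign y e =>
    simp only [writes, List.mem_singleton] at h
    simp [run, h]
  | store => rfl
  | seq c d ihc ihd =>
    simp only [writes, List.mem_append, not_or] at h
    simp [run, ihc _ h.1, ihd _ h.2]
  | ite e c d ihc ihd =>
    simp only [writes, List.mem_append, not_or] at h
    simp only [run]
    split
    · exact ihc _ h.1
    · exact ihd _ h.2
  | loop e c ih =>
    simp only [writes] at h
    simp only [run]
    generalize (e.eval σ).toNat = k
    induction k with
    | zero => rfl
    | succ k ihk => rw [Function.iterate_succ_apply', ih _ h, ihk]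

theorem Cmd.run_a_of_notMem {A : Arr} (c : Cmd) (σ : State) (h : A ∉ c.arrWrites) :
    (c.run σ).a A = σ.a A := by
  induction c generalizing σ with
  | skip => rfl
  | assign y e => rfl
  | store B e f =>
    simp only [arrWrites, List.mem_singleton] at h
    simp [run, h]
  | seq c d ihc ihd =>
    simp only [arrWrites, List.mem_append, not_or] at h
    simp [run, ihc _ h.1, ihd _ h.2]
  | ite e c d ihc ihd =>
    simp only [arrWrites, List.mem_append, not_or] at h
    simp only [run]
    split
    · exact ihc _ h.1
    · exact ihd _ h.2
  | loop e c ih =>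
    simp only [arrWrites] at h
    simp only [run]
    generalize (e.eval σ).toNat = k
    induction k with
    | zero => rfl
    | succ k ihk => rw [Function.iterate_succ_apply', ih _ h, ihk]

/-- The rule for loops: an invariant `I`, with the unchanged part of the state for free. -/
theorem Cmd.loop_rule {e : Expr} {c : Cmd} {σ : State} {k t : ℕ} (I : ℕ → State → Prop)
    (hk : (e.eval σ).toNat = k) (h0 : I 0 σ)
    (hstep : ∀ i < k, ∀ τ, I i τ → (∀ x ∉ c.writes, τ.v x = σ.v x) →
      (∀ A ∉ c.arrWrites, τ.a A = σ.a A) → c.cost τ ≤ t ∧ I (i + 1) (c.run τ)) :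
    (Cmd.loop e c).cost σ ≤ e.cost + 3 + k * (t + 3) ∧ I k ((Cmd.loop e c).run σ) := by
  have hv : ∀ i, ∀ x ∉ c.writes, ((c.run)^[i] σ).v x = σ.v x := by
    intro i x hx
    induction i with
    | zero => rfl
    | succ i ih => rw [Function.iterate_succ_apply', c.run_v_of_notMem _ hx, ih]
  have ha : ∀ i, ∀ A ∉ c.arrWrites, ((c.run)^[i] σ).a A = σ.a A := by
    intro i A hx
    induction i with
    | zero => rfl
    | succ i ih => rw [Function.iterate_succ_apply', c.run_a_of_notMem _ hx, ih]
  have key : ∀ i ≤ k, I i ((c.run)^[i] σ) := by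
    intro i hi
    induction i with
    | zero => exact h0
    | succ i ih =>
      rw [Function.iterate_succ_apply']
      exact (hstep i hi _ (ih (by omega)) (hv i) (ha i)).2
  constructor
  · simp only [cost, hk]
    have : ∑ i ∈ Finset.range k, (c.cost ((c.run)^[i] σ) + 3) ≤ ∑ i ∈ Finset.range k, (t + 3) := by
      apply Finset.sum_le_sum
      intro i hi
      have hi' := Finset.mem_range.1 hi
      have := (hstep i hi' _ (key i hi'.le) (hv i) (ha i)).1
      omega
    simp only [Finset.sum_const, Finset.card_range, smul_eq_mul] at this
    omega
  · simp only [run, hk]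
    exact key k le_rfl

/-! #### Compilation -/

/-- The negative addresses are shared out by residue modulo 8: one class each for variables,
temporaries, loop counters and the arrays other than `inp`. Disjointness is then linear arithmetic.
-/
def vaddr (x : Var) : ℤ := -(8 * x.ctorIdx + 1)
def tmp (d : ℕ) : ℤ := -(8 * d + 2)
def cnt (d : ℕ) : ℤ := -(8 * d + 3)

def Arr.shift : Arr → ℤ
  | .inp => 0
  | .pos => -4
  | .bucket => -5
  | .best => -6

def Arr.addr (A : Arr) (i : ℕ) : ℤ := if A = .inp then i else A.shift - 8 * i

/-- The state `σ` is stored in the memory `M`. -/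
structure Rep (M : Memory) (σ : State) : Prop where
  v : ∀ x, M (vaddr x) = σ.v x
  a : ∀ A i, M (Arr.addr A i) = σ.a A i

/-- Replaces the index in `tmp d` by the address of the entry of `A`. -/
def index (A : Arr) (d : ℕ) : Prog :=
  -- The clamp to `0` matches `toNat` in `Expr.eval`; below, three doublings produce the stride 8.
  .seq (.ifPos (tmp d) .skip (.const (tmp d) 0))
    (if A = .inp then .skip else
      .seq (.add (tmp d) (tmp d) (tmp d)) (.seq (.add (tmp d) (tmp d) (tmp d))
        (.seq (.add (tmp d) (tmp d) (tmp d)) (.seq (.const (tmp (d + 1)) A.shift)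
          (.sub (tmp d) (tmp (d + 1)) (tmp d))))))

/-- The depth `d` is the height of an evaluation stack: the result goes to `tmp d`, and only
temporaries from `d` on are touched. -/
def Expr.comp : Expr → ℕ → Prog
  | .var x, d => .seq (.const (tmp (d + 1)) 0) (.add (tmp d) (vaddr x) (tmp (d + 1)))
  | .lit k, d => .const (tmp d) k
  | .plus e f, d => .seq (e.comp d) (.seq (f.comp (d + 1)) (.add (tmp d) (tmp d) (tmp (d + 1))))
  | .minus e f, d => .seq (e.comp d) (.seq (f.comp (d + 1)) (.sub (tmp d) (tmp d) (tmp (d + 1))))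
  | .get A e, d => .seq (e.comp d) (.seq (index A d) (.load (tmp d) (tmp d)))

/-- Here `k` is the nesting depth of loops, so that each enclosing loop has a counter of its own.
Temporaries need not survive from one command to the next. -/
def Cmd.comp : Cmd → ℕ → Prog
  | .skip, _ => .skip
  | .assign x e, _ =>
    .seq (e.comp 0) (.seq (.const (tmp 1) 0) (.add (vaddr x) (tmp 0) (tmp 1)))
  | .store A e f, _ =>
    .seq (e.comp 0) (.seq (index A 0) (.seq (f.comp 1) (.store (tmp 0) (tmp 1))))
  | .seq c d, k => .seq (c.comp k) (d.comp k)
  | .ite e c d, k => .seq (e.comp 0) (.ifPos (tmp 0) (c.comp k) (d.comp k))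
  | .loop e c, k =>
    .seq (e.comp 0) (.seq (.seq (.const (tmp 1) 0) (.add (cnt k) (tmp 0) (tmp 1)))
      (.whilePos (cnt k) (.seq (c.comp (k + 1))
        (.seq (.const (tmp 0) 1) (.sub (cnt k) (cnt k) (tmp 0))))))

theorem tmp_inj {i j : ℕ} : tmp i = tmp j ↔ i = j := by
  unfold tmp; omega

theorem cnt_inj {i j : ℕ} : cnt i = cnt j ↔ i = j := by
  unfold cnt; omega

theorem vaddr_inj {x y : Var} : vaddr x = vaddr y ↔ x = y := by
  refine ⟨fun h => ?_, fun h => h ▸ rfl⟩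
  have h' : x.ctorIdx = y.ctorIdx := by
    unfold vaddr at h; omega
  rw [← Var.ofNat_ctorIdx x, ← Var.ofNat_ctorIdx y, h']

theorem vaddr_ne_tmp (x : Var) (d : ℕ) : vaddr x ≠ tmp d := by
  unfold vaddr tmp; omega

theorem cnt_ne_tmp (x d : ℕ) : cnt x ≠ tmp d := by
  unfold cnt tmp; omega

theorem vaddr_ne_cnt (x : Var) (d : ℕ) : vaddr x ≠ cnt d := by
  unfold vaddr cnt; omega

theorem addr_ne_tmp (A : Arr) (i d : ℕ) : A.addr i ≠ tmp d := by
  cases A <;> simp [Arr.addr, Arr.shift, tmp] <;> omega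

theorem addr_ne_cnt (A : Arr) (i d : ℕ) : A.addr i ≠ cnt d := by
  cases A <;> simp [Arr.addr, Arr.shift, cnt] <;> omega

theorem addr_ne_vaddr (A : Arr) (i : ℕ) (d : Var) : A.addr i ≠ vaddr d := by
  cases A <;> simp [Arr.addr, Arr.shift, vaddr] <;> omega

theorem addr_inj {A B : Arr} {i j : ℕ} : A.addr i = B.addr j ↔ A = B ∧ i = j := by
  cases A <;> cases B <;> simp [Arr.addr, Arr.shift] <;> omega

/-- `M'` agrees with `M` outside the temporary cells from `tmp d` on. -/
def TmpEq (d : ℕ) (M M' : Memory) : Prop := ∀ a, (∀ j, d ≤ j → a ≠ tmp j) → M' a = M a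

theorem TmpEq.trans {d d' : ℕ} {M M' M'' : Memory} (hd : d ≤ d') (h : TmpEq d M M')
    (h' : TmpEq d' M' M'') : TmpEq d M M'' := fun a ha => by
  rw [h' a (fun j hj => ha j (hd.trans hj)), h a ha]

theorem TmpEq.update (d j : ℕ) (hj : d ≤ j) (M : Memory) (z : ℤ) :
    TmpEq d M (Function.update M (tmp j) z) := fun a ha => by
  rw [Function.update_of_ne (ha j hj)]

theorem Rep.of_tmpEq {d : ℕ} {M M' : Memory} {σ : State} (h : Rep M σ) (h' : TmpEq d M M') :
    Rep M' σ where
  v x := by rw [h' _ (fun j _ => vaddr_ne_tmp x j), h.v]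
  a A i := by rw [h' _ (fun j _ => addr_ne_tmp A i j), h.a]

theorem index_spec (A : Arr) (d : ℕ) (M : Memory) :
    ∃ t M', t ≤ 7 ∧ Exec (index A d) M t M' ∧ M' (tmp d) = A.addr (M (tmp d)).toNat ∧
      TmpEq d M M' := by
  have hclamp : ∃ M₁, Exec (.ifPos (tmp d) .skip (.const (tmp d) 0)) M 2 M₁ ∧
      M₁ (tmp d) = ((M (tmp d)).toNat : ℤ) ∧ TmpEq d M M₁ := by
    by_cases h : 0 < M (tmp d)
    · exact ⟨M, .ifPos_true h (.skip _), by omega, fun _ _ => rfl⟩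
    · refine ⟨_, .ifPos_false h (.const _ _ _), ?_, TmpEq.update d d le_rfl _ _⟩
      rw [Function.update_self]
      omega
  obtain ⟨M₁, h₁, hv, ht⟩ := hclamp
  by_cases hA : A = .inp
  · subst hA
    refine ⟨2 + 1, M₁, by norm_num, ?_, by simp [hv, Arr.addr], ht⟩
    simp only [index, if_true]
    exact .seq h₁ (.skip _)
  · simp only [index, if_neg hA]
    refine ⟨_, _, ?_, .seq h₁ (.seq (.add _ _ _ _) (.seq (.add _ _ _ _) (.seq (.add _ _ _ _)
      (.seq (.const _ _ _) (.sub _ _ _ _))))), ?_, ?_⟩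
    · norm_num
    · have h1 : tmp d ≠ tmp (d + 1) := by rw [Ne, tmp_inj]; omega
      simp only [Function.update_self, Function.update_of_ne h1, hv, Arr.addr, if_neg hA]
      ring
    · have hu := TmpEq.update d d le_rfl
      exact ht.trans le_rfl ((hu _ _).trans le_rfl ((hu _ _).trans le_rfl ((hu _ _).trans le_rfl
        ((TmpEq.update d (d + 1) (by omega) _ _).trans le_rfl (hu _ _)))))

/-- The clause `TmpEq d` carries the induction: the right operand is evaluated at depth `d + 1`, so
the value of the left one in `tmp d` survives. -/
theorem Expr.comp_spec (e : Expr) (σ : State) (d : ℕ) (M : Memory) (hM : Rep M σ) :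
    ∃ t M', t ≤ e.cost ∧ Exec (e.comp d) M t M' ∧ M' (tmp d) = e.eval σ ∧ TmpEq d M M' := by
  induction e generalizing d M with
  | var x =>
    refine ⟨_, _, ?_, .seq (.const _ _ _) (.add _ _ _ _), ?_, ?_⟩
    · simp [cost]
    · simp [eval, vaddr_ne_tmp, hM.v]
    · exact (TmpEq.update d (d + 1) (by omega) _ _).trans le_rfl (TmpEq.update d d le_rfl _ _)
  | lit k =>
    exact ⟨_, _, le_rfl, .const _ _ _, by simp [eval], TmpEq.update d d le_rfl _ _⟩
  | plus e f ihe ihf =>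
    obtain ⟨t₁, M₁, ht₁, he₁, hv₁, hq₁⟩ := ihe d M hM
    obtain ⟨t₂, M₂, ht₂, he₂, hv₂, hq₂⟩ := ihf (d + 1) M₁ (hM.of_tmpEq hq₁)
    refine ⟨_, _, ?_, .seq he₁ (.seq he₂ (.add _ _ _ _)), ?_, ?_⟩
    · simp only [cost]; omega
    · rw [Function.update_self, hv₂, hq₂ _ (fun j hj => by rw [Ne, tmp_inj]; omega), hv₁, eval]
    · exact (hq₁.trans (by omega) hq₂).trans le_rfl (TmpEq.update d d le_rfl _ _)
  | minus e f ihe ihf =>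
    obtain ⟨t₁, M₁, ht₁, he₁, hv₁, hq₁⟩ := ihe d M hM
    obtain ⟨t₂, M₂, ht₂, he₂, hv₂, hq₂⟩ := ihf (d + 1) M₁ (hM.of_tmpEq hq₁)
    refine ⟨_, _, ?_, .seq he₁ (.seq he₂ (.sub _ _ _ _)), ?_, ?_⟩
    · simp only [cost]; omega
    · rw [Function.update_self, hv₂, hq₂ _ (fun j hj => by rw [Ne, tmp_inj]; omega), hv₁, eval]
    · exact (hq₁.trans (by omega) hq₂).trans le_rfl (TmpEq.update d d le_rfl _ _)
  | get A e ih =>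
    obtain ⟨t₁, M₁, ht₁, he₁, hv₁, hq₁⟩ := ih d M hM
    obtain ⟨t₂, M₂, ht₂, he₂, hv₂, hq₂⟩ := index_spec A d M₁
    refine ⟨_, _, ?_, .seq he₁ (.seq he₂ (.load _ _ _)), ?_, ?_⟩
    · simp only [cost]; omega
    · rw [Function.update_self, hv₂, hq₂ _ (fun j _ => addr_ne_tmp _ _ _),
        hq₁ _ (fun j _ => addr_ne_tmp _ _ _), hM.a, hv₁, eval]
    · exact (hq₁.trans le_rfl hq₂).trans le_rfl (TmpEq.update d d le_rfl _ _)

/-- The counters of the enclosing loops are unchanged. -/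
def CntEq (k : ℕ) (M M' : Memory) : Prop := ∀ j < k, M' (cnt j) = M (cnt j)

theorem TmpEq.cntEq {d : ℕ} {M M' : Memory} (h : TmpEq d M M') (k : ℕ) : CntEq k M M' :=
  fun j _ => h _ (fun i _ => cnt_ne_tmp j i)

theorem CntEq.trans {k k' : ℕ} {M M' M'' : Memory} (hk : k ≤ k') (h : CntEq k M M')
    (h' : CntEq k' M' M'') : CntEq k M M'' := fun j hj => by
  rw [h' j (by omega), h j hj]

theorem Rep.update_cnt {M : Memory} {σ : State} (h : Rep M σ) (k : ℕ) (z : ℤ) :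
    Rep (Function.update M (cnt k) z) σ where
  v x := by rw [Function.update_of_ne (vaddr_ne_cnt x k), h.v]
  a A i := by rw [Function.update_of_ne (addr_ne_cnt A i k), h.a]

theorem CntEq.update (k j : ℕ) (hj : k ≤ j) (M : Memory) (z : ℤ) :
    CntEq k M (Function.update M (cnt j) z) := fun i hi => by
  rw [Function.update_of_ne (by rw [Ne, cnt_inj]; omega)]

theorem Cmd.comp_spec (c : Cmd) (σ : State) (k : ℕ) (M : Memory) (hM : Rep M σ) :
    ∃ t M', t ≤ c.cost σ ∧ Exec (c.comp k) M t M' ∧ Rep M' (c.run σ) ∧ CntEq k M M' := by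
  induction c generalizing σ k M with
  | skip => exact ⟨_, _, le_rfl, .skip _, hM, fun _ _ => rfl⟩
  | assign x e =>
    obtain ⟨t₁, M₁, ht₁, he₁, hv₁, hq₁⟩ := e.comp_spec σ 0 M hM
    have hM₁ := hM.of_tmpEq hq₁
    refine ⟨_, _, ?_, .seq he₁ (.seq (.const _ _ _) (.add _ _ _ _)), ⟨?_, ?_⟩, ?_⟩
    · simp only [cost]; omega
    · intro y
      by_cases h : y = x
      · subst h
        simp [run, tmp_inj, hv₁]
      · have h' : vaddr y ≠ vaddr x := by rwa [Ne, vaddr_inj]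
        simp [run, h, h', vaddr_ne_tmp, hM₁.v]
    · intro A i
      simp [run, addr_ne_tmp, addr_ne_vaddr, hM₁.a]
    · intro j hj
      have := vaddr_ne_cnt x j
      rw [Function.update_of_ne this.symm, Function.update_of_ne (cnt_ne_tmp _ _),
        hq₁.cntEq k j hj]
  | store A e f =>
    obtain ⟨t₁, M₁, ht₁, he₁, hv₁, hq₁⟩ := e.comp_spec σ 0 M hM
    obtain ⟨t₂, M₂, ht₂, he₂, hv₂, hq₂⟩ := index_spec A 0 M₁
    have hM₂ := (hM.of_tmpEq hq₁).of_tmpEq hq₂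
    obtain ⟨t₃, M₃, ht₃, he₃, hv₃, hq₃⟩ := f.comp_spec σ 1 M₂ hM₂
    have hM₃ := hM₂.of_tmpEq hq₃
    have hadr : M₃ (tmp 0) = A.addr (e.eval σ).toNat := by
      rw [hq₃ _ (fun j hj => by rw [Ne, tmp_inj]; omega), hv₂, hv₁]
    refine ⟨_, _, ?_, .seq he₁ (.seq he₂ (.seq he₃ (.store _ _ _))), ⟨?_, ?_⟩, ?_⟩
    · simp only [cost]; omega
    · intro y
      rw [hadr, Function.update_of_ne (addr_ne_vaddr _ _ _).symm, hM₃.v, run]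
    · intro A' i
      rw [hadr, hv₃]
      by_cases hA : A' = A
      · subst hA
        by_cases hi : i = (e.eval σ).toNat
        · subst hi
          simp [run]
        · have : A'.addr i ≠ A'.addr (e.eval σ).toNat := by
            rw [Ne, addr_inj]; tauto
          simp [run, this, hi, hM₃.a]
      · have : A'.addr i ≠ A.addr (e.eval σ).toNat := by
          rw [Ne, addr_inj]; tauto
        simp [run, this, hA, hM₃.a]
    · intro j hj
      rw [hadr, Function.update_of_ne (addr_ne_cnt _ _ _).symm, hq₃.cntEq k j hj,
        hq₂.cntEq k j hj, hq₁.cntEq k j hj]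
  | seq c d ihc ihd =>
    obtain ⟨t₁, M₁, ht₁, he₁, hr₁, hc₁⟩ := ihc σ k M hM
    obtain ⟨t₂, M₂, ht₂, he₂, hr₂, hc₂⟩ := ihd _ k M₁ hr₁
    refine ⟨_, _, ?_, .seq he₁ he₂, hr₂, hc₁.trans le_rfl hc₂⟩
    simp only [cost]; omega
  | ite e c d ihc ihd =>
    obtain ⟨t₁, M₁, ht₁, he₁, hv₁, hq₁⟩ := e.comp_spec σ 0 M hM
    have hM₁ := hM.of_tmpEq hq₁
    by_cases h : 0 < e.eval σ
    · obtain ⟨t₂, M₂, ht₂, he₂, hr₂, hc₂⟩ := ihc σ k M₁ hM₁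
      refine ⟨_, _, ?_, .seq he₁ (.ifPos_true (hv₁ ▸ h) he₂), ?_, (hq₁.cntEq k).trans le_rfl hc₂⟩
      · simp only [cost, if_pos h]; omega
      · simpa only [run, if_pos h] using hr₂
    · obtain ⟨t₂, M₂, ht₂, he₂, hr₂, hc₂⟩ := ihd σ k M₁ hM₁
      refine ⟨_, _, ?_, .seq he₁ (.ifPos_false (hv₁ ▸ h) he₂), ?_, (hq₁.cntEq k).trans le_rfl hc₂⟩
      · simp only [cost, if_neg h]; omega
      · simpa only [run, if_neg h] using hr₂
  | loop e c ih =>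
    obtain ⟨t₁, M₁, ht₁, he₁, hv₁, hq₁⟩ := e.comp_spec σ 0 M hM
    have hM₁ := hM.of_tmpEq hq₁
    -- Induction on the remaining rounds, for every state: the machine counts down, and the body,
    -- compiled at depth `k + 1`, leaves `cnt k` alone.
    have hloop : ∀ (j : ℕ) (τ : State) (M₂ : Memory), Rep M₂ τ → (M₂ (cnt k)).toNat = j →
        ∃ t M', t ≤ 1 + ∑ i ∈ Finset.range j, (c.cost (c.run^[i] τ) + 3) ∧
          Exec (.whilePos (cnt k) (.seq (c.comp (k + 1))
            (.seq (.const (tmp 0) 1) (.sub (cnt k) (cnt k) (tmp 0))))) M₂ t M' ∧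
          Rep M' (c.run^[j] τ) ∧ CntEq k M₂ M' := by
      intro j
      induction j with
      | zero =>
        intro τ M₂ hr hj
        refine ⟨1, M₂, by simp, .whilePos_false (by omega), hr, fun _ _ => rfl⟩
      | succ j ihj =>
        intro τ M₂ hr hj
        obtain ⟨t₃, M₃, ht₃, he₃, hr₃, hc₃⟩ := ih τ (k + 1) M₂ hr
        have hk₃ : M₃ (cnt k) = M₂ (cnt k) := hc₃ k (by omega)
        have hu := TmpEq.update 0 0 le_rfl M₃ 1
        obtain ⟨t₄, M₄, ht₄, he₄, hr₄, hc₄⟩ := ihj (c.run τ) (Function.update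
          (Function.update M₃ (tmp 0) 1) (cnt k) (Function.update M₃ (tmp 0) 1 (cnt k) -
            Function.update M₃ (tmp 0) 1 (tmp 0))) ((hr₃.of_tmpEq hu).update_cnt k _)
          (by simp [cnt_ne_tmp, hk₃, hj])
        refine ⟨_, _, ?_, .whilePos_true (by omega)
          (.seq he₃ (.seq (.const _ _ _) (.sub _ _ _ _))) he₄, hr₄, ?_⟩
        · rw [Finset.sum_range_succ']
          simp only [Function.iterate_succ_apply] at ht₄ ⊢
          simp only [Function.iterate_zero, id_eq]
          omega
        · have h₃ : CntEq k M₂ M₃ := fun i hi => hc₃ i (by omega)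
          exact h₃.trans le_rfl
            ((hu.cntEq k).trans le_rfl ((CntEq.update k k le_rfl _ _).trans le_rfl hc₄))
    have hu := TmpEq.update 0 1 (by omega) M₁ 0
    obtain ⟨t₂, M₂, ht₂, he₂, hr₂, hc₂⟩ := hloop (e.eval σ).toNat σ (Function.update
      (Function.update M₁ (tmp 1) 0) (cnt k) (Function.update M₁ (tmp 1) 0 (tmp 0) +
        Function.update M₁ (tmp 1) 0 (tmp 1))) ((hM₁.of_tmpEq hu).update_cnt k _)
      (by simp [tmp_inj, hv₁])
    refine ⟨_, _, ?_, .seq he₁ (.seq (.seq (.const _ _ _) (.add _ _ _ _)) he₂), hr₂, ?_⟩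
    · simp only [cost]; omega
    · exact (hq₁.cntEq k).trans le_rfl
        ((hu.cntEq k).trans le_rfl ((CntEq.update k k le_rfl _ _).trans le_rfl hc₂))

end LoopLang

/-! ### Sign patterns of few points on the line are realized by few constraints -/

namespace LLOC

section Separation

variable {E : Type*} [NormedAddCommGroup E] [InnerProductSpace ℝ E]

/-- If one always adds a vector of `S` of least inner product with the current sum, then the sum
stays close to the multiples of any `p ∈ conv S` with `⟪a, p⟫ ≥ ‖p‖²` on `S`. -/
theorem norm_greedy_sub_sq_le {ι : Type*} [Fintype ι] (z : ι → E) (w : ι → ℝ) (hw : ∀ i, 0 < w i)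
    (hw1 : ∑ i, w i = 1) (hz : ∀ i, ‖z i‖ ≤ 4)
    (hp : ∀ i, ‖∑ i, w i • z i‖ ^ 2 ≤ inner ℝ (z i) (∑ i, w i • z i))
    (N : ℕ) (y : ℕ → E) (h0 : y 0 = 0)
    (hy : ∀ t < N, ∃ j, y (t + 1) = y t + z j ∧ ∀ i, inner ℝ (z j) (y t) ≤ inner ℝ (z i) (y t)) :
    ∀ t ≤ N, ‖y t - (t : ℝ) • ∑ i, w i • z i‖ ^ 2 ≤ 64 * t := by
  set p := ∑ i, w i • z i with hpdef
  have hpn : ‖p‖ ≤ 4 := by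
    calc ‖p‖ ≤ ∑ i, ‖w i • z i‖ := norm_sum_le _ _
      _ ≤ ∑ i, w i * 4 := by
        apply Finset.sum_le_sum
        intro i _
        rw [norm_smul, Real.norm_of_nonneg (hw i).le]
        exact mul_le_mul_of_nonneg_left (hz i) (hw i).le
      _ = 4 := by rw [← Finset.sum_mul, hw1, one_mul]
  intro t ht
  induction t with
  | zero => simp [h0]
  | succ t ih =>
    obtain ⟨j, hj, hmin⟩ := hy t (by omega)
    have e : y (t + 1) - ((t + 1 : ℕ) : ℝ) • p = (y t - (t : ℝ) • p) + (z j - p) := by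
      rw [hj]; push_cast; rw [add_smul, one_smul]; abel
    have h1 : inner ℝ (z j) (y t) ≤ inner ℝ p (y t) := by
      rw [hpdef, sum_inner]
      calc inner ℝ (z j) (y t) = ∑ i, w i * inner ℝ (z j) (y t) := by
            rw [← Finset.sum_mul, hw1, one_mul]
        _ ≤ ∑ i, inner ℝ (w i • z i) (y t) := by
            apply Finset.sum_le_sum
            intro i _
            rw [real_inner_smul_left]
            exact mul_le_mul_of_nonneg_left (hmin i) (hw i).le
    have h2 : inner ℝ (y t - (t : ℝ) • p) (z j - p) ≤ 0 := by
      have h3 : (t : ℝ) * ‖p‖ ^ 2 ≤ t * inner ℝ (z j) p :=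
        mul_le_mul_of_nonneg_left (hp j) t.cast_nonneg
      rw [inner_sub_left, inner_sub_right, inner_sub_right, real_inner_smul_left,
        real_inner_smul_left, real_inner_self_eq_norm_sq, real_inner_comm (z j) (y t),
        real_inner_comm p (y t), real_inner_comm (z j) p]
      linarith
    have h4 : ‖z j - p‖ ≤ 8 := (norm_sub_le _ _).trans (by linarith [hz j])
    have h5 : ‖z j - p‖ ^ 2 ≤ 64 := by nlinarith [norm_nonneg (z j - p)]
    rw [e, norm_add_sq_real]
    push_cast
    linarith [ih (by omega)]

/-- A point in the interior of a simplex with small integral Gram matrix, which has the same inner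
product with all vertices, is not too short. -/
theorem one_le_norm_sq_mul {ι : Type*} [Fintype ι] (z : ι → E) (w : ι → ℝ)
    (hw1 : ∑ i, w i = 1) (hli : LinearIndependent ℝ z)
    (hint : ∀ i j, ∃ k : ℤ, inner ℝ (z i) (z j) = k) (hz : ∀ i, ‖z i‖ ≤ 4) {ρ : ℝ} (hρ : 0 ≤ ρ)
    (hp : ∀ i, inner ℝ (z i) (∑ i, w i • z i) = ρ) :
    1 ≤ ρ * (Fintype.card ι * ((Fintype.card ι).factorial * 16 ^ Fintype.card ι)) := by
  classical
  set G := Matrix.gram ℝ z with hG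
  have hdet : G.det ≠ 0 := Matrix.det_gram_ne_zero_iff_linearIndependent.2 hli
  choose g hg using hint
  have hdet1 : 1 ≤ |G.det| := by
    have : G = (Matrix.of g).map (Int.castRingHom ℝ) := by
      ext i j
      simp [hG, Matrix.gram_apply, hg]
    have h2 : G.det = ((Matrix.of g).det : ℤ) := by
      rw [this, ← RingHom.mapMatrix_apply, ← RingHom.map_det]
      simp
    rw [h2] at hdet ⊢
    have : (Matrix.of g).det ≠ 0 := by exact_mod_cast hdet
    exact_mod_cast Int.one_le_abs this
  have hGw : G.mulVec w = fun _ => ρ := by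
    ext i
    rw [← hp i, inner_sum]
    simp [Matrix.mulVec, dotProduct, hG, Matrix.gram_apply, real_inner_smul_right, mul_comm]
  -- Cramer's rule for `G w = ρ · 1` without denominators. As the weights sum to `1`, summing the
  -- entries expresses the nonzero integer `det G` as `ρ` times a bounded number.
  have hcr : G.det • w = ρ • G.cramer 1 := by
    have h1 : G.mulVec (G.det • w - ρ • G.cramer 1) = 0 := by
      rw [Matrix.mulVec_sub, Matrix.mulVec_smul, Matrix.mulVec_smul, Matrix.mulVec_cramer, hGw]
      ext i
      simp [mul_comm]
    by_contra hne
    exact hdet (Matrix.exists_mulVec_eq_zero_iff.1 ⟨_, sub_ne_zero.2 hne, h1⟩)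
  have hsum : G.det = ρ * ∑ i, G.cramer 1 i := by
    have := congrArg (fun f : ι → ℝ => ∑ i, f i) hcr
    simpa [← Finset.mul_sum, hw1] using this
  have hbd : ∀ i, |G.cramer 1 i| ≤ (Fintype.card ι).factorial * 16 ^ Fintype.card ι := by
    intro i
    rw [Matrix.cramer_apply]
    have := Matrix.det_le (A := G.updateCol i 1) (abv := AbsoluteValue.abs) (x := (16 : ℝ)) (by
      intro a b
      rw [AbsoluteValue.abs_apply, Matrix.updateCol_apply]
      split
      · simp
      · rw [hG, Matrix.gram_apply]
        calc |inner ℝ (z a) (z b)| ≤ ‖z a‖ * ‖z b‖ := abs_real_inner_le_norm _ _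
          _ ≤ 4 * 4 := by gcongr <;> exact hz _
          _ = 16 := by norm_num)
    simpa using this
  calc (1 : ℝ) ≤ |G.det| := hdet1
    _ = ρ * |∑ i, G.cramer 1 i| := by rw [hsum, abs_mul, abs_of_nonneg hρ]
    _ ≤ ρ * ∑ i, |G.cramer 1 i| := by gcongr; exact Finset.abs_sum_le_sum_abs _ _
    _ ≤ ρ * ∑ _i : ι, ((Fintype.card ι).factorial * 16 ^ Fintype.card ι : ℝ) := by
      gcongr with i; exact hbd i
    _ = _ := by simp

/-- A finite set `A` of vectors in an open half space contains few vectors such that the greedy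
sums of these have a positive inner product with all vectors of `A`. -/
theorem exists_greedy_separation [FiniteDimensional ℝ E] (A : Set E) (hA : A.Finite)
    (hne : A.Nonempty) (hnorm : ∀ a ∈ A, ‖a‖ ≤ 4)
    (hint : ∀ a ∈ A, ∀ b ∈ A, ∃ k : ℤ, inner ℝ a b = k) (x : E)
    (hx : ∀ a ∈ A, 0 < inner ℝ a x) (N : ℕ)
    (hN : ∀ s ≤ Module.finrank ℝ E, 1024 * ((s : ℝ) * (s.factorial * 16 ^ s)) ^ 2 < N) :
    ∃ S : ℕ → E, (∀ j, S j ∈ A) ∧ ∀ y : ℕ → E, y 0 = 0 →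
      (∀ t < N, ∃ j ≤ Module.finrank ℝ E, y (t + 1) = y t + S j ∧
        ∀ i ≤ Module.finrank ℝ E, inner ℝ (S j) (y t) ≤ inner ℝ (S i) (y t)) →
      ∀ a ∈ A, 0 < inner ℝ a (y N) := by
  classical
  -- The point of the convex hull nearest to `0`.
  obtain ⟨p, hpA, hpmin⟩ := exists_norm_eq_iInf_of_complete_convex (K := convexHull ℝ A)
    hne.convexHull (hA.isCompact_convexHull ℝ).isComplete (convex_convexHull ℝ A) 0
  rw [norm_eq_iInf_iff_real_inner_le_zero (convex_convexHull ℝ A) hpA] at hpmin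
  have hpa : ∀ a ∈ A, ‖p‖ ^ 2 ≤ inner ℝ a p := by
    intro a ha
    have := hpmin a (subset_convexHull ℝ A ha)
    rw [zero_sub, inner_neg_left, inner_sub_right, real_inner_self_eq_norm_sq,
      real_inner_comm a p] at this
    linarith
  obtain ⟨ι, hι, z, w, hzA, hzind, hw, hw1, hzp⟩ := eq_pos_convex_span_of_mem_convexHull hpA
  have hzA' : ∀ i, z i ∈ A := fun i => hzA ⟨i, rfl⟩
  have hxp : 0 < inner ℝ p x := by
    have hnι : Nonempty ι := by
      by_contra h
      rw [not_nonempty_iff] at h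
      simp at hw1
    rw [← hzp, sum_inner]
    apply Finset.sum_pos _ Finset.univ_nonempty
    intro i _
    rw [real_inner_smul_left]
    exact mul_pos (hw i) (hx _ (hzA' i))
  have hp0 : p ≠ 0 := by
    rintro rfl
    simp at hxp
  have hρ : 0 < ‖p‖ ^ 2 := by positivity
  -- The average of the numbers `⟪z i, p⟫ ≥ ‖p‖²` with positive weights is `‖p‖²`, so all of them
  -- are equal to it.
  have hpeq : ∀ i, inner ℝ (z i) p = ‖p‖ ^ 2 := by
    have hs : ∑ i, w i * (inner ℝ (z i) p - ‖p‖ ^ 2) = 0 := by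
      simp only [mul_sub, Finset.sum_sub_distrib]
      rw [← Finset.sum_mul, hw1, one_mul, ← real_inner_self_eq_norm_sq]
      conv_lhs => rw [← hzp]
      rw [sum_inner]
      simp [real_inner_smul_left]
    rw [Finset.sum_eq_zero_iff_of_nonneg (fun i _ => mul_nonneg (hw i).le
      (sub_nonneg.2 (hpa _ (hzA' i))))] at hs
    intro i
    rcases mul_eq_zero.1 (hs i (Finset.mem_univ i)) with h | h
    · exact absurd h (hw i).ne'
    · linarith
  -- All vertices lie on a hyperplane that misses `0`, so affine independence becomes linear
  -- independence. This allows at most `finrank` vertices and makes the Gram determinant nonzero.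
  have hli : LinearIndependent ℝ z := by
    rw [Fintype.linearIndependent_iff]
    intro g hg
    have h1 : ∑ i, g i = 0 := by
      have := congrArg (fun v => inner ℝ v p) hg
      simp only [sum_inner, real_inner_smul_left, hpeq, inner_zero_left, ← Finset.sum_mul] at this
      exact (mul_eq_zero.1 this).resolve_right hρ.ne'
    intro i
    exact affineIndependent_iff.1 hzind Finset.univ g h1 hg i (Finset.mem_univ i)
  have hcard : Fintype.card ι ≤ Module.finrank ℝ E := hli.fintype_card_le_finrank
  have hcard0 : 0 < Fintype.card ι := by
    rw [Fintype.card_pos_iff]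
    by_contra h
    rw [not_nonempty_iff] at h
    simp at hw1
  have hlow := one_le_norm_sq_mul z w hw1 hli (fun i j => hint _ (hzA' i) _ (hzA' j))
    (fun i => hnorm _ (hzA' i)) hρ.le (by rw [hzp]; exact hpeq)
  set e := Fintype.equivFin ι
  have hmod : ∀ j, j % Fintype.card ι < Fintype.card ι := fun j => Nat.mod_lt _ hcard0
  -- The indices up to `finrank` run through all vertices, with repetitions, which do not affect a
  -- least inner product.
  refine ⟨fun j => z (e.symm ⟨j % Fintype.card ι, hmod j⟩), fun j => hzA' _, ?_⟩
  intro y h0 hy a ha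
  have hgr := norm_greedy_sub_sq_le z w hw hw1 (fun i => hnorm _ (hzA' i))
    (by rw [hzp]; exact fun i => (hpeq i).ge) N y h0 (by
      intro t ht
      obtain ⟨j, hj, hj1, hj2⟩ := hy t ht
      refine ⟨_, hj1, fun i => ?_⟩
      have := hj2 (e i) (by have := (e i).2; omega)
      simpa [Nat.mod_eq_of_lt (e i).2] using this) N le_rfl
  rw [hzp] at hgr
  have hNpos : (0 : ℝ) ≤ N := N.cast_nonneg
  have h1 : ‖y N - (N : ℝ) • p‖ ≤ 8 * √N := by
    have h8 : (8 * √(N : ℝ)) ^ 2 = 64 * N := by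
      rw [mul_pow, Real.sq_sqrt hNpos]; norm_num
    exact abs_le_of_sq_le_sq' (by rw [h8]; exact hgr) (by positivity) |>.2
  have h2 : inner ℝ a (y N) = N * inner ℝ a p + inner ℝ a (y N - (N : ℝ) • p) := by
    rw [inner_sub_right, real_inner_smul_right]; ring
  have h3 : -(4 * (8 * √N)) ≤ inner ℝ a (y N - (N : ℝ) • p) := by
    have h4 : ‖a‖ * ‖y N - (N : ℝ) • p‖ ≤ 4 * (8 * √N) :=
      mul_le_mul (hnorm a ha) h1 (norm_nonneg _) (by norm_num)
    have := abs_le.1 (abs_real_inner_le_norm a (y N - (N : ℝ) • p))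
    linarith [this.1]
  have h5 : (N : ℝ) * ‖p‖ ^ 2 ≤ N * inner ℝ a p := mul_le_mul_of_nonneg_left (hpa a ha) hNpos
  have h6 := hN _ hcard
  set Z : ℝ := (Fintype.card ι : ℝ) * ((Fintype.card ι).factorial * 16 ^ Fintype.card ι) with hZ
  have hZ0 : 0 ≤ Z := by positivity
  have h7 : 32 * Z < √N := by
    apply Real.lt_sqrt_of_sq_lt
    linarith [show (32 * Z) ^ 2 = 1024 * Z ^ 2 by ring]
  have h8 : 32 < ‖p‖ ^ 2 * √N := by nlinarith
  have h9 : √(N : ℝ) * √N = N := Real.mul_self_sqrt hNpos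
  have h10 : 0 < √(N : ℝ) := by linarith
  -- The main term of `⟪a, y N⟫` beats the error `4 · 8√N`; this needs `√N > 32 / ‖p‖²`, whence the
  -- constant `1024` in `hN`.
  have h11 : 32 * √N < N * ‖p‖ ^ 2 := by
    calc 32 * √N < (‖p‖ ^ 2 * √N) * √N := by gcongr
      _ = N * ‖p‖ ^ 2 := by rw [mul_assoc, h9, mul_comm]
  rw [h2]
  linarith

end Separation

/-- Four indices `p, q, r, s`, which stand for the constraint `y p + y q > y r + y s`. -/
abbrev Quad := ℕ × ℕ × ℕ × ℕ

namespace Quad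

def val {R : Type*} [AddCommGroup R] (q : Quad) (y : ℕ → R) : R :=
  y q.1 + y q.2.1 - y q.2.2.1 - y q.2.2.2

/-- The four indices need not be distinct, and coefficients of coinciding indices add up.
Comparisons of two positions and comparisons with a midpoint are both of this form. -/
def coeff (q : Quad) (i : ℕ) : ℤ :=
  (if i = q.1 then 1 else 0) + (if i = q.2.1 then 1 else 0) - (if i = q.2.2.1 then 1 else 0) -
    (if i = q.2.2.2 then 1 else 0)

def Below (q : Quad) (B : ℕ) : Prop := q.1 < B ∧ q.2.1 < B ∧ q.2.2.1 < B ∧ q.2.2.2 < B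

noncomputable def vec (q : Quad) (B : ℕ) : EuclideanSpace ℝ (Fin B) :=
  WithLp.toLp 2 fun i => (q.coeff i : ℝ)

theorem inner_vec {B : ℕ} (q : Quad) (hq : q.Below B) (y : ℕ → ℝ) :
    inner ℝ (q.vec B) (WithLp.toLp 2 fun i : Fin B => y i) = q.val y := by
  obtain ⟨h1, h2, h3, h4⟩ := hq
  have key : ∀ k < B, ∑ i : Fin B, (if (i : ℕ) = k then y i else 0) = y k := by
    intro k hk
    rw [Finset.sum_eq_single ⟨k, hk⟩]
    · simp
    · intro b _ hb
      rw [if_neg]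
      exact fun h => hb (Fin.ext h)
    · simp
  simp only [PiLp.inner_apply, vec, coeff, val]
  rw [← key _ h1, ← key _ h2, ← key _ h3, ← key _ h4, ← Finset.sum_add_distrib,
    ← Finset.sum_sub_distrib, ← Finset.sum_sub_distrib]
  apply Finset.sum_congr rfl
  intro i _
  push_cast
  simp only [RCLike.inner_apply, conj_trivial]
  split_ifs <;> ring

theorem abs_coeff_le (q : Quad) (i : ℕ) : |q.coeff i| ≤ 2 := by
  unfold coeff
  split_ifs <;> simp

end Quad
end LLOC

/-! ### Greedy sequences of integral positions -/

namespace LLOC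
namespace Quad

/-- The squared norm is the value of `q` at its own coefficients: four terms of size at most 2. -/
theorem norm_vec_le {B : ℕ} (q : Quad) (hq : q.Below B) : ‖q.vec B‖ ≤ 4 := by
  have h1 : ‖q.vec B‖ ^ 2 = q.val (fun i => (q.coeff i : ℝ)) := by
    rw [← real_inner_self_eq_norm_sq]
    exact inner_vec q hq fun i => (q.coeff i : ℝ)
  have h2 : q.val (fun i => (q.coeff i : ℝ)) ≤ 8 := by
    have h : ∀ i, |(q.coeff i : ℝ)| ≤ 2 := fun i => by exact_mod_cast q.abs_coeff_le i
    simp only [val]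
    linarith [(abs_le.1 (h q.1)).2, (abs_le.1 (h q.2.1)).2, (abs_le.1 (h q.2.2.1)).1,
      (abs_le.1 (h q.2.2.2)).1]
  nlinarith [norm_nonneg (q.vec B)]

end Quad

/-- A number of greedy steps that suffices for `B` points. -/
def steps (B : ℕ) : ℕ := (16 * B) ^ (4 * B + 8)

theorem lt_steps {B s : ℕ} (hB : 0 < B) (hs : s ≤ B) :
    1024 * (s * (s.factorial * 16 ^ s)) ^ 2 < steps B := by
  have h1 : s.factorial ≤ B ^ B :=
    s.factorial_le_pow.trans ((Nat.pow_le_pow_left hs s).trans (Nat.pow_le_pow_right hB hs))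
  have h2 : s * (s.factorial * 16 ^ s) ≤ (16 * B) ^ (B + 1) := by
    calc s * (s.factorial * 16 ^ s) ≤ B * (B ^ B * 16 ^ B) := by gcongr; norm_num
      _ ≤ (16 * B) * (B ^ B * 16 ^ B) := by gcongr; omega
      _ = (16 * B) ^ (B + 1) := by rw [pow_succ, mul_pow]; ring
  calc 1024 * (s * (s.factorial * 16 ^ s)) ^ 2 ≤ 1024 * ((16 * B) ^ (B + 1)) ^ 2 := by gcongr
    _ < (16 * B) ^ 4 * ((16 * B) ^ (B + 1)) ^ 2 := by
      have : 16 ^ 4 ≤ (16 * B) ^ 4 := Nat.pow_le_pow_left (by omega) 4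
      have h3 : 0 < ((16 * B) ^ (B + 1)) ^ 2 := by positivity
      exact Nat.mul_lt_mul_of_pos_right (by omega) h3
    _ = (16 * B) ^ (2 * B + 6) := by rw [← pow_mul, ← pow_add]; congr 1; ring
    -- The exponent `4 * B + 8` exceeds `2 * B + 6` generously, since `steps B` must also bound the
    -- number `B ^ (4 * (B + 1))` of codes.
    _ ≤ steps B := Nat.pow_le_pow_right (by omega) (by omega)

/-- `y` is a sequence of positions of `B` points that starts at `0`, and moves in each step in the
direction of a constraint among `S 0, …, S B` that is satisfied least. -/
structure IsGreedy (B : ℕ) (S : ℕ → Quad) (N : ℕ) (y : ℕ → ℕ → ℤ) : Prop where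
  zero : ∀ i < B, y 0 i = 0
  step : ∀ t < N, ∃ j ≤ B, (∀ i < B, y (t + 1) i = y t i + (S j).coeff i) ∧
    ∀ k ≤ B, (S j).val (y t) ≤ (S k).val (y t)

/-- Every sign pattern of `B` points on the line is obtained by greedy steps for some `B + 1`
constraints. -/
theorem exists_greedy_pattern (B : ℕ) (hB : 0 < B) (F : ℕ → ℝ) :
    ∃ S : ℕ → Quad, (∀ j, (S j).Below B) ∧ ∀ y, IsGreedy B S (steps B) y →
      ∀ q : Quad, q.Below B → 0 < q.val F → 0 < q.val (y (steps B)) := by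
  by_cases hne : ∃ q : Quad, q.Below B ∧ 0 < q.val F
  swap
  · refine ⟨fun _ => (0, 0, 0, 0), fun _ => ⟨hB, hB, hB, hB⟩, fun y _ q hq hF => ?_⟩
    exact absurd ⟨q, hq, hF⟩ hne
  set Q : Set Quad := {q | q.Below B ∧ 0 < q.val F} with hQ
  have hfin : Q.Finite := by
    apply Set.Finite.subset (((Set.finite_Iio B).prod ((Set.finite_Iio B).prod
      ((Set.finite_Iio B).prod (Set.finite_Iio B)))))
    rintro q ⟨⟨h1, h2, h3, h4⟩, -⟩
    exact ⟨h1, h2, h3, h4⟩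
  have hrank : Module.finrank ℝ (EuclideanSpace ℝ (Fin B)) = B := finrank_euclideanSpace_fin
  -- The quadruples that are positive at `F` have their vectors in the open half space with normal
  -- `F`.
  obtain ⟨S, hS, hsep⟩ := exists_greedy_separation ((fun q : Quad => q.vec B) '' Q)
    (hfin.image _) (by obtain ⟨q, h⟩ := hne; exact ⟨_, q, h, rfl⟩)
    (by rintro _ ⟨q, hq, rfl⟩; exact q.norm_vec_le hq.1)
    (by
      rintro _ ⟨q, hq, rfl⟩ _ ⟨r, hr, rfl⟩
      refine ⟨q.val r.coeff, ?_⟩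
      have := Quad.inner_vec q hq.1 fun i => (r.coeff i : ℝ)
      simp only [Quad.vec] at this ⊢
      rw [this]
      simp [Quad.val])
    (WithLp.toLp 2 fun i : Fin B => F i)
    (by rintro _ ⟨q, hq, rfl⟩; rw [Quad.inner_vec q hq.1]; exact hq.2)
    (steps B) (by
      intro s hs
      rw [hrank] at hs
      exact_mod_cast lt_steps hB hs)
  choose R hR hRS using hS
  refine ⟨R, fun j => (hR j).1, fun y hy q hq hF => ?_⟩
  have hcast : ∀ (r : Quad) (t : ℕ), (r.val fun i => (y t i : ℝ)) = (r.val (y t) : ℤ) := by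
    intro r t
    simp [Quad.val]
  have := hsep (fun t => WithLp.toLp 2 fun i : Fin B => (y t i : ℝ))
    (by ext i; simp [hy.zero i i.2])
    (by
      intro t ht
      obtain ⟨j, hj, hj1, hj2⟩ := hy.step t ht
      rw [hrank]
      refine ⟨j, hj, ?_, fun i hi => ?_⟩
      · rw [← hRS]
        ext i
        simp [hj1 i i.2, Quad.vec]
      · rw [← hRS, ← hRS, Quad.inner_vec _ (hR j).1 fun i => (y t i : ℝ),
          Quad.inner_vec _ (hR i).1 fun i => (y t i : ℝ), hcast, hcast]
        exact_mod_cast hj2 i hi) (q.vec B) ⟨q, ⟨hq, hF⟩, rfl⟩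
  rw [Quad.inner_vec q hq fun i => (y (steps B) i : ℝ), hcast] at this
  exact_mod_cast this

/-- The order of two distances is determined by the signs of quadruples. -/
theorem abs_sub_lt_abs_sub {B : ℕ} {F : ℕ → ℝ} {y : ℕ → ℤ}
    (h : ∀ q : Quad, q.Below B → 0 < q.val F → 0 < q.val y) {i j k : ℕ} (hi : i < B) (hj : j < B)
    (hk : k < B) (hF : |F i - F j| < |F i - F k|) : |y i - y j| < |y i - y k| := by
  -- For `F k ≤ F i` the comparison of distances says `F k < F j` and `F j + F k < 2 F i`, which are
  -- the first and the third quadruple; the other two are the mirror image.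
  have h1 := h (i, j, i, k) ⟨hi, hj, hi, hk⟩
  have h2 := h (i, k, i, j) ⟨hi, hk, hi, hj⟩
  have h3 := h (i, i, j, k) ⟨hi, hi, hj, hk⟩
  have h4 := h (j, k, i, i) ⟨hj, hk, hi, hi⟩
  simp only [Quad.val] at h1 h2 h3 h4
  obtain ⟨ha, hb⟩ := abs_lt.1 hF
  rcases le_total 0 (F i - F k) with hs | hs
  · rw [abs_of_nonneg hs] at ha hb
    have h1' := h1 (by linarith)
    have h3' := h3 (by linarith)
    refine lt_of_lt_of_le ?_ (le_abs_self _)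
    rw [abs_lt]
    constructor <;> linarith
  · rw [abs_of_nonpos hs] at ha hb
    have h2' := h2 (by linarith)
    have h4' := h4 (by linarith)
    refine lt_of_lt_of_le ?_ (neg_le_abs _)
    rw [abs_lt]
    constructor <;> linarith

end LLOC

/-! ### Bucketing the points by the number of farther points -/

namespace LLOC

open Filter Topology in
/-- The points may be assumed to have distinct images. -/
theorem exists_injective_satisfies {n : ℕ} (f : Fin n → ℝ) :
    ∃ g : Fin n → ℝ, Function.Injective g ∧ ∀ c, Satisfies f c → Satisfies g c := by
  -- Add `t · i` to the image of the point `i`: for small `t > 0` strict inequalities persist and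
  -- ties are broken.
  have h1 : ∀ᶠ t : ℝ in 𝓝[>] 0, ∀ c, Satisfies f c →
      Satisfies (fun i => f i + t * ((i : ℕ) : ℝ)) c := by
    rw [eventually_all]
    intro c
    by_cases hc : Satisfies f c
    · have : ∀ᶠ t : ℝ in 𝓝 0, Satisfies (fun i => f i + t * ((i : ℕ) : ℝ)) c := by
        apply ContinuousAt.eventually_lt
        · fun_prop
        · fun_prop
        · simpa [Satisfies] using hc
      exact (this.filter_mono nhdsWithin_le_nhds).mono fun t ht _ => ht
    · exact Eventually.of_forall fun t h => absurd h hc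
  have h2 : ∀ᶠ t : ℝ in 𝓝[>] 0, ∀ i j : Fin n, i ≠ j →
      f i + t * ((i : ℕ) : ℝ) ≠ f j + t * ((j : ℕ) : ℝ) := by
    rw [eventually_all]
    intro i
    rw [eventually_all]
    intro j
    by_cases hij : f i = f j
    · filter_upwards [self_mem_nhdsWithin] with t ht hne heq
      rw [hij, add_right_inj, mul_right_inj' (ne_of_gt ht)] at heq
      exact hne (Fin.ext (by exact_mod_cast heq))
    · have hc : ContinuousAt (fun t : ℝ =>
          (f i + t * ((i : ℕ) : ℝ)) - (f j + t * ((j : ℕ) : ℝ))) 0 := by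
        fun_prop
      have := hc.eventually_ne (show _ ≠ (0 : ℝ) by simpa [sub_eq_zero] using hij)
      exact (this.filter_mono nhdsWithin_le_nhds).mono fun t ht _ => sub_ne_zero.1 ht
  obtain ⟨t, ht1, ht2⟩ := (h1.and h2).exists
  exact ⟨_, fun i j hij => by_contra fun hne => ht2 i j hne hij, ht1⟩

/-! ### Ranks of points on the line -/

section Ranks

variable {n : ℕ}

theorem card_rank_mem_Ico_le {ρ : Fin n → ℕ} (hρ : Function.Injective ρ) (a b : ℕ) :
    (Finset.univ.filter fun v => a ≤ ρ v ∧ ρ v < b).card ≤ b - a := by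
  rw [← Nat.card_Ico]
  apply Finset.card_le_card_of_injOn ρ
  · intro v hv
    simpa using hv
  · exact hρ.injOn

theorem card_rank_lt {ρ : Fin n → ℕ} (hρ : Function.Injective ρ) (hn : ∀ v, ρ v < n) {r : ℕ}
    (hr : r ≤ n) : (Finset.univ.filter fun v => ρ v < r).card = r := by
  have himg : Finset.univ.image ρ = Finset.range n := by
    apply Finset.eq_of_subset_of_card_le
    · intro x hx
      obtain ⟨v, -, rfl⟩ := Finset.mem_image.1 hx
      exact Finset.mem_range.2 (hn v)
    · rw [Finset.card_image_of_injective _ hρ]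
      simp
  have : (Finset.univ.filter fun v => ρ v < r).image ρ = Finset.range r := by
    ext x
    simp only [Finset.mem_image, Finset.mem_filter, Finset.mem_univ, true_and, Finset.mem_range]
    constructor
    · rintro ⟨v, hv, rfl⟩
      exact hv
    · intro hx
      have : x ∈ Finset.univ.image ρ := by
        rw [himg, Finset.mem_range]; omega
      obtain ⟨v, -, rfl⟩ := Finset.mem_image.1 this
      exact ⟨v, hx, rfl⟩
  rw [← Finset.card_image_of_injective _ hρ, this, Finset.card_range]

/-- The number of points to the left of `v`. -/
noncomputable def rank (f : Fin n → ℝ) (v : Fin n) : ℕ :=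
  (Finset.univ.filter fun w => f w < f v).card

theorem rank_lt_rank {f : Fin n → ℝ} {v w : Fin n} (h : f v < f w) : rank f v < rank f w := by
  apply Finset.card_lt_card
  rw [Finset.ssubset_iff_of_subset]
  · exact ⟨v, by simpa using h, by simp⟩
  · intro x hx
    simp only [Finset.mem_filter, Finset.mem_univ, true_and] at hx ⊢
    exact hx.trans h

theorem rank_lt_rank_iff {f : Fin n → ℝ} {v w : Fin n} : rank f v < rank f w ↔ f v < f w := by
  refine ⟨fun h => ?_, rank_lt_rank⟩
  by_contra hc
  rcases (not_lt.1 hc).lt_or_eq with h' | h'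
  · exact absurd (rank_lt_rank h') (by omega)
  · simp [rank, h'] at h

theorem rank_injective {f : Fin n → ℝ} (hf : Function.Injective f) :
    Function.Injective (rank f) := by
  intro v w h
  apply hf
  rcases lt_trichotomy (f v) (f w) with h' | h' | h'
  · have := rank_lt_rank h'; omega
  · exact h'
  · have := rank_lt_rank h'; omega

theorem rank_lt (f : Fin n → ℝ) (v : Fin n) : rank f v < n := by
  calc rank f v < (Finset.univ : Finset (Fin n)).card := by
        apply Finset.card_lt_card
        rw [Finset.ssubset_iff_of_subset (Finset.subset_univ _)]
        exact ⟨v, Finset.mem_univ _, by simp⟩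
    _ = n := by simp

end Ranks

/-! ### Constraints that change when points move within their buckets -/

section Ambiguous

variable {n : ℕ}

/-- A set of triples of which no two lie on a common line in the direction `(-1, 1, 1)`, at a
distance that is a multiple of `w`. -/
theorem card_le_of_chains {P : Fin n → ℕ} (hP : Function.Injective P) (hPn : ∀ v, P v < n) {w : ℕ}
    (hw : 0 < w) (A : Finset (Fin n × Fin n × Fin n))
    (hA : ∀ c ∈ A, ∀ d ∈ A, P d.1 + w ≤ P c.1 → P c.2.1 + w ≤ P d.2.1 → P c.2.2 + w ≤ P d.2.2 →
      False) : A.card ≤ 4 * n ^ 2 * w := by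
  have hmod : ∀ a b : ℕ, a % w = b % w → a < b → a + w ≤ b := by
    intro a b h hab
    have h1 : w ∣ b - a := (Nat.modEq_iff_dvd' hab.le).1 h
    have := Nat.le_of_dvd (by omega) h1
    omega
  have : A.card ≤ (Finset.range (2 * n) ×ˢ Finset.range (2 * n) ×ˢ Finset.range w).card := by
    -- Two triples with the same key differ by a multiple of `w` times `(-1, 1, 1)`, so the
    -- hypothesis makes the key injective.
    apply Finset.card_le_card_of_injOn fun c => (P c.1 + P c.2.1, P c.1 + P c.2.2, P c.1 % w)
    · intro c _
      have h1 := hPn c.1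
      have h2 := hPn c.2.1
      have h3 := hPn c.2.2
      have h4 := Nat.mod_lt (P c.1) hw
      simp only [Finset.coe_product, Finset.coe_range, Set.mem_prod, Set.mem_Iio]
      omega
    · intro c hc d hd h
      simp only [Prod.mk.injEq] at h
      obtain ⟨h1, h2, h3⟩ := h
      rcases lt_trichotomy (P c.1) (P d.1) with hl | hl | hl
      · have := hmod _ _ h3 hl
        exact (hA d hd c hc this (by omega) (by omega)).elim
      · have e1 := hP hl
        have e2 := hP (show P c.2.1 = P d.2.1 by omega)
        have e3 := hP (show P c.2.2 = P d.2.2 by omega)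
        exact Prod.ext e1 (Prod.ext e2 e3)
      · have := hmod _ _ h3.symm hl
        exact (hA c hc d hd this (by omega) (by omega)).elim
  refine this.trans (le_of_eq ?_)
  simp only [Finset.card_product, Finset.card_range]
  ring

theorem card_fst_filter (p : Fin n → Fin n → Prop) [∀ a b, Decidable (p a b)] {k : ℕ}
    (h : ∀ a, (Finset.univ.filter (p a)).card ≤ k) :
    (Finset.univ.filter fun c : Fin n × Fin n => p c.1 c.2).card ≤ n * k := by
  rw [Finset.card_filter, Fintype.sum_prod_type]
  calc ∑ a, ∑ b, (if p a b then 1 else 0) ≤ ∑ _a : Fin n, k := by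
        apply Finset.sum_le_sum
        intro a _
        rw [← Finset.card_filter]
        exact h a
    _ = n * k := by simp

open Classical in
/-- Moving all points within their buckets (intervals of `w` consecutive points) affects few
constraints. -/
theorem card_ambiguous_le {f g : Fin n → ℝ} (hf : Function.Injective f) {w : ℕ} (hw : 0 < w)
    (hg : ∀ v, ∃ z, rank f z / w = rank f v / w ∧ g v = f z) :
    (Finset.univ.filter fun c : Fin n × Fin n × Fin n =>
      c.1 ≠ c.2.1 ∧ c.1 ≠ c.2.2 ∧ c.2.1 ≠ c.2.2 ∧ Satisfies f c ∧ ¬ Satisfies g c).card ≤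
      19 * n ^ 2 * (w - 1) := by
  have hP := rank_injective hf
  set b : Fin n → ℕ := fun v => rank f v / w with hb
  have hfb : ∀ x v, b x < b v → f x < f v := by
    intro x v h
    rw [← rank_lt_rank_iff]
    exact lt_of_not_ge fun hc => absurd (Nat.div_le_div_right (c := w) hc) (not_le.2 h)
  have hgf : ∀ x v, b x < b v → g x < f v := by
    intro x v h
    obtain ⟨z, hz, hz'⟩ := hg x
    rw [hz']
    exact hfb _ _ (by simp only [hb] at h ⊢; omega)
  have hfg : ∀ x v, b x < b v → f x < g v := by
    intro x v h
    obtain ⟨z, hz, hz'⟩ := hg v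
    rw [hz']
    exact hfb _ _ (by simp only [hb] at h ⊢; omega)
  have hgg : ∀ x v, b x ≠ b v → f x < f v → g x < g v := by
    intro x v hne h
    have hlt : b x < b v := by
      refine lt_of_le_of_ne (Nat.div_le_div_right (rank_lt_rank h).le) hne
    obtain ⟨z, hz, hz'⟩ := hg x
    rw [hz']
    exact hfg _ _ (by simp only [hb] at hlt ⊢; omega)
  have hbw : ∀ x v, rank f x + w ≤ rank f v → b x < b v := by
    intro x v h
    have : (rank f x + w) / w ≤ rank f v / w := Nat.div_le_div_right h
    rw [Nat.add_div_right _ hw] at this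
    exact this
  -- The bound has the factor `w - 1`, so buckets of one point must be free of errors; for `w ≥ 2`
  -- the factor `w` is at most `2 * (w - 1)`.
  rcases Nat.lt_or_ge 1 w with hw1 | hw1
  swap
  · have hw' : w = 1 := by omega
    subst hw'
    have hgf : g = f := by
      ext v
      obtain ⟨z, hz, hz'⟩ := hg v
      rw [Nat.div_one, Nat.div_one] at hz
      rw [hz', hP hz]
    rw [Finset.filter_false_of_mem]
    · simp
    · rintro c - ⟨-, -, -, h1, h2⟩
      rw [hgf] at h2
      exact h2 h1
  have hpair : ∀ x, (Finset.univ.filter fun v => x ≠ v ∧ b x = b v).card ≤ w - 1 := by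
    intro x
    have h1 : (Finset.univ.filter fun v => x ≠ v ∧ b x = b v) =
        (Finset.univ.filter fun v => b x = b v).erase x := by
      ext v
      simp [eq_comm]
    rw [h1, Finset.card_erase_of_mem (by simp)]
    apply Nat.sub_le_sub_right
    refine (Finset.card_le_card ?_).trans ((card_rank_mem_Ico_le hP (b x * w) (b x * w + w)).trans
      (by omega))
    intro v hv
    simp only [Finset.mem_filter, Finset.mem_univ, true_and, hb] at hv ⊢
    rw [hv]
    refine ⟨Nat.div_mul_le_self _ _, ?_⟩
    have := Nat.lt_div_mul_add (a := rank f v) hw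
    exact this
  have hpairs := card_fst_filter (fun x v => x ≠ v ∧ b x = b v) hpair
  set E := Finset.univ.filter fun c : Fin n × Fin n => c.1 ≠ c.2 ∧ b c.1 = b c.2 with hE
  set A1 := Finset.univ.filter fun c : Fin n × Fin n × Fin n =>
    2 * f c.1 < f c.2.1 + f c.2.2 ∧ g c.2.1 + g c.2.2 ≤ 2 * g c.1 with hA1
  set A2 := Finset.univ.filter fun c : Fin n × Fin n × Fin n =>
    f c.2.1 + f c.2.2 < 2 * f c.1 ∧ 2 * g c.1 ≤ g c.2.1 + g c.2.2 with hA2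
  -- For `c` and `d` as in `card_le_of_chains`, passing from `f` on `c` to `g` on `d` moves the
  -- first point left and the two others right. So the strict inequality of `c` for `f` contradicts
  -- the reverse one of `d` for `g`.
  have c1 : A1.card ≤ 4 * n ^ 2 * w := by
    apply card_le_of_chains hP (rank_lt f) hw
    intro c hc d hd h1 h2 h3
    simp only [hA1, Finset.mem_filter, Finset.mem_univ, true_and] at hc hd
    have := hgf _ _ (hbw _ _ h1)
    have := hfg _ _ (hbw _ _ h2)
    have := hfg _ _ (hbw _ _ h3)
    linarith [hc.1, hd.2]
  have c2 : A2.card ≤ 4 * n ^ 2 * w := by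
    apply card_le_of_chains hP (rank_lt f) hw
    intro c hc d hd h1 h2 h3
    simp only [hA2, Finset.mem_filter, Finset.mem_univ, true_and] at hc hd
    have := hfg _ _ (hbw _ _ h1)
    have := hgf _ _ (hbw _ _ h2)
    have := hgf _ _ (hbw _ _ h3)
    linarith [hc.2, hd.1]
  have hsub : (Finset.univ.filter fun c : Fin n × Fin n × Fin n =>
      c.1 ≠ c.2.1 ∧ c.1 ≠ c.2.2 ∧ c.2.1 ≠ c.2.2 ∧ Satisfies f c ∧ ¬ Satisfies g c) ⊆
      ((E ×ˢ (Finset.univ : Finset (Fin n))).image fun c => (c.1.1, c.1.2, c.2)) ∪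
      ((E ×ˢ (Finset.univ : Finset (Fin n))).image fun c => (c.1.1, c.2, c.1.2)) ∪
      ((E ×ˢ (Finset.univ : Finset (Fin n))).image fun c => (c.2, c.1.1, c.1.2)) ∪ A1 ∪ A2 := by
    rintro ⟨x, v, w'⟩ hc
    simp only [Finset.mem_filter, Finset.mem_univ, true_and] at hc
    obtain ⟨h1, h2, h3, hs, hns⟩ := hc
    simp only [Finset.mem_union, Finset.mem_image, Finset.mem_product, Finset.mem_univ, and_true,
      hE, Finset.mem_filter, true_and, Prod.exists, Prod.mk.injEq]
    by_cases e1 : b x = b v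
    · exact Or.inl (Or.inl (Or.inl (Or.inl ⟨x, v, w', ⟨h1, e1⟩, rfl, rfl, rfl⟩)))
    by_cases e2 : b x = b w'
    · exact Or.inl (Or.inl (Or.inl (Or.inr ⟨x, w', v, ⟨h2, e2⟩, rfl, rfl, rfl⟩)))
    by_cases e3 : b v = b w'
    · exact Or.inl (Or.inl (Or.inr ⟨v, w', x, ⟨h3, e3⟩, rfl, rfl, rfl⟩))
    simp only [Satisfies, not_lt] at hs hns
    -- Three different buckets, so the order is preserved. With the pivot at one end the constraint
    -- depends on the order alone and cannot flip; with the pivot in the middle it compares the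
    -- pivot with the midpoint, which leads to `A1` or `A2`.
    rcases lt_or_gt_of_ne (hf.ne h1) with o1 | o1 <;> rcases lt_or_gt_of_ne (hf.ne h2) with o2 | o2
    · have g1 := hgg _ _ e1 o1
      have g2 := hgg _ _ e2 o2
      rw [abs_of_neg (by linarith), abs_of_neg (by linarith)] at hs hns
      have := hgg _ _ e3 (by linarith)
      linarith
    · have g1 := hgg _ _ e1 o1
      have g2 := hgg _ _ (Ne.symm e2) o2
      rw [abs_of_neg (by linarith), abs_of_pos (by linarith)] at hs
      rw [abs_of_pos (by linarith), abs_of_neg (by linarith)] at hns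
      refine Or.inr ?_
      simp only [hA2, Finset.mem_filter, Finset.mem_univ, true_and]
      constructor <;> linarith
    · have g1 := hgg _ _ (Ne.symm e1) o1
      have g2 := hgg _ _ e2 o2
      rw [abs_of_pos (by linarith), abs_of_neg (by linarith)] at hs
      rw [abs_of_neg (by linarith), abs_of_pos (by linarith)] at hns
      refine Or.inl (Or.inr ?_)
      simp only [hA1, Finset.mem_filter, Finset.mem_univ, true_and]
      constructor <;> linarith
    · have g1 := hgg _ _ (Ne.symm e1) o1
      have g2 := hgg _ _ (Ne.symm e2) o2
      rw [abs_of_pos (by linarith), abs_of_pos (by linarith)] at hs hns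
      have := hgg _ _ (Ne.symm e3) (by linarith)
      linarith
  have himg : ∀ φ : (Fin n × Fin n) × Fin n → Fin n × Fin n × Fin n,
      ((E ×ˢ (Finset.univ : Finset (Fin n))).image φ).card ≤ n ^ 2 * (w - 1) := by
    intro φ
    refine Finset.card_image_le.trans ?_
    rw [Finset.card_product, Finset.card_univ, Fintype.card_fin]
    calc E.card * n ≤ n * (w - 1) * n := by gcongr
      _ = n ^ 2 * (w - 1) := by ring
  refine (Finset.card_le_card hsub).trans ?_
  have u1 : ∀ s t : Finset (Fin n × Fin n × Fin n), (s ∪ t).card ≤ s.card + t.card :=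
    Finset.card_union_le
  refine (u1 _ _).trans ((Nat.add_le_add_right ((u1 _ _).trans (Nat.add_le_add_right
    ((u1 _ _).trans (Nat.add_le_add_right (u1 _ _) _)) _)) _).trans ?_)
  refine (Nat.add_le_add (Nat.add_le_add (Nat.add_le_add (Nat.add_le_add (himg _) (himg _))
    (himg _)) c1) c2).trans ?_
  have : 4 * n ^ 2 * w ≤ 4 * n ^ 2 * (2 * (w - 1)) := Nat.mul_le_mul_left _ (by omega)
  calc _ ≤ n ^ 2 * (w - 1) + n ^ 2 * (w - 1) + n ^ 2 * (w - 1) + 4 * n ^ 2 * (2 * (w - 1)) +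
        4 * n ^ 2 * (2 * (w - 1)) := by omega
    _ = 19 * n ^ 2 * (w - 1) := by ring

end Ambiguous
end LLOC

/-! ### Buckets read off from the constraints at a center -/

namespace LLOC

open Classical in
/-- The number of points that are farther from `u` than `v` according to the constraints. -/
noncomputable def farCount {n : ℕ} (T : Constraints n) (u v : Fin n) : ℕ :=
  (Finset.univ.filter fun x => (u, v, x) ∈ T).card

/-- The bucket of `v`, for `m` buckets by the distance from `u` and one more bucket for `u`. -/
noncomputable def bucketOf {n : ℕ} (T : Constraints n) (m : ℕ) (u v : Fin n) : ℕ :=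
  if v = u then m else farCount T u v / (n / m + 1)

open Classical in
/-- The constraints that `f` violates. -/
noncomputable def violated {n : ℕ} (T : Constraints n) (f : Fin n → ℝ) : Constraints n :=
  T.filter fun c => ¬ Satisfies f c

theorem farCount_le {n : ℕ} (T : Constraints n) (u v : Fin n) : farCount T u v ≤ n := by
  refine (Finset.card_le_univ _).trans ?_
  simp

theorem lt_mul_div_add_one {n m a : ℕ} (hm : 0 < m) (ha : a ≤ n) : a < m * (n / m + 1) := by
  have := Nat.lt_mul_div_succ n hm
  omega

theorem bucketOf_lt {n : ℕ} (T : Constraints n) {m : ℕ} (hm : 0 < m) (u v : Fin n) :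
    bucketOf T m u v < m + 1 := by
  unfold bucketOf
  split
  · omega
  · have : farCount T u v / (n / m + 1) < m := by
      rw [Nat.div_lt_iff_lt_mul (Nat.succ_pos _)]
      exact lt_mul_div_add_one hm (farCount_le T u v)
    omega

/-- Two numbers in different intervals of length `w` are separated by a multiple of `w`. -/
theorem exists_mul_between {a b t w m : ℕ} (hw : 0 < w) (h1 : a ≤ b + t) (h2 : b ≤ a + t)
    (hab : a / w ≠ b / w) (ha : a < m * w) (hb : b < m * w) :
    ∃ j < m, j * w - t ≤ b ∧ b < j * w + t := by
  rcases lt_or_gt_of_ne hab with h | h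
  · refine ⟨b / w, (Nat.div_lt_iff_lt_mul hw).2 hb, ?_, ?_⟩
    · have := Nat.div_mul_le_self b w
      omega
    · have := (Nat.div_lt_iff_lt_mul hw).1 h
      omega
  · refine ⟨a / w, (Nat.div_lt_iff_lt_mul hw).2 ha, ?_, ?_⟩
    · have := Nat.div_mul_le_self a w
      omega
    · have := (Nat.div_lt_iff_lt_mul hw).1 h
      have := Nat.div_mul_le_self a w
      omega

section

variable {n : ℕ}

open Classical in
/-- The number of elements of `X` whose first coordinate is `u`. -/
noncomputable def fiber (X : Constraints n) (u : Fin n) : ℕ :=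
  ∑ v, ∑ w, if (u, v, w) ∈ X then 1 else 0

theorem sum_fiber (X : Constraints n) : ∑ u, fiber X u = X.card := by
  classical
  have : X.card = ∑ c, if c ∈ X then 1 else 0 := by simp
  rw [this, Fintype.sum_prod_type]
  apply Finset.sum_congr rfl
  intro u _
  rw [fiber, Fintype.sum_prod_type]

/-- Some point of `L` has at most average fiber. -/
theorem exists_mul_fiber_le (X : Constraints n) (L : Finset (Fin n)) (hL : L.Nonempty) :
    ∃ u ∈ L, L.card * fiber X u ≤ X.card := by
  obtain ⟨u, hu, hmin⟩ := L.exists_min_image (fiber X) hL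
  refine ⟨u, hu, ?_⟩
  calc L.card * fiber X u = ∑ _v ∈ L, fiber X u := by simp
    _ ≤ ∑ v ∈ L, fiber X v := Finset.sum_le_sum hmin
    _ ≤ ∑ v, fiber X v := Finset.sum_le_univ_sum_of_nonneg fun _ => Nat.zero_le _
    _ = X.card := sum_fiber X

open Classical in
/-- The number of constraints of `X` that compare `v` with another point from `u`. -/
noncomputable def conflicts (X : Constraints n) (u v : Fin n) : ℕ :=
  (Finset.univ.filter fun w => (u, v, w) ∈ X ∨ (u, w, v) ∈ X).card

/-- Each triple `(u, v, w)` is counted at most once for `v` and once for `w`. -/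
theorem sum_conflicts_le (X : Constraints n) (u : Fin n) :
    ∑ v, conflicts X u v ≤ 2 * fiber X u := by
  classical
  calc ∑ v, conflicts X u v
      ≤ ∑ v, ((∑ w, if (u, v, w) ∈ X then 1 else 0) + ∑ w, if (u, w, v) ∈ X then 1 else 0) := by
        apply Finset.sum_le_sum
        intro v _
        rw [← Finset.card_filter, ← Finset.card_filter, conflicts, Finset.filter_or]
        exact Finset.card_union_le _ _
    _ = 2 * fiber X u := by
      rw [Finset.sum_add_distrib, Finset.sum_comm (f := fun v w => if (u, w, v) ∈ X then 1 else 0),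
        two_mul]
      rfl

-- Markov's inequality for the conflicts at `u`.
open Classical in
theorem card_conflicts_gt_mul_le (X : Constraints n) (u : Fin n) (τ : ℕ) :
    (Finset.univ.filter fun v => τ < conflicts X u v).card * (τ + 1) ≤ 2 * fiber X u := by
  refine le_trans ?_ (sum_conflicts_le X u)
  calc _ = ∑ _v ∈ Finset.univ.filter (fun v => τ < conflicts X u v), (τ + 1) := by simp
    _ ≤ ∑ v ∈ Finset.univ.filter (fun v => τ < conflicts X u v), conflicts X u v := by
      apply Finset.sum_le_sum
      intro v hv
      exact (Finset.mem_filter.1 hv).2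
    _ ≤ _ := Finset.sum_le_univ_sum_of_nonneg fun _ => Nat.zero_le _

open Classical in
/-- If `u` is among the rightmost points, then the number of points that are farther from `u` than
`v` is about the rank of `v`. -/
theorem farCount_rank {T : Constraints n} (hT : IsDense T) {f : Fin n → ℝ}
    (L : Finset (Fin n)) (hL : ∀ v ∉ L, ∀ x ∈ L, f v < f x) {u : Fin n}
    (hu : u ∈ L) {v : Fin n} (hv : v ∉ L) :
    farCount T u v ≤ rank f v + ((L.card - 1) + conflicts (violated T f) u v) ∧
      rank f v ≤ farCount T u v + ((L.card - 1) + conflicts (violated T f) u v) := by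
  have hvu := hL v hv u hu
  have hne : u ≠ v := fun h => hv (h ▸ hu)
  have hviol : ∀ x y, (u, x, y) ∈ violated T f ↔
      (u, x, y) ∈ T ∧ ¬ |f u - f x| < |f u - f y| := by
    intro x y
    simp [violated, Satisfies]
  rw [← Finset.card_erase_of_mem hu]
  -- The points in question are not to the right of `u`, so farther from `u` means farther left.
  -- Density supplies a constraint for either outcome of the comparison.
  have key : ∀ x, x ∉ L.erase u → ¬ ((u, v, x) ∈ violated T f ∨ (u, x, v) ∈ violated T f) →
      ((u, v, x) ∈ T ↔ f x < f v) := by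
    intro x hxL hx
    rw [not_or, hviol, hviol] at hx
    by_cases hxu : x = u
    · subst hxu
      constructor
      · intro h
        exact absurd rfl (hT.distinct _ _ _ h).2.1
      · intro h
        linarith
    by_cases hxv : x = v
    · subst hxv
      constructor
      · intro h
        exact absurd rfl (hT.distinct _ _ _ h).2.2
      · intro h
        exact absurd h (lt_irrefl _)
    have hxL' : x ∉ L := fun h => hxL (Finset.mem_erase.2 ⟨hxu, h⟩)
    have hxf := hL x hxL' u hu
    rw [abs_of_pos (by linarith), abs_of_pos (by linarith)] at hx
    have hone := hT.exactly_one u v x hne (Ne.symm hxu) (Ne.symm hxv)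
    by_cases hin : (u, v, x) ∈ T
    · simp only [hin, true_and, not_not, true_iff] at hx ⊢
      linarith [hx.1]
    · have hin' : (u, x, v) ∈ T := by
        by_contra h
        exact hin (hone.2 h)
      simp only [hin, hin', true_and, not_not, false_iff] at hx ⊢
      linarith [hx.2]
  constructor
  · have hsub : (Finset.univ.filter fun x => (u, v, x) ∈ T) ⊆
        (Finset.univ.filter fun x => f x < f v) ∪ (L.erase u ∪ Finset.univ.filter fun x =>
          (u, v, x) ∈ violated T f ∨ (u, x, v) ∈ violated T f) := by
      intro x hx
      simp only [Finset.mem_filter, Finset.mem_univ, true_and, Finset.mem_union] at hx ⊢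
      by_cases h1 : x ∈ L.erase u
      · exact Or.inr (Or.inl h1)
      by_cases h2 : (u, v, x) ∈ violated T f ∨ (u, x, v) ∈ violated T f
      · exact Or.inr (Or.inr h2)
      exact Or.inl ((key x h1 h2).1 hx)
    exact (Finset.card_le_card hsub).trans ((Finset.card_union_le _ _).trans
      (Nat.add_le_add_left (Finset.card_union_le _ _) _))
  · have hsub : (Finset.univ.filter fun x => f x < f v) ⊆
        (Finset.univ.filter fun x => (u, v, x) ∈ T) ∪ (L.erase u ∪ Finset.univ.filter fun x =>
          (u, v, x) ∈ violated T f ∨ (u, x, v) ∈ violated T f) := by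
      intro x hx
      simp only [Finset.mem_filter, Finset.mem_univ, true_and, Finset.mem_union] at hx ⊢
      by_cases h1 : x ∈ L.erase u
      · exact Or.inr (Or.inl h1)
      by_cases h2 : (u, v, x) ∈ violated T f ∨ (u, x, v) ∈ violated T f
      · exact Or.inr (Or.inr h2)
      exact Or.inl ((key x h1 h2).2 hx)
    exact (Finset.card_le_card hsub).trans ((Finset.card_union_le _ _).trans
      (Nat.add_le_add_left (Finset.card_union_le _ _) _))

open Classical in
/-- Triples with a coordinate in `s`. -/
theorem card_meets_le (s : Finset (Fin n)) :
    (Finset.univ.filter fun c : Fin n × Fin n × Fin n => c.1 ∈ s ∨ c.2.1 ∈ s ∨ c.2.2 ∈ s).card ≤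
      3 * n ^ 2 * s.card := by
  have hsub : (Finset.univ.filter fun c : Fin n × Fin n × Fin n =>
      c.1 ∈ s ∨ c.2.1 ∈ s ∨ c.2.2 ∈ s) ⊆
      (s ×ˢ (Finset.univ : Finset (Fin n)) ×ˢ (Finset.univ : Finset (Fin n))) ∪
      (((Finset.univ : Finset (Fin n)) ×ˢ s ×ˢ (Finset.univ : Finset (Fin n))) ∪
      ((Finset.univ : Finset (Fin n)) ×ˢ (Finset.univ : Finset (Fin n)) ×ˢ s)) := by
    intro c hc
    simpa using hc
  refine (Finset.card_le_card hsub).trans ((Finset.card_union_le _ _).trans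
    ((Nat.add_le_add_left (Finset.card_union_le _ _) _).trans (le_of_eq ?_)))
  simp only [Finset.card_product, Finset.card_univ, Fintype.card_fin]
  ring

open Classical in
/-- For some point `u`, the points can be placed according to their buckets with few violated
constraints. Here `r` is the number of candidates for `u`, and `τ` is the tolerated number of
conflicts of a point. -/
theorem exists_bucket_placement {T : Constraints n} (hT : IsDense T) {f : Fin n → ℝ}
    (hf : Function.Injective f) {m r : ℕ} (hm : 0 < m) (hr : 0 < r) (hrn : r ≤ n) (τ : ℕ) :
    ∃ (u : Fin n) (F : ℕ → ℝ) (s D : ℕ),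
      (violated T fun v => F (bucketOf T m u v)).card ≤
        (violated T f).card + 3 * n ^ 2 * s + 19 * n ^ 2 * (n / m) ∧
      s ≤ (r - 1) + D + 2 * (r - 1 + τ) * m ∧ r * (D * (τ + 1)) ≤ 2 * (violated T f).card := by
  have hP := rank_injective hf
  have hneg : Function.Injective (fun v => -f v) := fun a b h => hf (neg_injective h)
  -- The `r` rightmost points, from which `u` is chosen by averaging.
  set L := Finset.univ.filter fun v => rank (fun v => -f v) v < r with hLdef
  have hLr : L.card = r := card_rank_lt (rank_injective hneg) (rank_lt _) hrn
  have hL : ∀ v ∉ L, ∀ x ∈ L, f v < f x := by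
    intro v hv x hx
    simp only [hLdef, Finset.mem_filter, Finset.mem_univ, true_and, not_lt] at hv hx
    have := rank_lt_rank_iff.1 (lt_of_lt_of_le hx hv)
    linarith
  obtain ⟨u, hu, hfib⟩ := exists_mul_fiber_le (violated T f) L
    (Finset.card_pos.1 (by omega))
  rw [hLr] at hfib
  set w := n / m + 1 with hw
  have hw0 : 0 < w := Nat.succ_pos _
  set b : Fin n → ℕ := fun v => rank f v / w with hb
  have hbm : ∀ v, b v < m := fun v => by
    rw [hb]
    exact (Nat.div_lt_iff_lt_mul hw0).2 (lt_mul_div_add_one hm (rank_lt f v).le)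
  -- Each true bucket is placed at one of its points, and the extra index `m` at `u`. The value `0`
  -- at empty buckets is arbitrary: only triples of correctly bucketed points use the comparison
  -- with `g`.
  set F : ℕ → ℝ := fun j => if j = m then f u else if h : ∃ z, b z = j then f h.choose else 0
    with hF
  set g : Fin n → ℝ := fun v => if v = u then f u else F (b v) with hg
  have hFb : ∀ v, ∃ z, b z = b v ∧ F (b v) = f z := by
    intro v
    have h : ∃ z, b z = b v := ⟨v, rfl⟩
    refine ⟨h.choose, h.choose_spec, ?_⟩
    rw [hF]
    simp only [(hbm v).ne, if_false, dif_pos h]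
  have hgz : ∀ v, ∃ z, rank f z / w = rank f v / w ∧ g v = f z := by
    intro v
    by_cases hvu : v = u
    · exact ⟨v, rfl, by simp [hg, hvu]⟩
    · obtain ⟨z, hz, hz'⟩ := hFb v
      exact ⟨z, hz, by simp only [hg, hvu, if_false, hz']⟩
  -- The points whose bucket from the constraints differs from the bucket of their rank. Triples
  -- that meet them are given up.
  set Bad := Finset.univ.filter fun v => v ≠ u ∧ farCount T u v / w ≠ b v with hBad
  set Dset := Finset.univ.filter fun v => τ < conflicts (violated T f) u v with hDset
  refine ⟨u, F, Bad.card, Dset.card, ?_, ?_, ?_⟩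
  · have hsub : (violated T fun v => F (bucketOf T m u v)) ⊆ violated T f ∪
        (Finset.univ.filter fun c : Fin n × Fin n × Fin n =>
          c.1 ∈ Bad ∨ c.2.1 ∈ Bad ∨ c.2.2 ∈ Bad) ∪
        (Finset.univ.filter fun c : Fin n × Fin n × Fin n => c.1 ≠ c.2.1 ∧ c.1 ≠ c.2.2 ∧
          c.2.1 ≠ c.2.2 ∧ Satisfies f c ∧ ¬ Satisfies g c) := by
      rintro ⟨x, v, y⟩ hc
      simp only [violated, Finset.mem_filter, Finset.mem_union, Finset.mem_univ, true_and] at hc ⊢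
      obtain ⟨hcT, hcs⟩ := hc
      by_cases h1 : Satisfies f (x, v, y)
      swap
      · exact Or.inl (Or.inl ⟨hcT, h1⟩)
      by_cases h2 : x ∈ Bad ∨ v ∈ Bad ∨ y ∈ Bad
      · exact Or.inl (Or.inr h2)
      obtain ⟨d1, d2, d3⟩ := hT.distinct _ _ _ hcT
      refine Or.inr ⟨d1, d2, d3, h1, ?_⟩
      have hgood : ∀ a, a ∉ Bad → F (bucketOf T m u a) = g a := by
        intro a ha
        simp only [hBad, Finset.mem_filter, Finset.mem_univ, true_and, not_and, not_not] at ha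
        by_cases hau : a = u
        · simp [bucketOf, hau, hg, hF]
        · simp only [bucketOf, hau, if_false, hg]
          rw [← ha hau]
      rw [not_or, not_or] at h2
      simpa only [Satisfies, hgood x h2.1, hgood v h2.2.1, hgood y h2.2.2] using hcs
    have ham := card_ambiguous_le hf hw0 hgz
    have hmeet := card_meets_le Bad
    have hw1 : w - 1 = n / m := by omega
    rw [hw1] at ham
    refine (Finset.card_le_card hsub).trans ((Finset.card_union_le _ _).trans ?_)
    refine Nat.add_le_add ((Finset.card_union_le _ _).trans ?_) ham
    exact Nat.add_le_add_left hmeet _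
  · set t := r - 1 + τ with ht
    -- For a point outside `L` and `Dset` the count is within `t` of the rank, so a wrong bucket
    -- forces the rank to be within `t` of one of the `m` multiples of `w`.
    have hsub : Bad ⊆ L.erase u ∪ Dset ∪ (Finset.range m).biUnion fun j =>
        Finset.univ.filter fun v => j * w - t ≤ rank f v ∧ rank f v < j * w + t := by
      intro v hv
      simp only [hBad, Finset.mem_filter, Finset.mem_univ, true_and] at hv
      obtain ⟨hvu, hvb⟩ := hv
      simp only [Finset.mem_union, Finset.mem_biUnion, Finset.mem_range, Finset.mem_filter,
        Finset.mem_univ, true_and]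
      by_cases hvL : v ∈ L
      · exact Or.inl (Or.inl (Finset.mem_erase.2 ⟨hvu, hvL⟩))
      by_cases hvD : v ∈ Dset
      · exact Or.inl (Or.inr hvD)
      simp only [hDset, Finset.mem_filter, Finset.mem_univ, true_and, not_lt] at hvD
      obtain ⟨h1, h2⟩ := farCount_rank hT L hL hu hvL
      rw [hLr] at h1 h2
      exact Or.inr (exists_mul_between hw0 (h1.trans (by omega)) (h2.trans (by omega)) hvb
        (lt_mul_div_add_one hm (farCount_le T u v)) (lt_mul_div_add_one hm (rank_lt f v).le))
    refine (Finset.card_le_card hsub).trans ((Finset.card_union_le _ _).trans ?_)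
    refine Nat.add_le_add ((Finset.card_union_le _ _).trans ?_) ?_
    · rw [Finset.card_erase_of_mem hu, hLr]
    · refine Finset.card_biUnion_le.trans ?_
      calc _ ≤ ∑ _j ∈ Finset.range m, 2 * t := by
            apply Finset.sum_le_sum
            intro j _
            exact (card_rank_mem_Ico_le hP _ _).trans (by omega)
        _ = 2 * t * m := by simp [mul_comm]
  · calc r * (Dset.card * (τ + 1)) ≤ r * (2 * fiber (violated T f) u) := by
          exact Nat.mul_le_mul_left _ (card_conflicts_gt_mul_le _ _ _)
      _ = 2 * (r * fiber (violated T f) u) := by ring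
      _ ≤ _ := Nat.mul_le_mul_left _ hfib

end
end LLOC

/-! ### The error of the best placement in terms of `ε^(1/8)` -/

namespace LLOC

variable {n : ℕ}

theorem satisfiesFraction_iff {T : Constraints n} {f : Fin n → ℝ} {α : ℝ} :
    SatisfiesFraction T f (1 - α) ↔ ((violated T f).card : ℝ) ≤ α * T.card := by
  classical
  have h : (T.filter fun c => Satisfies f c).card + (violated T f).card = T.card :=
    Finset.card_filter_add_card_filter_not _
  have h' : ((T.filter fun c => Satisfies f c).card : ℝ) + (violated T f).card = T.card := by
    exact_mod_cast h
  unfold SatisfiesFraction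
  have e : ∀ inst : DecidablePred fun c => Satisfies f c,
      (@Finset.filter _ (fun c => Satisfies f c) inst T).card =
        (T.filter fun c => Satisfies f c).card := by
    intro inst; congr!
  rw [e]
  constructor <;> intro _ <;> linarith

theorem card_constraints_le (T : Constraints n) : T.card ≤ n ^ 3 := by
  refine (Finset.card_le_univ T).trans (le_of_eq ?_)
  simp only [Fintype.card_prod, Fintype.card_fin]
  ring

/-- The constraints and their mirror images cover all `n (n - 1) (n - 2)` triples of distinct
points. The factor 9 is attained at `n = 3`. -/
theorem IsDense.pow_three_le {T : Constraints n} (hT : IsDense T) (hn : 3 ≤ n) :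
    n ^ 3 ≤ 9 * T.card := by
  classical
  set X : Constraints n := Finset.univ.sigma (fun u : Fin n => (Finset.univ.erase u).offDiag)
    |>.map ⟨fun c => (c.1, c.2), by rintro ⟨a, b⟩ ⟨c, d⟩ h; simpa using h⟩ with hX
  have hXc : X.card = n * ((n - 1) * (n - 1) - (n - 1)) := by
    rw [hX, Finset.card_map, Finset.card_sigma]
    simp [Finset.offDiag_card]
  have hsub : X ⊆ T ∪ T.image fun c => (c.1, c.2.2, c.2.1) := by
    rintro ⟨x, v, w⟩ hc
    simp only [hX, Finset.mem_map, Finset.mem_sigma, Finset.mem_univ, true_and,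
      Finset.mem_offDiag, Finset.mem_erase] at hc
    obtain ⟨⟨u, v₁, w₁⟩, ⟨⟨h1, -⟩, ⟨h2, -⟩, h3⟩, h⟩ := hc
    cases h
    simp only [Finset.mem_union, Finset.mem_image, Prod.exists, Prod.mk.injEq]
    by_cases hin : (u, v, w) ∈ T
    · exact Or.inl hin
    · refine Or.inr ⟨u, w, v, ?_, rfl, rfl, rfl⟩
      by_contra h
      exact hin ((hT.exactly_one u v w (Ne.symm h1) (Ne.symm h2) h3).2 h)
  have hle : X.card ≤ 2 * T.card := by
    refine (Finset.card_le_card hsub).trans ((Finset.card_union_le _ _).trans ?_)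
    have := Finset.card_image_le (s := T) (f := fun c => (c.1, c.2.2, c.2.1))
    omega
  rw [hXc] at hle
  obtain ⟨k, rfl⟩ : ∃ k, n = k + 3 := ⟨n - 3, by omega⟩
  have e : (k + 3 - 1) * (k + 3 - 1) - (k + 3 - 1) = (k + 2) * (k + 1) := by
    rw [show k + 3 - 1 = k + 2 by omega]
    apply Nat.sub_eq_of_eq_add
    ring
  rw [e] at hle
  nlinarith [Nat.zero_le k, Nat.zero_le (k ^ 2), Nat.zero_le (k ^ 3)]

/-- If few constraints are violated by some map, then few are violated by a placement of the
buckets. -/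
theorem exists_placement {T : Constraints n} (hT : IsDense T) (hn : 3 ≤ n) {d : ℝ} (hd0 : 0 < d)
    (hd : d ≤ 1 / 2) {f : Fin n → ℝ} (hf : ((violated T f).card : ℝ) ≤ d ^ 8 * T.card) {m : ℕ}
    (hm1 : 1 ≤ 2 * (m * d)) (hm2 : m * d ≤ 2) :
    ∃ (u : Fin n) (F : ℕ → ℝ),
      ((violated T fun v => F (bucketOf T m u v)).card : ℝ) ≤ 648 * d * T.card := by
  obtain ⟨g, hg, hgf⟩ := exists_injective_satisfies f
  have hV : ((violated T g).card : ℝ) ≤ d ^ 8 * T.card := by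
    refine le_trans ?_ hf
    have : violated T g ⊆ violated T f := by
      intro c hc
      simp only [violated, Finset.mem_filter] at hc ⊢
      exact ⟨hc.1, fun h => hc.2 (hgf c h)⟩
    exact_mod_cast Finset.card_le_card this
  have hm : 0 < m := by
    rcases Nat.eq_zero_or_pos m with h | h
    · subst h; norm_num at hm1
    · exact h
  have hm' : (0 : ℝ) < m := by exact_mod_cast hm
  have hnr : (3 : ℝ) ≤ n := by exact_mod_cast hn
  have hn0 : (0 : ℝ) < n := by linarith
  have hT3 : (T.card : ℝ) ≤ (n : ℝ) ^ 3 := by exact_mod_cast card_constraints_le T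
  have hT9 : (n : ℝ) ^ 3 ≤ 9 * T.card := by exact_mod_cast hT.pow_three_le hn
  have hd2 : d ^ 2 ≤ d / 2 := by nlinarith
  have hd4 : d ^ 4 ≤ d ^ 2 / 4 := by
    have : d ^ 4 = d ^ 2 * d ^ 2 := by ring
    nlinarith [sq_nonneg d]
  have hd8 : d ^ 8 ≤ d := by
    calc d ^ 8 ≤ d ^ 1 := pow_le_pow_of_le_one hd0.le (by linarith) (by norm_num)
      _ = d := pow_one d
  -- This balance gives the exponent 8: averaging over `d^4 n` candidates leaves `d^4 n²` violated
  -- constraints at `u`, so at most `2 d² n` points have more than `d² n` conflicts. A tolerance of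
  -- about `d² n` at each of `m ≈ 1/d` boundaries then costs `O(d n)` points.
  set r := ⌊d ^ 4 * n⌋₊ + 1 with hr
  set τ := ⌊d ^ 2 * n⌋₊ with hτ
  have hr1 : ((r - 1 : ℕ) : ℝ) ≤ d ^ 4 * n := by
    rw [hr, Nat.add_sub_cancel]
    exact Nat.floor_le (by positivity)
  have hr2 : d ^ 4 * n ≤ r := by
    rw [hr]; push_cast
    exact (Nat.lt_floor_add_one _).le
  have hτ1 : (τ : ℝ) ≤ d ^ 2 * n := Nat.floor_le (by positivity)
  have hτ2 : d ^ 2 * n ≤ τ + 1 := (Nat.lt_floor_add_one _).le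
  have hrn : r ≤ n := by
    have h1 : (r : ℝ) ≤ d ^ 4 * n + 1 := by
      rw [hr]; push_cast
      linarith [Nat.floor_le (show 0 ≤ d ^ 4 * (n : ℝ) by positivity)]
    have h2 : d ^ 4 * n ≤ (1 / 16) * n := by
      apply mul_le_mul_of_nonneg_right _ hn0.le
      linarith
    have : (r : ℝ) ≤ n := by linarith
    exact_mod_cast this
  obtain ⟨u, F, s, D, h1, h2, h3⟩ := exists_bucket_placement hT hg hm (show 0 < r by omega) hrn τ
  refine ⟨u, F, ?_⟩
  have h1' : ((violated T fun v => F (bucketOf T m u v)).card : ℝ) ≤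
      (violated T g).card + 3 * (n : ℝ) ^ 2 * s + 19 * (n : ℝ) ^ 2 * ((n / m : ℕ) : ℝ) := by
    exact_mod_cast h1
  have h2' : (s : ℝ) ≤ ((r - 1 : ℕ) : ℝ) + D + 2 * (((r - 1 : ℕ) : ℝ) + τ) * m := by
    exact_mod_cast h2
  have h3' : (r : ℝ) * (D * (τ + 1)) ≤ 2 * (violated T g).card := by exact_mod_cast h3
  have hD : (D : ℝ) ≤ 2 * (d ^ 2 * n) := by
    have e1 : (d ^ 4 * n) * (D * (d ^ 2 * n)) ≤ 2 * (d ^ 8 * (n : ℝ) ^ 3) := by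
      calc (d ^ 4 * n) * (D * (d ^ 2 * n)) ≤ (r : ℝ) * (D * (τ + 1)) := by gcongr
        _ ≤ 2 * (violated T g).card := h3'
        _ ≤ 2 * (d ^ 8 * T.card) := by linarith
        _ ≤ _ := by gcongr
    have e2 : (d ^ 6 * (n : ℝ) ^ 2) * D ≤ (d ^ 6 * (n : ℝ) ^ 2) * (2 * (d ^ 2 * n)) := by
      calc _ = (d ^ 4 * n) * (D * (d ^ 2 * n)) := by ring
        _ ≤ _ := e1
        _ = _ := by ring
    exact le_of_mul_le_mul_left e2 (by positivity)
  have hdn : 0 < d * n := by positivity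
  have q2 : d ^ 2 * n ≤ d * n / 2 := by
    linarith [mul_le_mul_of_nonneg_right hd2 hn0.le]
  have q4 : d ^ 4 * n ≤ d ^ 2 * n / 4 := by
    linarith [mul_le_mul_of_nonneg_right hd4 hn0.le]
  have hs : (s : ℝ) ≤ 11 * (d * n) := by
    have e1 : 2 * (((r - 1 : ℕ) : ℝ) + τ) * m ≤ 8 * (d * n) := by
      calc 2 * (((r - 1 : ℕ) : ℝ) + τ) * m ≤ 2 * (d ^ 2 * n + d ^ 2 * n) * m := by
            gcongr
            linarith [show 0 ≤ d ^ 2 * (n : ℝ) by positivity]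
        _ = 4 * (d * n) * (m * d) := by ring
        _ ≤ 4 * (d * n) * 2 := by gcongr
        _ = _ := by ring
    linarith [show 0 ≤ d ^ 2 * (n : ℝ) by positivity]
  have hnm : ((n / m : ℕ) : ℝ) ≤ 2 * (d * n) := by
    refine Nat.cast_div_le.trans ?_
    rw [div_le_iff₀ hm']
    linarith [mul_le_mul_of_nonneg_right hm1 hn0.le]
  calc _ ≤ _ := h1'
    -- The constants add up to `1 + 33 + 38 = 72`, and `648 = 72 * 9` by density.
    _ ≤ d * (n : ℝ) ^ 3 + 3 * (n : ℝ) ^ 2 * (11 * (d * n)) + 19 * (n : ℝ) ^ 2 * (2 * (d * n)) := by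
      gcongr
      calc ((violated T g).card : ℝ) ≤ d ^ 8 * T.card := hV
        _ ≤ d * (n : ℝ) ^ 3 := by gcongr
    _ = 72 * d * (n : ℝ) ^ 3 := by ring
    _ ≤ 72 * d * (9 * T.card) := by gcongr
    _ = _ := by ring

end LLOC

/-! ### The program -/

namespace LoopLang

open LoopLang.Expr LoopLang.Cmd

notation:65 c:66 ";;" d:65 => Cmd.seq c d

namespace Cmd

def incr (x : Var) : Cmd := assign x (plus (var x) (lit 1))

def double (x : Var) : Cmd := assign x (plus (var x) (var x))

/-- `z := x * y`. -/
def mul (z x y : Var) : Cmd := assign z (lit 0) ;; loop (var x) (assign z (plus (var z) (var y)))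

/-- `(c, q) := (c % d, c / d)`. -/
def divmod (c q d : Var) : Cmd :=
  assign q (lit 0) ;; loop (var c)
    (ite (plus (minus (var c) (var d)) (lit 1)) (assign c (minus (var c) (var d)) ;; incr q) skip)

theorem cost_seq (c d : Cmd) (σ : State) : (c ;; d).cost σ = c.cost σ + d.cost (c.run σ) := rfl

theorem run_seq (c d : Cmd) (σ : State) : (c ;; d).run σ = d.run (c.run σ) := rfl

theorem run_ite_pos {e : Expr} {c d : Cmd} {σ : State} (h : 0 < e.eval σ) :
    (ite e c d).run σ = c.run σ := by
  rw [run, if_pos h]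

theorem run_ite_neg {e : Expr} {c d : Cmd} {σ : State} (h : ¬ 0 < e.eval σ) :
    (ite e c d).run σ = d.run σ := by
  rw [run, if_neg h]

theorem mul_spec {z x y : Var} (hx : z ≠ x) (hy : z ≠ y) {σ : State} {a b : ℕ}
    (ha : σ.v x = a) (hb : σ.v y = b) :
    (mul z x y).cost σ ≤ 20 * (a + 1) ∧ ((mul z x y).run σ).v z = a * b := by
  have h := loop_rule (e := var x) (c := assign z (plus (var z) (var y)))
    (σ := (assign z (lit 0)).run σ) (k := a) (t := 10) (fun i τ => τ.v z = i * b)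
    (by simp [eval, run, hx.symm, ha]) (by simp [run, eval])
    (by
      intro i _ τ hτ hv _
      have hyτ : τ.v y = b := by
        rw [hv y (by simp [writes, hy.symm])]
        simp [run, hy.symm, hb]
      refine ⟨by simp [cost, Expr.cost], ?_⟩
      simp only [run, eval, Function.update_self, hτ, hyτ]
      push_cast
      ring)
  refine ⟨?_, h.2⟩
  simp only [mul, cost, Expr.cost] at h ⊢
  omega

/-- The loop makes `a` rounds, usually far too many, and is idle once the remainder is below the
divisor. The invariant records that this has happened or that every round so far subtracted; the
latter for all `a` rounds also leaves a remainder below `b`. -/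
theorem divmod_spec {c q d : Var} (hcq : c ≠ q) (hcd : c ≠ d) (hqd : q ≠ d) {σ : State} {a b : ℕ}
    (ha : σ.v c = a) (hb : σ.v d = b) (hb0 : 0 < b) :
    (divmod c q d).cost σ ≤ 50 * (a + 1) ∧ ((divmod c q d).run σ).v c = (a % b : ℕ) ∧
      ((divmod c q d).run σ).v q = (a / b : ℕ) := by
  have h := loop_rule (e := var c)
    (c := ite (plus (minus (var c) (var d)) (lit 1))
      (assign c (minus (var c) (var d)) ;; incr q) skip)
    (σ := (assign q (lit 0)).run σ) (k := a) (t := 30)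
    (fun i τ => ∃ r k : ℕ, τ.v c = r ∧ τ.v q = k ∧ r + k * b = a ∧ (r < b ∨ k = i))
    (by simp [eval, run, hcq, ha])
    ⟨a, 0, by simp [run, hcq, ha], by simp [run, eval], by simp, Or.inr rfl⟩
    (by
      rintro i _ τ ⟨r, k, hr, hk, hrk, hor⟩ hv _
      have hdτ : τ.v d = b := by
        rw [hv d (by simp [writes, incr, hcd.symm, hqd.symm])]
        simp [run, hqd.symm, hb]
      by_cases hrb : b ≤ r
      · have hpos : 0 < (plus (minus (var c) (var d)) (lit 1)).eval τ := by
          simp only [eval, hr, hdτ]; omega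
        refine ⟨by simp [cost, Expr.cost, hpos, incr], r - b, k + 1, ?_, ?_, ?_, ?_⟩
        · rw [run_ite_pos hpos]
          simp only [run, incr, eval, Function.update_of_ne hcq, Function.update_self, hr, hdτ]
          omega
        · rw [run_ite_pos hpos]
          simp [run, incr, eval, hcq.symm, hk]
        · rw [Nat.add_mul]
          omega
        · omega
      · have hpos : ¬ 0 < (plus (minus (var c) (var d)) (lit 1)).eval τ := by
          simp only [eval, hr, hdτ]; omega
        refine ⟨by simp [cost, Expr.cost, hpos], r, k, ?_, ?_, hrk, Or.inl (by omega)⟩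
        · rw [run_ite_neg hpos, run, hr]
        · rw [run_ite_neg hpos, run, hk])
  obtain ⟨hc, r, k, hr, hk, hrk, hor⟩ := h
  have hrb : r < b := by
    rcases hor with h | h
    · exact h
    · subst h
      nlinarith
  have hmod : a % b = r := by
    rw [← hrk, Nat.add_mul_mod_self_right, Nat.mod_eq_of_lt hrb]
  have hdiv : a / b = k := by
    rw [← hrk, Nat.add_mul_div_right _ _ hb0, Nat.div_eq_of_lt hrb, zero_add]
  refine ⟨?_, ?_, ?_⟩
  · simp only [divmod, cost, Expr.cost] at hc ⊢
    omega
  · rw [hmod]; exact hr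
  · rw [hdiv]; exact hk

/-- The number of parts is about the eighth root of the parameter. -/
def findParts : Cmd :=
  assign .parts (lit 1) ;; loop (var .param)
    (mul .prod₁ .parts .parts ;; mul .prod₂ .prod₁ .prod₁ ;; mul .prod₃ .prod₂ .prod₂ ;;
      ite (minus (var .param) (var .prod₃)) (incr .parts) skip)

def findWidth : Cmd :=
  assign .count (var .size) ;; divmod .count .width .parts ;; incr .width

def findBase : Cmd :=
  assign .places (plus (var .parts) (lit 1)) ;; assign .base (var .places) ;;
    double .base ;; double .base ;; double .base ;; double .base ;;
    assign .expo (var .places) ;; double .expo ;; double .expo ;;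
    assign .expo (plus (var .expo) (lit 8)) ;; assign .bound (lit 1)

/-- The small factor `base` is the loop counter of `mul`, so a multiplication costs `O(m)` steps,
however large `bound` has become. -/
def findBound : Cmd :=
  findBase ;; loop (var .expo) (mul .prod₁ .base .bound ;; assign .bound (var .prod₁))

/-- The candidate `m` grows only while `m ^ 8 < k`. If it has grown in all `k` rounds, then `m = k +
1`, which is certainly large enough. -/
theorem findParts_spec {σ : State} {k : ℕ} (hk : σ.v .param = k) :
    findParts.cost σ ≤ 400 * (k + 1) ^ 5 ∧ ∃ m : ℕ, (findParts.run σ).v .parts = m ∧ 0 < m ∧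
      k ≤ m ^ 8 ∧ (m = 1 ∨ (m - 1) ^ 8 < k) := by
  have h := loop_rule (e := var .param)
    (c := mul .prod₁ .parts .parts ;; mul .prod₂ .prod₁ .prod₁ ;; mul .prod₃ .prod₂ .prod₂ ;;
      ite (minus (var .param) (var .prod₃)) (incr .parts) skip)
    (σ := (assign .parts (lit 1)).run σ) (k := k) (t := 150 * (k + 1) ^ 4)
    (fun i τ => ∃ m : ℕ, τ.v .parts = m ∧ 0 < m ∧ m ≤ i + 1 ∧ (k ≤ m ^ 8 ∨ m = i + 1) ∧
      (m = 1 ∨ (m - 1) ^ 8 < k))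
    (by simp [eval, run, hk]) ⟨1, by simp [run, eval], by simp⟩
    (by
      rintro i hi τ ⟨m, hm, hm0, hmi, hmk, hm1⟩ hv _
      have hKτ : τ.v .param = k := by
        rw [hv _ (by decide)]
        simp [run, hk]
      obtain ⟨c1, r1⟩ := mul_spec (z := .prod₁) (by decide) (by decide) hm hm
      set τ₁ := (mul .prod₁ .parts .parts).run τ with hτ₁
      have r1' : τ₁.v .prod₁ = ((m * m : ℕ) : ℤ) := by rw [r1]; push_cast; ring
      obtain ⟨c2, r2⟩ := mul_spec (z := .prod₂) (by decide) (by decide) r1' r1'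
      set τ₂ := (mul .prod₂ .prod₁ .prod₁).run τ₁ with hτ₂
      have r2' : τ₂.v .prod₂ = ((m * m * (m * m) : ℕ) : ℤ) := by rw [r2]; push_cast; ring
      obtain ⟨c3, r3⟩ := mul_spec (z := .prod₃) (by decide) (by decide) r2' r2'
      set τ₃ := (mul .prod₃ .prod₂ .prod₂).run τ₂ with hτ₃
      have r3' : τ₃.v .prod₃ = ((m ^ 8 : ℕ) : ℤ) := by rw [r3]; push_cast; ring
      have hK₃ : τ₃.v .param = k := by
        rw [hτ₃, run_v_of_notMem _ _ (by decide), hτ₂, run_v_of_notMem _ _ (by decide), hτ₁,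
          run_v_of_notMem _ _ (by decide), hKτ]
      have hm₃ : τ₃.v .parts = m := by
        rw [hτ₃, run_v_of_notMem _ _ (by decide), hτ₂, run_v_of_notMem _ _ (by decide), hτ₁,
          run_v_of_notMem _ _ (by decide), hm]
      have hcost : 20 * (m + 1) + 20 * (m * m + 1) + 20 * (m * m * (m * m) + 1) + 20 ≤
          150 * (k + 1) ^ 4 := by
        have h1 : m ≤ k + 1 := by omega
        have h2 : m * m * (m * m) ≤ (k + 1) ^ 4 := by
          calc m * m * (m * m) = m ^ 4 := by ring
            _ ≤ _ := Nat.pow_le_pow_left h1 4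
        have h3 : m ≤ m * m := Nat.le_mul_self m
        have h4 : m * m ≤ m * m * (m * m) := Nat.le_mul_self _
        have h5 : 1 ≤ m * m * (m * m) := by nlinarith
        omega
      by_cases hc : m ^ 8 < k
      · have hpos : 0 < (minus (var .param) (var .prod₃)).eval τ₃ := by
          simp only [eval, hK₃, r3']; omega
        refine ⟨?_, m + 1, ?_, by omega, by omega, by omega, Or.inr (by simpa using hc)⟩
        · refine le_trans ?_ hcost
          simp only [cost, ← hτ₁, ← hτ₂, ← hτ₃, if_pos hpos, incr, Expr.cost]
          omega
        · rw [run, run, run, ← hτ₁, ← hτ₂, ← hτ₃, run_ite_pos hpos]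
          simp [run, incr, eval, hm₃]
      · have hpos : ¬ 0 < (minus (var .param) (var .prod₃)).eval τ₃ := by
          simp only [eval, hK₃, r3']; omega
        refine ⟨?_, m, ?_, by omega, by omega, by omega, hm1⟩
        · refine le_trans ?_ hcost
          simp only [cost, ← hτ₁, ← hτ₂, ← hτ₃, if_neg hpos, Expr.cost]
          omega
        · rw [run, run, run, ← hτ₁, ← hτ₂, ← hτ₃, run_ite_neg hpos, run, hm₃])
  obtain ⟨hc, m, hm, hm0, hmi, hmk, hm1⟩ := h
  refine ⟨?_, m, hm, hm0, ?_, hm1⟩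
  · simp only [findParts, cost, Expr.cost] at hc ⊢
    have h1 : 1 ≤ (k + 1) ^ 4 := Nat.one_le_pow _ _ (by omega)
    have h2 : k * (150 * (k + 1) ^ 4 + 3) ≤ 153 * (k + 1) ^ 5 := by
      calc k * (150 * (k + 1) ^ 4 + 3) ≤ (k + 1) * (153 * (k + 1) ^ 4) := by
            apply Nat.mul_le_mul <;> omega
        _ = _ := by ring
    have h3 : 1 ≤ (k + 1) ^ 5 := Nat.one_le_pow _ _ (by omega)
    omega
  · rcases hmk with h | h
    · exact h
    · rw [h]
      calc k ≤ k + 1 := by omega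
        _ ≤ (k + 1) ^ 8 := Nat.le_self_pow (by norm_num) _

theorem findWidth_spec {σ : State} {n m : ℕ} (hn : σ.v .size = n) (hm : σ.v .parts = m)
    (hm0 : 0 < m) :
    findWidth.cost σ ≤ 100 * (n + 1) ∧ (findWidth.run σ).v .width = (n / m + 1 : ℕ) := by
  obtain ⟨h1, -, h3⟩ := divmod_spec (c := .count) (q := .width) (d := .parts) (by decide)
    (by decide) (by decide) (σ := (assign .count (var .size)).run σ) (a := n) (b := m)
    (by simp [run, eval, hn]) (by simp [run, hm]) hm0
  constructor
  · simp only [findWidth, cost, Expr.cost, incr] at h1 ⊢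
    omega
  · simp only [findWidth, run, eval, incr, Function.update_self] at h3 ⊢
    rw [h3]
    push_cast
    ring

theorem findBound_spec {σ : State} {m : ℕ} (hm : σ.v .parts = m) :
    findBound.cost σ ≤ 200 * LLOC.steps (m + 1) ^ 2 ∧ (findBound.run σ).v .places = (m + 1 : ℕ) ∧
      (findBound.run σ).v .bound = LLOC.steps (m + 1) := by
  set σ₀ := findBase.run σ with hσ₀
  have e0 : σ₀.v .places = (m + 1 : ℕ) := by simp [hσ₀, findBase, run, eval, double, hm]
  have e1 : σ₀.v .base = (16 * (m + 1) : ℕ) := by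
    simp [hσ₀, findBase, run, eval, double, hm]; ring
  have e2 : σ₀.v .expo = (4 * (m + 1) + 8 : ℕ) := by
    simp [hσ₀, findBase, run, eval, double, hm]; ring
  have e3 : σ₀.v .bound = 1 := by simp [hσ₀, findBase, run, eval, double]
  have h := loop_rule (e := var .expo) (c := mul .prod₁ .base .bound ;; assign .bound (var .prod₁))
    (σ := σ₀) (k := 4 * (m + 1) + 8) (t := 20 * (16 * (m + 1) + 1) + 4)
    (fun i τ => τ.v .bound = ((16 * (m + 1)) ^ i : ℕ))
    (by simp only [eval, e2, Int.toNat_natCast]) (by simp [e3])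
    (by
      intro i _ τ hτ hv _
      have hb : τ.v .base = (16 * (m + 1) : ℕ) := by rw [hv _ (by decide), e1]
      obtain ⟨c1, r1⟩ := mul_spec (z := .prod₁) (by decide) (by decide) hb hτ
      refine ⟨?_, ?_⟩
      · simp only [cost, Expr.cost]
        omega
      · simp only [run, eval, Function.update_self, r1]
        push_cast
        ring)
  obtain ⟨hc, hN⟩ := h
  refine ⟨?_, ?_, ?_⟩
  · have h0 : findBase.cost σ ≤ 70 := by simp [findBase, cost, Expr.cost, double]
    rw [findBound, cost, ← hσ₀]
    have h1 : 16 * (m + 1) ≤ LLOC.steps (m + 1) := Nat.le_self_pow (by omega) _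
    have h2 : 4 * (m + 1) + 8 ≤ LLOC.steps (m + 1) :=
      (Nat.lt_pow_self (by omega)).le
    simp only [Expr.cost] at hc
    have h3 : (4 * (m + 1) + 8) * (20 * (16 * (m + 1) + 1) + 4 + 3) ≤
        LLOC.steps (m + 1) * (47 * LLOC.steps (m + 1)) := by
      apply Nat.mul_le_mul h2
      omega
    have h4 : LLOC.steps (m + 1) * (47 * LLOC.steps (m + 1)) = 47 * LLOC.steps (m + 1) ^ 2 := by
      ring
    have h5 : LLOC.steps (m + 1) ≤ LLOC.steps (m + 1) ^ 2 := Nat.le_self_pow (by norm_num) _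
    omega
  · rw [findBound, run, ← hσ₀, run_v_of_notMem _ _ (by decide), e0]
  · exact hN

end Cmd
end LoopLang

/-! ### Lists of quadruples as numbers, and extension of greedy sequences -/

namespace LLOC

/-- The `j`-th quadruple of base-`B` digits of `k`. -/
def decode (B k j : ℕ) : Quad :=
  (k / B ^ (4 * j) % B, k / B ^ (4 * j) / B % B, k / B ^ (4 * j) / B / B % B,
    k / B ^ (4 * j) / B / B / B % B)

theorem decode_below {B : ℕ} (hB : 0 < B) (k j : ℕ) : (decode B k j).Below B :=
  ⟨Nat.mod_lt _ hB, Nat.mod_lt _ hB, Nat.mod_lt _ hB, Nat.mod_lt _ hB⟩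

theorem decode_next (B k j : ℕ) :
    k / B ^ (4 * j) / B / B / B / B = k / B ^ (4 * (j + 1)) := by
  simp only [Nat.div_div_eq_div_mul]
  ring_nf

/-- Horner's scheme with `4 * L` digits, the first quadruple in the lowest digits. -/
theorem exists_decode {B : ℕ} (hB : 0 < B) (S : ℕ → Quad) (hS : ∀ j, (S j).Below B) (L : ℕ) :
    ∃ k < B ^ (4 * L), ∀ j < L, decode B k j = S j := by
  induction L generalizing S with
  | zero => exact ⟨0, by simp, by simp⟩
  | succ L ih =>
    obtain ⟨k, hk, hkS⟩ := ih (fun j => S (j + 1)) fun j => hS _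
    obtain ⟨h1, h2, h3, h4⟩ := hS 0
    set p := (S 0).1 with hp
    set q := (S 0).2.1 with hq
    set r := (S 0).2.2.1 with hr
    set s := (S 0).2.2.2 with hs
    have hdig : ∀ a b, a < B → (a + B * b) % B = a ∧ (a + B * b) / B = b := by
      intro a b ha
      rw [Nat.add_mul_mod_self_left, Nat.add_mul_div_left _ _ hB, Nat.mod_eq_of_lt ha,
        Nat.div_eq_of_lt ha, zero_add]
      exact ⟨rfl, rfl⟩
    have hlt : ∀ a b c, a < B → b < c → a + B * b < B * c := by
      intro a b c ha hb
      calc a + B * b < B * (b + 1) := by rw [Nat.mul_add]; omega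
        _ ≤ B * c := Nat.mul_le_mul_left _ hb
    refine ⟨p + B * (q + B * (r + B * (s + B * k))), ?_, ?_⟩
    · have e : B ^ (4 * (L + 1)) = B * (B * (B * (B * B ^ (4 * L)))) := by ring
      rw [e]
      exact hlt _ _ _ h1 (hlt _ _ _ h2 (hlt _ _ _ h3 (hlt _ _ _ h4 hk)))
    · intro j hj
      rcases j with _ | j
      · simp only [decode, Nat.mul_zero, pow_zero, Nat.div_one, (hdig _ _ h1).1, (hdig _ _ h1).2,
          (hdig _ _ h2).1, (hdig _ _ h2).2, (hdig _ _ h3).1, (hdig _ _ h3).2, (hdig _ _ h4).1]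
        rfl
      · rw [← hkS j (by omega)]
        have e : (p + B * (q + B * (r + B * (s + B * k)))) / B ^ (4 * (j + 1)) =
            k / B ^ (4 * j) := by
          have : B ^ (4 * (j + 1)) = B * (B * (B * (B * B ^ (4 * j)))) := by ring
          rw [this, ← Nat.div_div_eq_div_mul, (hdig _ _ h1).2, ← Nat.div_div_eq_div_mul,
            (hdig _ _ h2).2, ← Nat.div_div_eq_div_mul, (hdig _ _ h3).2,
            ← Nat.div_div_eq_div_mul, (hdig _ _ h4).2]
        simp only [decode, e]

/-- The program stores only the current positions. The whole sequence lives in a loop invariant,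
where each round appends one term. -/
theorem IsGreedy.extend {B N : ℕ} {S : ℕ → Quad} {y : ℕ → ℕ → ℤ} (hy : IsGreedy B S N y)
    (z : ℕ → ℤ) {j : ℕ} (hj : j ≤ B) (hz : ∀ i < B, z i = y N i + (S j).coeff i)
    (hmin : ∀ k ≤ B, (S j).val (y N) ≤ (S k).val (y N)) :
    IsGreedy B S (N + 1) (Function.update y (N + 1) z) where
  zero i hi := by
    rw [Function.update_of_ne (by omega)]
    exact hy.zero i hi
  step t ht := by
    rw [Function.update_of_ne (show t ≠ N + 1 by omega)]
    rcases Nat.lt_succ_iff_lt_or_eq.1 ht with h | h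
    · rw [Function.update_of_ne (show t + 1 ≠ N + 1 by omega)]
      exact hy.step t h
    · subst h
      rw [Function.update_self]
      exact ⟨j, hj, hz, hmin⟩

theorem IsGreedy.congr {B N : ℕ} {S R : ℕ → Quad} {y : ℕ → ℕ → ℤ} (hy : IsGreedy B S N y)
    (h : ∀ j ≤ B, S j = R j) : IsGreedy B R N y where
  zero := hy.zero
  step t ht := by
    obtain ⟨j, hj, h1, h2⟩ := hy.step t ht
    rw [h j hj] at h1 h2
    exact ⟨j, hj, h1, fun k hk => h k hk ▸ h2 k hk⟩

theorem Quad.val_congr {B : ℕ} {q : Quad} (hq : q.Below B) {y z : ℕ → ℤ}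
    (h : ∀ i < B, y i = z i) : q.val y = q.val z := by
  simp only [Quad.val, h _ hq.1, h _ hq.2.1, h _ hq.2.2.1, h _ hq.2.2.2]

end LLOC

/-! ### Programs for the buckets and for the least satisfied quadruple -/

namespace LoopLang

open LoopLang.Expr LoopLang.Cmd LLOC

/-- The number of positive cells among `n` consecutive ones. -/
def countPos (I : ℕ → ℤ) (P n : ℕ) : ℕ := ((Finset.range n).filter fun j => 0 < I (P + j)).card

theorem countPos_succ (I : ℕ → ℤ) (P n : ℕ) :
    countPos I P (n + 1) = countPos I P n + if 0 < I (P + n) then 1 else 0 := by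
  simp only [countPos, Finset.card_filter, Finset.sum_range_succ]

namespace Cmd

/-- The pointer `start` moves through the table of constraints and keeps its place between calls, so
no address has to be computed by multiplication. -/
def countFar : Cmd :=
  assign .count (lit 0) ;; loop (var .size)
    (ite (get .inp (var .start)) (incr .count) skip ;; incr .start)

def findBucket : Cmd :=
  countFar ;; divmod .count .quot .width ;; store .bucket (var .point) (var .quot) ;; incr .point

/-- The last assignment overwrites the meaningless bucket that the loop computes for the center
itself. -/
def findBuckets : Cmd :=
  assign .point (lit 0) ;; loop (var .size) findBucket ;;
    store .bucket (var .center) (var .parts)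

theorem countFar_spec {σ : State} {n P : ℕ} (hn : σ.v .size = n) (hP : σ.v .start = P) :
    countFar.cost σ ≤ 40 * (n + 1) ∧
      (countFar.run σ).v .count = countPos (σ.a .inp) P n ∧
      (countFar.run σ).v .start = (P + n : ℕ) := by
  have h := loop_rule (e := var .size)
    (c := ite (get .inp (var .start)) (incr .count) skip ;; incr .start)
    (σ := (assign .count (lit 0)).run σ) (k := n) (t := 30)
    (fun i τ => τ.v .count = countPos (σ.a .inp) P i ∧ τ.v .start = (P + i : ℕ))
    (by simp [eval, run, hn]) (by simp [run, eval, hP, countPos])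
    (by
      rintro i _ τ ⟨h1, h2⟩ _ ha
      have hI : τ.a .inp = σ.a .inp := by
        rw [ha _ (by decide)]; rfl
      have hev : (get .inp (var .start)).eval τ = σ.a .inp (P + i) := by
        simp only [eval, hI, h2, Int.toNat_natCast]
      by_cases hpos : 0 < σ.a .inp (P + i)
      · rw [cost, run, run_ite_pos (hev ▸ hpos)]
        refine ⟨?_, ?_, ?_⟩
        · simp [cost, hev, hpos, incr, Expr.cost]
        · simp [run, incr, eval, h1, countPos_succ, hpos]
        · simp [run, incr, eval, h2]; ring
      · rw [cost, run, run_ite_neg (hev ▸ hpos)]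
        refine ⟨?_, ?_, ?_⟩
        · simp [cost, hev, hpos, incr, Expr.cost]
        · simp [run, incr, h1, countPos_succ, hpos]
        · simp [run, incr, eval, h2]; ring)
  refine ⟨?_, h.2⟩
  have := h.1
  simp only [countFar, cost, Expr.cost] at this ⊢
  omega

theorem findBucket_spec {σ : State} {n P w v : ℕ} (hn : σ.v .size = n) (hP : σ.v .start = P)
    (hw : σ.v .width = w) (hw0 : 0 < w) (hv : σ.v .point = v) :
    findBucket.cost σ ≤ 150 * (n + 1) ∧
      (findBucket.run σ).v .start = (P + n : ℕ) ∧ (findBucket.run σ).v .point = (v + 1 : ℕ) ∧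
      (findBucket.run σ).a .bucket =
        Function.update (σ.a .bucket) v (countPos (σ.a .inp) P n / w : ℕ) := by
  obtain ⟨c1, r1, s1⟩ := countFar_spec hn hP
  set σ₁ := countFar.run σ with hσ₁
  have hw₁ : σ₁.v .width = w := by rw [hσ₁, run_v_of_notMem _ _ (by decide), hw]
  have hv₁ : σ₁.v .point = v := by rw [hσ₁, run_v_of_notMem _ _ (by decide), hv]
  have hb₁ : σ₁.a .bucket = σ.a .bucket := by rw [hσ₁, run_a_of_notMem _ _ (by decide)]
  obtain ⟨c2, -, r2⟩ := divmod_spec (c := .count) (q := .quot) (by decide) (by decide) (by decide)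
    r1 hw₁ hw0
  set σ₂ := (divmod .count .quot .width).run σ₁ with hσ₂
  have hv₂ : σ₂.v .point = v := by rw [hσ₂, run_v_of_notMem _ _ (by decide), hv₁]
  have hs₂ : σ₂.v .start = (P + n : ℕ) := by rw [hσ₂, run_v_of_notMem _ _ (by decide), s1]
  have hb₂ : σ₂.a .bucket = σ.a .bucket := by rw [hσ₂, run_a_of_notMem _ _ (by decide), hb₁]
  have hle : countPos (σ.a .inp) P n ≤ n := by
    refine (Finset.card_filter_le _ _).trans ?_
    simp
  rw [findBucket, cost_seq, cost_seq, run_seq, run_seq, ← hσ₁, ← hσ₂]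
  refine ⟨?_, ?_, ?_, ?_⟩
  · simp only [cost, Expr.cost, incr]
    omega
  · simp [run, incr, hs₂]
  · simp [run, incr, eval, hv₂]
  · simp [run, incr, eval, hv₂, r2, hb₂]

theorem findBuckets_spec {σ : State} {n P w u m : ℕ} (hn : σ.v .size = n) (hP : σ.v .start = P)
    (hw : σ.v .width = w) (hw0 : 0 < w) (hu : σ.v .center = u) (hm : σ.v .parts = m) :
    findBuckets.cost σ ≤ 200 * (n + 1) ^ 2 ∧
      (findBuckets.run σ).v .start = (P + n * n : ℕ) ∧
      ∀ v < n, (findBuckets.run σ).a .bucket v =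
        (if v = u then m else countPos (σ.a .inp) (P + v * n) n / w : ℕ) := by
  have h := loop_rule (e := var .size) (c := findBucket)
    (σ := (assign .point (lit 0)).run σ) (k := n) (t := 150 * (n + 1))
    (fun i τ => τ.v .start = (P + i * n : ℕ) ∧ τ.v .point = i ∧
      ∀ v < i, τ.a .bucket v = (countPos (σ.a .inp) (P + v * n) n / w : ℕ))
    (by simp [eval, run, hn]) (by simp [run, eval, hP])
    (by
      rintro i _ τ ⟨h1, h2, h3⟩ hv ha
      have hI : τ.a .inp = σ.a .inp := by
        rw [ha _ (by decide)]; rfl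
      obtain ⟨c1, r1, r2, r3⟩ := findBucket_spec (σ := τ) (n := n) (w := w)
        (by rw [hv _ (by decide)]; simp [run, hn]) h1
        (by rw [hv _ (by decide)]; simp [run, hw]) hw0 h2
      refine ⟨c1, ?_, r2, ?_⟩
      · rw [r1]; congr 1; ring
      · intro v hvi
        rw [r3, hI]
        by_cases hvv : v = i
        · subst hvv
          rw [Function.update_self]
        · rw [Function.update_of_ne hvv]
          exact h3 v (by omega))
  obtain ⟨c1, r1, -, r3⟩ := h
  set σ₁ := (loop (var .size) findBucket).run ((assign .point (lit 0)).run σ) with hσ₁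
  have hu₁ : σ₁.v .center = u := by
    rw [hσ₁, run_v_of_notMem _ _ (by decide)]; simp [run, hu]
  have hm₁ : σ₁.v .parts = m := by
    rw [hσ₁, run_v_of_notMem _ _ (by decide)]; simp [run, hm]
  rw [findBuckets, cost_seq, cost_seq, run_seq, run_seq, ← hσ₁]
  refine ⟨?_, ?_, ?_⟩
  · simp only [cost, Expr.cost] at c1 ⊢
    have : (n + 1) ^ 2 = n * n + 2 * n + 1 := by ring
    have : n * (150 * (n + 1) + 3) = 150 * (n * n) + 153 * n := by ring
    omega
  · simp [run, r1]
  · intro v hv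
    by_cases hvu : v = u
    · simp [run, eval, hu₁, hm₁, hvu]
    · simp [run, eval, hu₁, hvu, r3 v hv]

/-- The last base-`places` digit of `count`, which is removed. -/
def digit (x : Var) : Cmd :=
  divmod .count .quot .places ;; assign x (var .count) ;; assign .count (var .quot)

theorem digit_spec {x : Var} (hx : x ≠ .count) (hx' : x ≠ .quot) {σ : State} {a B : ℕ}
    (ha : σ.v .count = a) (hB : σ.v .places = B) (hB0 : 0 < B) :
    (digit x).cost σ ≤ 60 * (a + 1) ∧ ((digit x).run σ).v x = (a % B : ℕ) ∧
      ((digit x).run σ).v .count = (a / B : ℕ) := by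
  obtain ⟨c1, r1, r2⟩ := divmod_spec (c := .count) (q := .quot) (d := .places) (by decide)
    (by decide) (by decide) ha hB hB0
  rw [digit, cost, run]
  refine ⟨?_, ?_, ?_⟩
  · simp only [cost, Expr.cost]
    omega
  · simp [run, eval, hx, r1]
  · simp [run, eval, hx'.symm, r2]

def readQuad : Cmd := digit .dig₁ ;; digit .dig₂ ;; digit .dig₃ ;; digit .dig₄

theorem readQuad_spec {σ : State} {B k i : ℕ} (ha : σ.v .count = (k / B ^ (4 * i) : ℕ))
    (hB : σ.v .places = B) (hB0 : 0 < B) :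
    readQuad.cost σ ≤ 240 * (k + 1) ∧
      (readQuad.run σ).v .count = (k / B ^ (4 * (i + 1)) : ℕ) ∧
      (readQuad.run σ).v .dig₁ = (decode B k i).1 ∧
      (readQuad.run σ).v .dig₂ = (decode B k i).2.1 ∧
      (readQuad.run σ).v .dig₃ = (decode B k i).2.2.1 ∧
      (readQuad.run σ).v .dig₄ = (decode B k i).2.2.2 := by
  obtain ⟨c1, r1, s1⟩ := digit_spec (x := .dig₁) (by decide) (by decide) ha hB hB0
  set σ₁ := (digit .dig₁).run σ with hσ₁
  obtain ⟨c2, r2, s2⟩ := digit_spec (x := .dig₂) (B := B) (by decide) (by decide) s1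
    (by rw [hσ₁, run_v_of_notMem _ _ (by decide), hB]) hB0
  set σ₂ := (digit .dig₂).run σ₁ with hσ₂
  obtain ⟨c3, r3, s3⟩ := digit_spec (x := .dig₃) (B := B) (by decide) (by decide) s2
    (by rw [hσ₂, run_v_of_notMem _ _ (by decide), hσ₁, run_v_of_notMem _ _ (by decide), hB]) hB0
  set σ₃ := (digit .dig₃).run σ₂ with hσ₃
  obtain ⟨c4, r4, s4⟩ := digit_spec (x := .dig₄) (B := B) (by decide) (by decide) s3
    (by rw [hσ₃, run_v_of_notMem _ _ (by decide), hσ₂, run_v_of_notMem _ _ (by decide), hσ₁,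
      run_v_of_notMem _ _ (by decide), hB]) hB0
  rw [readQuad, cost_seq, cost_seq, cost_seq, run_seq, run_seq, run_seq, ← hσ₁, ← hσ₂, ← hσ₃]
  refine ⟨?_, ?_, ?_, ?_, ?_, r4⟩
  · have h1 : k / B ^ (4 * i) ≤ k := Nat.div_le_self _ _
    have h2 : k / B ^ (4 * i) / B ≤ k / B ^ (4 * i) := Nat.div_le_self _ _
    have h3 : k / B ^ (4 * i) / B / B ≤ k / B ^ (4 * i) / B := Nat.div_le_self _ _
    have h4 : k / B ^ (4 * i) / B / B / B ≤ k / B ^ (4 * i) / B / B := Nat.div_le_self _ _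
    omega
  · rw [s4, decode_next]
  · rw [run_v_of_notMem _ _ (by decide), hσ₃, run_v_of_notMem _ _ (by decide), hσ₂,
      run_v_of_notMem _ _ (by decide), r1]
    rfl
  · rw [run_v_of_notMem _ _ (by decide), hσ₃, run_v_of_notMem _ _ (by decide), r2]
    rfl
  · rw [run_v_of_notMem _ _ (by decide), r3]
    rfl

def take : Cmd :=
  assign .fresh (lit 0) ;; assign .least (var .val) ;; assign .arg₁ (var .dig₁) ;;
    assign .arg₂ (var .dig₂) ;; assign .arg₃ (var .dig₃) ;; assign .arg₄ (var .dig₄)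

/-- While `fresh` is positive, no quadruple has been recorded and `least` is meaningless, so the
first one is taken unconditionally. -/
def compareQuad : Cmd :=
  assign .val (minus (minus (plus (get .pos (var .dig₁)) (get .pos (var .dig₂)))
      (get .pos (var .dig₃))) (get .pos (var .dig₄))) ;;
    ite (var .fresh) take (ite (minus (var .least) (var .val)) take skip)

/-- Finds a least satisfied constraint among those that `code` encodes. -/
def findLeast : Cmd :=
  assign .count (var .code) ;; assign .fresh (lit 1) ;;
    loop (plus (var .places) (lit 1)) (readQuad ;; compareQuad)

/-- The constraint in `arg₁, …, arg₄` is `q`, with the value `least`. -/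
structure IsLeast (τ : State) (q : Quad) : Prop where
  fresh : τ.v .fresh = 0
  least : τ.v .least = q.val (τ.a .pos)
  arg₁ : τ.v .arg₁ = q.1
  arg₂ : τ.v .arg₂ = q.2.1
  arg₃ : τ.v .arg₃ = q.2.2.1
  arg₄ : τ.v .arg₄ = q.2.2.2

theorem compareQuad_spec {σ : State} {q : Quad} (h1 : σ.v .dig₁ = q.1) (h2 : σ.v .dig₂ = q.2.1)
    (h3 : σ.v .dig₃ = q.2.2.1) (h4 : σ.v .dig₄ = q.2.2.2) :
    compareQuad.cost σ ≤ 100 ∧ ((compareQuad.run σ).v .count = σ.v .count) ∧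
      (IsLeast (compareQuad.run σ) q ∧ (σ.v .fresh ≤ 0 → q.val (σ.a .pos) < σ.v .least) ∨
        σ.v .fresh ≤ 0 ∧ σ.v .least ≤ q.val (σ.a .pos) ∧
          ∀ r, IsLeast σ r → IsLeast (compareQuad.run σ) r) := by
  set σ₁ := (assign .val (minus (minus (plus (get .pos (var .dig₁)) (get .pos (var .dig₂)))
      (get .pos (var .dig₃))) (get .pos (var .dig₄)))).run σ with hσ₁
  have hval : σ₁.v .val = q.val (σ.a .pos) := by
    simp [hσ₁, run, eval, h1, h2, h3, h4, Quad.val]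
  have hfr : σ₁.v .fresh = σ.v .fresh := by simp [hσ₁, run]
  have hle : σ₁.v .least = σ.v .least := by simp [hσ₁, run]
  have htake : IsLeast (take.run σ₁) q := by
    constructor <;> simp [take, run, eval, hσ₁, h1, h2, h3, h4, Quad.val]
  rw [compareQuad]
  refine ⟨?_, run_v_of_notMem _ _ (by decide), ?_⟩
  · rw [cost, ← hσ₁]
    by_cases hf : 0 < σ₁.v .fresh
    · simp [cost, Expr.cost, eval, hf, take]
    · by_cases hl : σ₁.v .val < σ₁.v .least <;> simp [cost, Expr.cost, eval, hf, hl, take]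
  · rw [run, ← hσ₁]
    by_cases hf : 0 < (var .fresh).eval σ₁
    · rw [run_ite_pos hf]
      simp only [eval, hfr] at hf
      exact Or.inl ⟨htake, fun h => absurd h (by omega)⟩
    · rw [run_ite_neg hf]
      simp only [eval, hfr] at hf
      by_cases hl : 0 < (minus (var .least) (var .val)).eval σ₁
      · rw [run_ite_pos hl]
        simp only [eval, hle, hval] at hl
        exact Or.inl ⟨htake, fun _ => by omega⟩
      · rw [run_ite_neg hl]
        simp only [eval, hle, hval] at hl
        refine Or.inr ⟨by omega, by omega, fun r hr => ?_⟩
        obtain ⟨g1, g2, g3, g4, g5, g6⟩ := hr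
        constructor <;> simpa [run, hσ₁]

theorem findLeast_spec {σ : State} {B k : ℕ} (hk : σ.v .code = k) (hB : σ.v .places = B)
    (hB0 : 0 < B) :
    findLeast.cost σ ≤ 400 * (k + 1) * (B + 2) ∧ ∃ j ≤ B, IsLeast (findLeast.run σ) (decode B k j) ∧
      ∀ i ≤ B, (decode B k j).val (σ.a .pos) ≤ (decode B k i).val (σ.a .pos) := by
  have h := loop_rule (e := plus (var .places) (lit 1)) (c := readQuad ;; compareQuad)
    (σ := (assign .fresh (lit 1)).run ((assign .count (var .code)).run σ)) (k := B + 1)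
    (t := 240 * (k + 1) + 100)
    -- After `i` rounds `count` holds the digits not yet read, and the recorded quadruple is least
    -- among the first `i`. There are `B + 1` rounds, for the indices `0, …, B`.
    (fun i τ => τ.v .count = (k / B ^ (4 * i) : ℕ) ∧ (i = 0 ∧ τ.v .fresh = 1 ∨
      ∃ j < i, IsLeast τ (decode B k j) ∧
        ∀ l < i, (decode B k j).val (σ.a .pos) ≤ (decode B k l).val (σ.a .pos)))
    (by
      have : ((B : ℤ) + 1).toNat = B + 1 := by omega
      simp [eval, run, hB, this]) (by simp [run, eval, hk])
    (by
      rintro i _ τ ⟨hc, hor⟩ hv ha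
      have hpos : τ.a .pos = σ.a .pos := by
        rw [ha _ (by decide)]; rfl
      obtain ⟨c1, r0, r1, r2, r3, r4⟩ := readQuad_spec hc
        (by rw [hv _ (by decide)]; simpa [run] using hB) hB0
      set τ₁ := readQuad.run τ with hτ₁
      have hpos₁ : τ₁.a .pos = σ.a .pos := by
        rw [hτ₁, run_a_of_notMem _ _ (by decide), hpos]
      have hle₁ : ∀ r, IsLeast τ r → IsLeast τ₁ r := by
        rintro r ⟨g1, g2, g3, g4, g5, g6⟩
        constructor <;> rw [hτ₁, run_v_of_notMem _ _ (by decide)]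
        · exact g1
        · rw [g2, run_a_of_notMem _ _ (by decide)]
        · exact g3
        · exact g4
        · exact g5
        · exact g6
      have hfr₁ : τ₁.v .fresh = τ.v .fresh := by
        rw [hτ₁, run_v_of_notMem _ _ (by decide)]
      obtain ⟨c2, s0, s1⟩ := compareQuad_spec r1 r2 r3 r4
      rw [cost, run, ← hτ₁]
      refine ⟨by omega, by rw [s0, r0], Or.inr ?_⟩
      rw [hpos₁] at s1
      rcases s1 with ⟨s1, s2⟩ | ⟨s1, s2, s3⟩
      · refine ⟨i, by omega, s1, fun l hl => ?_⟩
        rcases Nat.lt_succ_iff_lt_or_eq.1 hl with hli | hli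
        · rcases hor with ⟨h0, -⟩ | ⟨j, hj, hjl, hmin⟩
          · omega
          · have h5 := s2 (by rw [hfr₁, hjl.fresh])
            have h6 := (hle₁ _ hjl).least
            rw [hpos₁] at h6
            linarith [hmin l hli]
        · rw [hli]
      · rcases hor with ⟨-, h0⟩ | ⟨j, hj, hjl, hmin⟩
        · omega
        · have h6 := (hle₁ _ hjl).least
          rw [hpos₁] at h6
          refine ⟨j, by omega, s3 _ (hle₁ _ hjl), fun l hl => ?_⟩
          rcases Nat.lt_succ_iff_lt_or_eq.1 hl with hli | hli
          · exact hmin l hli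
          · rw [hli]; linarith)
  obtain ⟨c1, -, hor⟩ := h
  refine ⟨?_, ?_⟩
  · simp only [findLeast, cost, Expr.cost] at c1 ⊢
    have e1 : (B + 1) * (240 * (k + 1) + 100 + 3) ≤ (B + 1) * (343 * (k + 1)) :=
      Nat.mul_le_mul_left _ (by omega)
    have e2 : 400 * (k + 1) * (B + 2) = (B + 1) * (343 * (k + 1)) + (B + 1) * (57 * (k + 1)) +
      400 * (k + 1) := by ring
    omega
  · rcases hor with ⟨h0, -⟩ | ⟨j, hj, hjl, hmin⟩
    · omega
    · exact ⟨j, by omega, hjl, fun i hi => hmin i (by omega)⟩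

end Cmd
end LoopLang

/-! ### Programs for placing the buckets and scoring a placement -/

namespace LoopLang

open LoopLang.Expr LoopLang.Cmd LLOC

/-- Whether the constraint in cell `P`, with the points `x`, `y`, `z`, is present and satisfied. -/
def Counts (I : ℕ → ℤ) (G : ℕ → ℤ) (P x y z : ℕ) : Prop :=
  0 < I P ∧ |G x - G y| < |G x - G z|

instance (I : ℕ → ℤ) (G : ℕ → ℤ) (P x y z : ℕ) : Decidable (Counts I G P x y z) := by
  unfold Counts; infer_instance

/-- The number of satisfied constraints with the first two points `x`, `y`. -/
def score₁ (I : ℕ → ℤ) (G : ℕ → ℤ) (P x y : ℕ) : ℕ → ℕ := fun k =>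
  ∑ z ∈ Finset.range k, if Counts I G (P + z) x y z then 1 else 0

/-- The number of satisfied constraints with the first point `x`. -/
def score₂ (I : ℕ → ℤ) (n : ℕ) (G : ℕ → ℤ) (P x : ℕ) : ℕ → ℕ := fun k =>
  ∑ y ∈ Finset.range k, score₁ I G (P + y * n) x y n

/-- The number of satisfied constraints. -/
def score₃ (I : ℕ → ℤ) (n : ℕ) (G : ℕ → ℤ) (P : ℕ) : ℕ → ℕ := fun k =>
  ∑ x ∈ Finset.range k, score₂ I n G (P + x * (n * n)) x n

theorem score₃_congr {I : ℕ → ℤ} {n : ℕ} {G H : ℕ → ℤ} (h : ∀ v < n, G v = H v) (P : ℕ) :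
    score₃ I n G P n = score₃ I n H P n := by
  unfold score₃ score₂ score₁
  refine Finset.sum_congr rfl fun x hx => Finset.sum_congr rfl fun y hy =>
    Finset.sum_congr rfl fun z hz => ?_
  rw [Finset.mem_range] at hx hy hz
  simp only [Counts, h x hx, h y hy, h z hz]

namespace Cmd

def bump (x : Var) (k : ℤ) : Cmd := store .pos (var x) (plus (get .pos (var x)) (lit k))

/-- Moves the buckets in the direction of the constraint in `arg₁, …, arg₄`. -/
def move : Cmd := bump .arg₁ 1 ;; bump .arg₂ 1 ;; bump .arg₃ (-1) ;; bump .arg₄ (-1)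

def greedyStep : Cmd := findLeast ;; move

def placeBuckets : Cmd :=
  assign .idx (lit 0) ;; loop (var .places) (store .pos (var .idx) (lit 0) ;; incr .idx) ;;
    loop (var .bound) greedyStep

/-- The four changes are made one after the other, so coinciding indices accumulate just as in
`Quad.coeff`. -/
theorem move_spec {σ : State} {q : Quad} (h : IsLeast σ q) :
    move.cost σ ≤ 100 ∧ ∀ i, (move.run σ).a .pos i = σ.a .pos i + q.coeff i := by
  obtain ⟨-, -, h1, h2, h3, h4⟩ := h
  refine ⟨by simp [move, cost, bump, Expr.cost], fun i => ?_⟩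
  simp only [move, run, bump, eval, h1, h2, h3, h4, Int.toNat_natCast, Function.update_self,
    Function.update_apply, Quad.coeff]
  split_ifs <;> simp_all <;> ring

theorem greedyStep_spec {σ : State} {B k : ℕ} (hk : σ.v .code = k) (hB : σ.v .places = B)
    (hB0 : 0 < B) :
    greedyStep.cost σ ≤ 500 * (k + 1) * (B + 2) ∧ ∃ j ≤ B,
      (∀ i, (greedyStep.run σ).a .pos i = σ.a .pos i + (decode B k j).coeff i) ∧
      ∀ i ≤ B, (decode B k j).val (σ.a .pos) ≤ (decode B k i).val (σ.a .pos) := by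
  obtain ⟨c1, j, hj, hl, hmin⟩ := findLeast_spec hk hB hB0
  obtain ⟨c2, h2⟩ := move_spec hl
  have hpos : (findLeast.run σ).a .pos = σ.a .pos := run_a_of_notMem _ _ (by decide)
  rw [greedyStep, cost_seq, run_seq]
  refine ⟨?_, j, hj, fun i => by rw [h2, hpos], hmin⟩
  have e : 500 * (k + 1) * (B + 2) = 400 * (k + 1) * (B + 2) + 100 * ((k + 1) * (B + 2)) := by ring
  have : 1 ≤ (k + 1) * (B + 2) := Nat.mul_pos (by omega) (by omega)
  omega

/-- Decoding by repeated subtraction makes a greedy step cost `O((k + 1) * (B + 2))`; the hypotheses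
`k < N` and `B + 2 ≤ N` turn `N` such steps into `O(N ^ 3)`. -/
theorem placeBuckets_spec {σ : State} {B k N : ℕ} (hk : σ.v .code = k) (hB : σ.v .places = B)
    (hB0 : 0 < B) (hN : σ.v .bound = N) (hkN : k < N) (hBN : B + 2 ≤ N) :
    placeBuckets.cost σ ≤ 600 * N ^ 3 ∧ ∃ y, IsGreedy B (decode B k) N y ∧
      ∀ i < B, (placeBuckets.run σ).a .pos i = y N i := by
  have h := loop_rule (e := var .places) (c := store .pos (var .idx) (lit 0) ;; incr .idx)
    (σ := (assign .idx (lit 0)).run σ) (k := B) (t := 20)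
    (fun i τ => τ.v .idx = i ∧ ∀ j < i, τ.a .pos j = 0)
    (by simp [eval, run, hB]) (by simp [run, eval])
    (by
      rintro i _ τ ⟨h1, h2⟩ _ _
      refine ⟨by simp [cost, Expr.cost, incr], ?_, ?_⟩
      · simp [run, incr, eval, h1]
      · intro j hj
        simp only [run, incr, eval, h1, Int.toNat_natCast, Function.update_self,
          Function.update_apply]
        split
        · rfl
        · exact h2 j (by omega))
  obtain ⟨c1, -, h0⟩ := h
  set σ₁ := (loop (var .places) (store .pos (var .idx) (lit 0) ;; incr .idx)).run
    ((assign .idx (lit 0)).run σ) with hσ₁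
  have hk₁ : σ₁.v .code = k := by
    rw [hσ₁, run_v_of_notMem _ _ (by decide), run_v_of_notMem _ _ (by decide), hk]
  have hB₁ : σ₁.v .places = B := by
    rw [hσ₁, run_v_of_notMem _ _ (by decide), run_v_of_notMem _ _ (by decide), hB]
  have hN₁ : σ₁.v .bound = N := by
    rw [hσ₁, run_v_of_notMem _ _ (by decide), run_v_of_notMem _ _ (by decide), hN]
  have h := loop_rule (e := var .bound) (c := greedyStep) (σ := σ₁) (k := N)
    (t := 500 * (k + 1) * (B + 2))
    (fun t τ => ∃ y, IsGreedy B (decode B k) t y ∧ ∀ i < B, τ.a .pos i = y t i)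
    (by simp [eval, hN₁])
    ⟨fun _ _ => 0, ⟨fun _ _ => rfl, fun t ht => absurd ht (by omega)⟩, h0⟩
    (by
      rintro t _ τ ⟨y, hy, hpos⟩ hv _
      obtain ⟨c2, j, hj, hstep, hmin⟩ := greedyStep_spec (σ := τ) (B := B) (k := k)
        (by rw [hv _ (by decide), hk₁]) (by rw [hv _ (by decide), hB₁]) hB0
      refine ⟨c2, _, hy.extend ((greedyStep.run τ).a .pos) hj ?_ ?_, ?_⟩
      · intro i hi
        rw [hstep, hpos i hi]
      · intro l hl
        rw [← Quad.val_congr (decode_below hB0 k j) hpos,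
          ← Quad.val_congr (decode_below hB0 k l) hpos]
        exact hmin l hl
      · intro i hi
        rw [Function.update_self])
  obtain ⟨c2, y, hy, hpos⟩ := h
  rw [placeBuckets, cost_seq, cost_seq, run_seq, run_seq, ← hσ₁]
  refine ⟨?_, y, hy, hpos⟩
  simp only [cost, Expr.cost] at c1 c2 ⊢
  have e1 : N * (500 * (k + 1) * (B + 2) + 3) ≤ N * (500 * N * N + 3) := by
    gcongr; omega
  have e2 : N * (500 * N * N + 3) = 500 * N ^ 3 + 3 * N := by ring
  have e3 : N * (3 * 3) ≤ N ^ 3 := by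
    have : 3 * 3 ≤ N * N := Nat.mul_le_mul (by omega) (by omega)
    calc N * (3 * 3) ≤ N * (N * N) := Nat.mul_le_mul_left _ this
      _ = N ^ 3 := by ring
  omega

def absolute (x : Var) : Cmd := ite (var x) skip (assign x (minus (lit 0) (var x)))

/-- The distance between the points in `pt₁` and `x`. -/
def distance (d x : Var) : Cmd :=
  assign d (minus (get .pos (get .bucket (var .pt₁))) (get .pos (get .bucket (var x)))) ;;
    absolute d

/-- Tests the constraint in cell `ptr`. -/
def testTriple : Cmd :=
  ite (get .inp (var .ptr))
    (distance .dist₁ .pt₂ ;; distance .dist₂ .pt₃ ;;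
      ite (minus (var .dist₂) (var .dist₁)) (incr .sat) skip) skip ;;
    incr .ptr

def evalThird : Cmd := assign .pt₃ (lit 0) ;; loop (var .size) (testTriple ;; incr .pt₃)

def evalSecond : Cmd := assign .pt₂ (lit 0) ;; loop (var .size) (evalThird ;; incr .pt₂)

/-- Counts the satisfied constraints. -/
def evaluate : Cmd :=
  assign .sat (lit 0) ;; assign .ptr (lit 2) ;; assign .pt₁ (lit 0) ;;
    loop (var .size) (evalSecond ;; incr .pt₁)

/-- The position of a point. -/
def position (σ : State) (v : ℕ) : ℤ := σ.a .pos (σ.a .bucket v).toNat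

theorem position_congr {σ τ : State} (h1 : τ.a .pos = σ.a .pos)
    (h2 : τ.a .bucket = σ.a .bucket) : position τ = position σ := by
  funext v
  simp only [position, h1, h2]

theorem distance_spec {d x : Var} {σ : State} {a b : ℕ} (ha : σ.v .pt₁ = a) (hb : σ.v x = b) :
    (distance d x).cost σ ≤ 100 ∧
      ((distance d x).run σ).v d = |position σ a - position σ b| := by
  set σ₁ := (assign d (minus (get .pos (get .bucket (var .pt₁)))
    (get .pos (get .bucket (var x))))).run σ with hσ₁
  have h1 : σ₁.v d = position σ a - position σ b := by
    simp [hσ₁, run, eval, ha, hb, position]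
  rw [distance, cost_seq, run_seq, ← hσ₁]
  by_cases h : 0 < (var d).eval σ₁
  · rw [absolute, run_ite_pos h, run, h1, cost, cost, if_pos h]
    simp only [eval, h1] at h
    refine ⟨by simp [Expr.cost, cost], (abs_of_pos h).symm⟩
  · rw [absolute, run_ite_neg h, cost, cost, if_neg h]
    simp only [eval, h1] at h
    refine ⟨by simp [Expr.cost, cost], ?_⟩
    rw [abs_of_nonpos (by omega)]
    simp [run, eval, h1]

theorem testTriple_spec {σ : State} {P x y z : ℕ} (hP : σ.v .ptr = P) (hx : σ.v .pt₁ = x)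
    (hy : σ.v .pt₂ = y) (hz : σ.v .pt₃ = z) :
    testTriple.cost σ ≤ 300 ∧ (testTriple.run σ).v .ptr = (P + 1 : ℕ) ∧
      (testTriple.run σ).v .sat =
        σ.v .sat + (if Counts (σ.a .inp) (position σ) P x y z then 1 else 0 : ℕ) := by
  have hcell : (get .inp (var .ptr)).eval σ = σ.a .inp P := by simp [eval, hP]
  rw [testTriple, cost_seq, run_seq]
  by_cases hI : 0 < σ.a .inp P
  swap
  · rw [run_ite_neg (hcell ▸ hI)]
    refine ⟨?_, ?_, ?_⟩
    · simp [cost, hcell, hI, incr, Expr.cost]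
    · simp [run, incr, eval, hP]
    · simp [run, incr, Counts, hI]
  rw [run_ite_pos (hcell ▸ hI), cost, if_pos (hcell ▸ hI)]
  obtain ⟨c1, r1⟩ := distance_spec (d := .dist₁) hx hy
  set σ₁ := (distance .dist₁ .pt₂).run σ with hσ₁
  have hpos : position σ₁ = position σ :=
    position_congr (run_a_of_notMem _ _ (by decide)) (run_a_of_notMem _ _ (by decide))
  obtain ⟨c2, r2⟩ := distance_spec (d := .dist₂) (x := .pt₃) (σ := σ₁) (a := x) (b := z)
    (by rw [hσ₁, run_v_of_notMem _ _ (by decide), hx])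
    (by rw [hσ₁, run_v_of_notMem _ _ (by decide), hz])
  rw [hpos] at r2
  rw [cost_seq, cost_seq, run_seq, run_seq, ← hσ₁]
  set σ₂ := (distance .dist₂ .pt₃).run σ₁ with hσ₂
  have r1' : σ₂.v .dist₁ = |position σ x - position σ y| := by
    rw [hσ₂, run_v_of_notMem _ _ (by decide), r1]
  have hsat : σ₂.v .sat = σ.v .sat := by
    rw [hσ₂, run_v_of_notMem _ _ (by decide), hσ₁, run_v_of_notMem _ _ (by decide)]
  have hptr : σ₂.v .ptr = P := by
    rw [hσ₂, run_v_of_notMem _ _ (by decide), hσ₁, run_v_of_notMem _ _ (by decide), hP]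
  by_cases hd : |position σ x - position σ y| < |position σ x - position σ z|
  · have hd' : 0 < (minus (var .dist₂) (var .dist₁)).eval σ₂ := by
      simp only [eval, r1', r2]; linarith
    rw [run_ite_pos hd', cost, if_pos hd']
    refine ⟨?_, ?_, ?_⟩
    · simp only [cost, incr, Expr.cost]
      omega
    · simp [run, incr, eval, hptr]
    · simp [run, incr, eval, hsat, Counts, hI, hd]
  · have hd' : ¬ 0 < (minus (var .dist₂) (var .dist₁)).eval σ₂ := by
      simp only [eval, r1', r2]; linarith
    rw [run_ite_neg hd', cost, if_neg hd']
    refine ⟨?_, ?_, ?_⟩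
    · simp only [cost, incr, Expr.cost]
      omega
    · simp [run, incr, eval, hptr]
    · simp [run, incr, hsat, Counts, hd]

theorem evalThird_spec {σ : State} {n P x y : ℕ} (hn : σ.v .size = n) (hP : σ.v .ptr = P)
    (hx : σ.v .pt₁ = x) (hy : σ.v .pt₂ = y) :
    evalThird.cost σ ≤ 400 * (n + 1) ∧ (evalThird.run σ).v .ptr = (P + n : ℕ) ∧
      (evalThird.run σ).v .sat = σ.v .sat + score₁ (σ.a .inp) (position σ) P x y n := by
  have h := loop_rule (e := var .size) (c := testTriple ;; incr .pt₃)
    (σ := (assign .pt₃ (lit 0)).run σ) (k := n) (t := 310)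
    (fun i τ => τ.v .pt₃ = i ∧ τ.v .ptr = (P + i : ℕ) ∧
      τ.v .sat = σ.v .sat + score₁ (σ.a .inp) (position σ) P x y i)
    (by simp [eval, run, hn]) (by simp [run, eval, hP, score₁])
    (by
      rintro i _ τ ⟨h1, h2, h3⟩ hv ha
      obtain ⟨c1, r1, r2⟩ := testTriple_spec (σ := τ) (x := x) (y := y) h2
        (by rw [hv _ (by decide)]; simpa [run] using hx)
        (by rw [hv _ (by decide)]; simpa [run] using hy) h1
      have h1' : (testTriple.run τ).v .pt₃ = i := by rw [run_v_of_notMem _ _ (by decide), h1]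
      rw [cost_seq, run_seq]
      refine ⟨?_, ?_, ?_, ?_⟩
      · simp only [cost, incr, Expr.cost]
        omega
      · simp [run, incr, eval, h1']
      · simp [run, incr, r1]; ring
      · have e1 : τ.a .inp = σ.a .inp := ha _ (by decide)
        have e2 : position τ = position σ :=
          position_congr (ha _ (by decide)) (ha _ (by decide))
        have e3 : ((incr .pt₃).run (testTriple.run τ)).v .sat = (testTriple.run τ).v .sat := by
          simp [run, incr]
        rw [e3, r2, h3, e1, e2, score₁, score₁, Finset.sum_range_succ]
        push_cast
        ring)
  obtain ⟨c1, -, h2, h3⟩ := h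
  rw [evalThird, cost_seq, run_seq]
  refine ⟨?_, h2, h3⟩
  simp only [cost, Expr.cost] at c1 ⊢
  omega

theorem evalSecond_spec {σ : State} {n P x : ℕ} (hn : σ.v .size = n) (hP : σ.v .ptr = P)
    (hx : σ.v .pt₁ = x) :
    evalSecond.cost σ ≤ 500 * (n + 1) ^ 2 ∧ (evalSecond.run σ).v .ptr = (P + n * n : ℕ) ∧
      (evalSecond.run σ).v .sat = σ.v .sat + score₂ (σ.a .inp) n (position σ) P x n := by
  have h := loop_rule (e := var .size) (c := evalThird ;; incr .pt₂)
    (σ := (assign .pt₂ (lit 0)).run σ) (k := n) (t := 410 * (n + 1))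
    (fun i τ => τ.v .pt₂ = i ∧ τ.v .ptr = (P + i * n : ℕ) ∧
      τ.v .sat = σ.v .sat + score₂ (σ.a .inp) n (position σ) P x i)
    (by simp [eval, run, hn]) (by simp [run, eval, hP, score₂])
    (by
      rintro i _ τ ⟨h1, h2, h3⟩ hv ha
      obtain ⟨c1, r1, r2⟩ := evalThird_spec (σ := τ) (n := n) (x := x)
        (by rw [hv _ (by decide)]; simpa [run] using hn) h2
        (by rw [hv _ (by decide)]; simpa [run] using hx) h1
      have h1' : (evalThird.run τ).v .pt₂ = i := by rw [run_v_of_notMem _ _ (by decide), h1]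
      rw [cost_seq, run_seq]
      refine ⟨?_, ?_, ?_, ?_⟩
      · simp only [cost, incr, Expr.cost]
        omega
      · simp [run, incr, eval, h1']
      · have e3 : ((incr .pt₂).run (evalThird.run τ)).v .ptr = (evalThird.run τ).v .ptr := by
          simp [run, incr]
        rw [e3, r1]
        congr 1
        ring
      · have e1 : τ.a .inp = σ.a .inp := ha _ (by decide)
        have e2 : position τ = position σ :=
          position_congr (ha _ (by decide)) (ha _ (by decide))
        have e3 : ((incr .pt₂).run (evalThird.run τ)).v .sat = (evalThird.run τ).v .sat := by
          simp [run, incr]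
        rw [e3, r2, h3, e1, e2, score₂, score₂, Finset.sum_range_succ]
        push_cast
        ring)
  obtain ⟨c1, -, h2, h3⟩ := h
  rw [evalSecond, cost_seq, run_seq]
  refine ⟨?_, h2, h3⟩
  simp only [cost, Expr.cost] at c1 ⊢
  have : (n + 1) ^ 2 = n * n + 2 * n + 1 := by ring
  have : n * (410 * (n + 1) + 3) = 410 * (n * n) + 413 * n := by ring
  omega

theorem evaluate_spec {σ : State} {n : ℕ} (hn : σ.v .size = n) :
    evaluate.cost σ ≤ 600 * (n + 1) ^ 3 ∧
      (evaluate.run σ).v .sat = score₃ (σ.a .inp) n (position σ) 2 n := by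
  set σ₀ := (assign .pt₁ (lit 0)).run ((assign .ptr (lit 2)).run ((assign .sat (lit 0)).run σ))
    with hσ₀
  have h := loop_rule (e := var .size) (c := evalSecond ;; incr .pt₁)
    (σ := σ₀) (k := n) (t := 510 * (n + 1) ^ 2)
    (fun i τ => τ.v .pt₁ = i ∧ τ.v .ptr = (2 + i * (n * n) : ℕ) ∧
      τ.v .sat = score₃ (σ.a .inp) n (position σ) 2 i)
    (by simp [eval, run, hn, hσ₀]) (by simp [run, eval, score₃, hσ₀])
    (by
      rintro i _ τ ⟨h1, h2, h3⟩ hv ha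
      obtain ⟨c1, r1, r2⟩ := evalSecond_spec (σ := τ) (n := n)
        (by rw [hv _ (by decide)]; simpa [run, hσ₀] using hn) h2 h1
      have h1' : (evalSecond.run τ).v .pt₁ = i := by rw [run_v_of_notMem _ _ (by decide), h1]
      rw [cost_seq, run_seq]
      refine ⟨?_, ?_, ?_, ?_⟩
      · simp only [cost, incr, Expr.cost]
        have : 1 ≤ (n + 1) ^ 2 := Nat.one_le_pow _ _ (by omega)
        omega
      · simp [run, incr, eval, h1']
      · have e3 : ((incr .pt₁).run (evalSecond.run τ)).v .ptr = (evalSecond.run τ).v .ptr := by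
          simp [run, incr]
        rw [e3, r1]
        congr 1
        ring
      · have e1 : τ.a .inp = σ.a .inp := ha _ (by decide)
        have e2 : position τ = position σ :=
          position_congr (ha _ (by decide)) (ha _ (by decide))
        have e3 : ((incr .pt₁).run (evalSecond.run τ)).v .sat = (evalSecond.run τ).v .sat := by
          simp [run, incr]
        rw [e3, r2, h3, e1, e2, score₃, score₃, Finset.sum_range_succ]
        push_cast
        ring)
  obtain ⟨c1, -, -, h3⟩ := h
  rw [evaluate, cost_seq, cost_seq, cost_seq, run_seq, run_seq, run_seq, ← hσ₀]
  refine ⟨?_, h3⟩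
  simp only [cost, Expr.cost] at c1 ⊢
  have h1 : 1 ≤ (n + 1) ^ 2 := Nat.one_le_pow _ _ (by omega)
  have h2 : n * (510 * (n + 1) ^ 2 + 3) ≤ (n + 1) * (513 * (n + 1) ^ 2) := by
    apply Nat.mul_le_mul <;> omega
  have h3 : (n + 1) * (513 * (n + 1) ^ 2) = 513 * (n + 1) ^ 3 := by ring
  have h4 : 1 ≤ (n + 1) ^ 3 := Nat.one_le_pow _ _ (by omega)
  omega

/-- Saves the current positions if they are better than all earlier ones. -/
def update : Cmd :=
  ite (minus (var .sat) (var .record))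
    (assign .record (var .sat) ;; assign .idx (lit 0) ;;
      loop (var .size) (store .best (var .idx) (get .pos (get .bucket (var .idx))) ;; incr .idx))
    skip

theorem update_spec {σ : State} {n s r : ℕ} (hn : σ.v .size = n) (hs : σ.v .sat = s)
    (hr : σ.v .record = r) :
    update.cost σ ≤ 100 * (n + 1) ∧ (update.run σ).v .record = (max r s : ℕ) ∧
      (r < s → ∀ v < n, (update.run σ).a .best v = position σ v) ∧
      (s ≤ r → (update.run σ).a .best = σ.a .best) := by
  have hev : (minus (var .sat) (var .record)).eval σ = s - r := by simp [eval, hs, hr]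
  by_cases h : r < s
  swap
  · have h' : ¬ 0 < (minus (var .sat) (var .record)).eval σ := by rw [hev]; omega
    rw [update, run_ite_neg h', cost, if_neg h']
    refine ⟨?_, ?_, fun h'' => absurd h'' h, fun _ => rfl⟩
    · simp [cost, Expr.cost]; omega
    · rw [run, hr, max_eq_left (by omega)]
  have h' : 0 < (minus (var .sat) (var .record)).eval σ := by rw [hev]; omega
  rw [update, run_ite_pos h', cost, if_pos h', cost_seq, cost_seq, run_seq, run_seq]
  set σ₀ := (assign .idx (lit 0)).run ((assign .record (var .sat)).run σ) with hσ₀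
  have hl := loop_rule (e := var .size)
    (c := store .best (var .idx) (get .pos (get .bucket (var .idx))) ;; incr .idx)
    (σ := σ₀) (k := n) (t := 50)
    (fun i τ => τ.v .idx = i ∧ ∀ v < i, τ.a .best v = position σ v)
    (by simp [eval, run, hn, hσ₀]) (by simp [run, eval, hσ₀])
    (by
      rintro i _ τ ⟨h1, h2⟩ hv ha
      have e2 : position τ = position σ :=
        position_congr (ha _ (by decide)) (ha _ (by decide))
      refine ⟨by simp [cost, Expr.cost, incr], ?_, ?_⟩
      · simp [run, incr, eval, h1]
      · intro v hvi
        simp only [run, incr, eval, h1, Int.toNat_natCast, Function.update_self,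
          Function.update_apply]
        split
        · rename_i hvi'
          rw [hvi', ← e2]
          rfl
        · exact h2 v (by omega))
  obtain ⟨c1, -, h2⟩ := hl
  refine ⟨?_, ?_, fun _ => h2, fun h'' => absurd h'' (by omega)⟩
  · simp only [cost, Expr.cost] at c1 ⊢
    omega
  · rw [run_v_of_notMem _ _ (by decide), max_eq_right h.le]
    simp [hσ₀, run, eval, hs]

end Cmd
end LoopLang

/-! ### The search over all centers and codes -/

namespace LoopLang

open LoopLang.Expr LoopLang.Cmd LLOC

/-- The constants of a run on `n` points with `m` parts and the input `I`. -/
structure Env (n m : ℕ) (I : ℕ → ℤ) (τ : State) : Prop where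
  size : τ.v .size = n
  parts : τ.v .parts = m
  width : τ.v .width = (n / m + 1 : ℕ)
  places : τ.v .places = (m + 1 : ℕ)
  bound : τ.v .bound = steps (m + 1)
  inp : τ.a .inp = I

theorem Env.of_eq {n m : ℕ} {I : ℕ → ℤ} {σ τ : State} (h : Env n m I σ)
    (hv : ∀ x ∈ [Var.size, .parts, .width, .places, .bound], τ.v x = σ.v x)
    (ha : τ.a .inp = σ.a .inp) : Env n m I τ where
  size := by rw [hv _ (by decide), h.size]
  parts := by rw [hv _ (by decide), h.parts]
  width := by rw [hv _ (by decide), h.width]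
  places := by rw [hv _ (by decide), h.places]
  bound := by rw [hv _ (by decide), h.bound]
  inp := by rw [ha, h.inp]

theorem Env.run {n m : ℕ} {I : ℕ → ℤ} {σ : State} (h : Env n m I σ) (c : Cmd)
    (hv : ∀ x ∈ [Var.size, .parts, .width, .places, .bound], x ∉ c.writes)
    (ha : Arr.inp ∉ c.arrWrites) : Env n m I (c.run σ) :=
  h.of_eq (fun x hx => run_v_of_notMem _ _ (hv x hx)) (run_a_of_notMem _ _ ha)

/-- The bucket of `v` for the center `u`. -/
def bucketIn (I : ℕ → ℤ) (n m u v : ℕ) : ℕ :=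
  if v = u then m else countPos I (2 + u * (n * n) + v * n) n / (n / m + 1)

theorem bucketIn_lt (I : ℕ → ℤ) {n m : ℕ} (hm : 0 < m) (u v : ℕ) : bucketIn I n m u v < m + 1 := by
  unfold bucketIn
  split
  · omega
  · have h : countPos I (2 + u * (n * n) + v * n) n ≤ n := by
      refine (Finset.card_filter_le _ _).trans ?_
      simp
    have := (Nat.div_lt_iff_lt_mul (Nat.succ_pos (n / m))).2 (lt_mul_div_add_one hm h)
    exact this.trans (Nat.lt_succ_self m)

/-- The candidate of the center `u` and the code `k` has a score of at most `s`. -/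
def Dominated (I : ℕ → ℤ) (n m u k s : ℕ) : Prop :=
  ∃ y, IsGreedy (m + 1) (decode (m + 1) k) (steps (m + 1)) y ∧
    score₃ I n (fun v => y (steps (m + 1)) (bucketIn I n m u v)) 2 n ≤ s

theorem Dominated.mono {I : ℕ → ℤ} {n m u k s t : ℕ} (h : Dominated I n m u k s) (hst : s ≤ t) :
    Dominated I n m u k t := by
  obtain ⟨y, hy, hs⟩ := h
  exact ⟨y, hy, hs.trans hst⟩

theorem add_three_le_steps (m : ℕ) : m + 1 + 2 ≤ steps (m + 1) := by
  have : 16 * (m + 1) ≤ steps (m + 1) := Nat.le_self_pow (by omega) _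
  omega

namespace Cmd

def tryCode : Cmd := placeBuckets ;; evaluate ;; update ;; incr .code

def tryCenter : Cmd :=
  findBuckets ;; assign .code (lit 0) ;; loop (var .bound) tryCode ;; incr .center

def readInput : Cmd := assign .size (get .inp (lit 0)) ;; assign .param (get .inp (lit 1))

def initSearch : Cmd := assign .record (lit 0) ;; assign .center (lit 0) ;; assign .start (lit 2)

/-- The output overwrites the beginning of the input, so it is written only after the search, from
the separate array `best`. -/
def writeOutput : Cmd :=
  assign .idx (lit 0) ;;
    loop (var .size) (store .inp (var .idx) (get .best (var .idx)) ;; incr .idx)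

def program : Cmd :=
  readInput ;; findParts ;; findWidth ;; findBound ;; initSearch ;;
    loop (var .size) tryCenter ;; writeOutput

/-- The invariant bounds `record` by the score of `best` without equality, so the search may start
with record `0` and no evaluated map. It suffices that all candidates seen are dominated by
`record`. -/
theorem tryCode_spec {σ : State} {n m : ℕ} {I : ℕ → ℤ} (hσ : Env n m I σ) (hm : 0 < m)
    {u k r : ℕ} (hk : σ.v .code = k) (hkN : k < steps (m + 1))
    (hb : ∀ v < n, σ.a .bucket v = bucketIn I n m u v) (hr : σ.v .record = r)
    (hrs : r ≤ score₃ I n (σ.a .best) 2 n) :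
    tryCode.cost σ ≤ 600 * steps (m + 1) ^ 3 + 800 * (n + 1) ^ 3 ∧
      (tryCode.run σ).v .code = (k + 1 : ℕ) ∧ ∃ s : ℕ, (tryCode.run σ).v .record = s ∧ r ≤ s ∧
        Dominated I n m u k s ∧ s ≤ score₃ I n ((tryCode.run σ).a .best) 2 n := by
  obtain ⟨c1, y, hy, hpos⟩ := placeBuckets_spec hk hσ.places (Nat.succ_pos m) hσ.bound hkN
    (add_three_le_steps m)
  have h1 := hσ.run placeBuckets (by decide) (by decide)
  set σ₁ := placeBuckets.run σ with hσ₁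
  obtain ⟨c2, r2⟩ := evaluate_spec h1.size
  have h2 := h1.run evaluate (by decide) (by decide)
  set σ₂ := evaluate.run σ₁ with hσ₂
  have hrec₂ : σ₂.v .record = r := by
    rw [hσ₂, run_v_of_notMem _ _ (by decide), hσ₁, run_v_of_notMem _ _ (by decide), hr]
  obtain ⟨c3, r3, hnew, hold⟩ := update_spec h2.size r2 hrec₂
  set σ₃ := update.run σ₂ with hσ₃
  have hcode₃ : σ₃.v .code = k := by
    rw [hσ₃, run_v_of_notMem _ _ (by decide), hσ₂, run_v_of_notMem _ _ (by decide), hσ₁,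
      run_v_of_notMem _ _ (by decide), hk]
  have hbest₂ : σ₂.a .best = σ.a .best := by
    rw [hσ₂, run_a_of_notMem _ _ (by decide), hσ₁, run_a_of_notMem _ _ (by decide)]
  have hposn : position σ₂ = position σ₁ :=
    position_congr (run_a_of_notMem _ _ (by decide)) (run_a_of_notMem _ _ (by decide))
  have hG : ∀ v < n, position σ₁ v = y (steps (m + 1)) (bucketIn I n m u v) := by
    intro v hv
    have hb₁ : σ₁.a .bucket = σ.a .bucket := run_a_of_notMem _ _ (by decide)
    rw [position, hb₁, hb v hv, Int.toNat_natCast, hpos _ (bucketIn_lt I hm u v)]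
  rw [h1.inp] at r3 hnew hold
  rw [tryCode, cost_seq, cost_seq, cost_seq, run_seq, run_seq, run_seq, ← hσ₁, ← hσ₂, ← hσ₃]
  refine ⟨?_, ?_, _, ?_, le_max_left _ _,
    Dominated.mono ⟨y, hy, (score₃_congr hG 2).ge⟩ (le_max_right _ _), ?_⟩
  · simp only [cost, incr, Expr.cost]
    have e1 : n + 1 ≤ (n + 1) ^ 3 := Nat.le_self_pow (by norm_num) _
    omega
  · simp [run, incr, eval, hcode₃]
  · have e3 : ((incr .code).run σ₃).v .record = σ₃.v .record := by simp [run, incr]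
    rw [e3, r3]
  · have e3 : ((incr .code).run σ₃).a .best = σ₃.a .best := rfl
    rw [e3]
    rcases Nat.lt_or_ge r (score₃ I n (position σ₁) 2 n) with h | h
    · rw [max_eq_right h.le]
      refine (score₃_congr (fun v hv => ?_) 2).le
      rw [hnew h v hv, hposn]
    · rw [max_eq_left h, hold h, hbest₂]
      exact hrs

theorem tryCenter_spec {σ : State} {n m : ℕ} {I : ℕ → ℤ} (hσ : Env n m I σ) (hm : 0 < m)
    {u r : ℕ} (hu : σ.v .center = u) (hs : σ.v .start = (2 + u * (n * n) : ℕ))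
    (hr : σ.v .record = r) (hrs : r ≤ score₃ I n (σ.a .best) 2 n) :
    tryCenter.cost σ ≤ 700 * steps (m + 1) ^ 4 + 1100 * steps (m + 1) * (n + 1) ^ 3 ∧
      (tryCenter.run σ).v .center = (u + 1 : ℕ) ∧
      (tryCenter.run σ).v .start = (2 + (u + 1) * (n * n) : ℕ) ∧
      ∃ s : ℕ, (tryCenter.run σ).v .record = s ∧ r ≤ s ∧
        (∀ k < steps (m + 1), Dominated I n m u k s) ∧
        s ≤ score₃ I n ((tryCenter.run σ).a .best) 2 n := by
  obtain ⟨c1, r1, hb⟩ := findBuckets_spec hσ.size hs hσ.width (Nat.succ_pos _) hu hσ.parts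
  have h1 := hσ.run findBuckets (by decide) (by decide)
  set σ₁ := findBuckets.run σ with hσ₁
  have h1' := h1.run (assign .code (lit 0)) (by decide) (by decide)
  set σ₂ := (assign .code (lit 0)).run σ₁ with hσ₂
  have hrec : σ₂.v .record = r := by
    rw [hσ₂, run_v_of_notMem _ _ (by decide), hσ₁, run_v_of_notMem _ _ (by decide), hr]
  have hcen : σ₂.v .center = u := by
    rw [hσ₂, run_v_of_notMem _ _ (by decide), hσ₁, run_v_of_notMem _ _ (by decide), hu]
  have hst : σ₂.v .start = (2 + u * (n * n) + n * n : ℕ) := by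
    rw [hσ₂, run_v_of_notMem _ _ (by decide), r1]
  have hbest : σ₂.a .best = σ.a .best := by
    rw [hσ₂, run_a_of_notMem _ _ (by decide), hσ₁, run_a_of_notMem _ _ (by decide)]
  have hbuck : ∀ v < n, σ₂.a .bucket v = bucketIn I n m u v := by
    intro v hv
    rw [hσ₂, run_a_of_notMem _ _ (by decide), hb v hv, bucketIn, hσ.inp]
  have h := loop_rule (e := var .bound) (c := tryCode) (σ := σ₂) (k := steps (m + 1))
    (t := 600 * steps (m + 1) ^ 3 + 800 * (n + 1) ^ 3)
    (fun i τ => τ.v .code = i ∧ ∃ s : ℕ, τ.v .record = s ∧ r ≤ s ∧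
        (∀ k < i, Dominated I n m u k s) ∧ s ≤ score₃ I n (τ.a .best) 2 n)
    (by simp [eval, h1'.bound])
    ⟨by simp [hσ₂, run, eval], r, hrec, le_rfl, by simp, by rw [hbest]; exact hrs⟩
    (by
      rintro i hi τ ⟨h2, s, h3, h4, h5, h6⟩ hv ha
      have hH : ∀ x ∈ [Var.size, .parts, .width, .places, .bound], x ∉ tryCode.writes := by decide
      have hτ : Env n m I τ := h1'.of_eq (fun x hx => hv x (hH x hx)) (ha _ (by decide))
      obtain ⟨c2, g1, t, g2, g3, g4, g5⟩ := tryCode_spec hτ hm (u := u) h2 hi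
        (by rw [ha _ (by decide)]; exact hbuck) h3 h6
      refine ⟨c2, g1, t, g2, h4.trans g3, fun k hk => ?_, g5⟩
      rcases Nat.lt_succ_iff_lt_or_eq.1 hk with hk' | hk'
      · exact (h5 k hk').mono g3
      · rw [hk']; exact g4)
  obtain ⟨c2, -, s, h3, h4, h5, h6⟩ := h
  rw [tryCenter, cost_seq, cost_seq, cost_seq, run_seq, run_seq, run_seq, ← hσ₁, ← hσ₂]
  set σ₃ := (loop (var .bound) tryCode).run σ₂ with hσ₃
  have hcen₃ : σ₃.v .center = u := by rw [hσ₃, run_v_of_notMem _ _ (by decide), hcen]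
  have hst₃ : σ₃.v .start = (2 + u * (n * n) + n * n : ℕ) := by
    rw [hσ₃, run_v_of_notMem _ _ (by decide), hst]
  refine ⟨?_, ?_, ?_, s, ?_, h4, h5, h6⟩
  · simp only [cost, incr, Expr.cost] at c2 ⊢
    set N := steps (m + 1) with hN
    have hN0 : 1 ≤ N := by have := add_three_le_steps m; omega
    have e1 : N * (600 * N ^ 3 + 800 * (n + 1) ^ 3 + 3) =
      600 * N ^ 4 + 800 * N * (n + 1) ^ 3 + 3 * N := by ring
    have e2 : N ≤ N ^ 4 := Nat.le_self_pow (by norm_num) _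
    have e3 : (n + 1) ^ 2 ≤ N * (n + 1) ^ 3 := by
      calc (n + 1) ^ 2 ≤ (n + 1) ^ 3 := Nat.pow_le_pow_right (by omega) (by norm_num)
        _ ≤ N * (n + 1) ^ 3 := Nat.le_mul_of_pos_left _ hN0
    have e4 : 800 * N * (n + 1) ^ 3 = 800 * (N * (n + 1) ^ 3) := by ring
    have e5 : 1100 * N * (n + 1) ^ 3 = 1100 * (N * (n + 1) ^ 3) := by ring
    omega
  · simp [run, incr, eval, hcen₃]
  · have e3 : ((incr .center).run σ₃).v .start = σ₃.v .start := by simp [run, incr]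
    rw [e3, hst₃]
    congr 1
    ring
  · have e3 : ((incr .center).run σ₃).v .record = σ₃.v .record := by simp [run, incr]
    rw [e3, h3]

theorem writeOutput_spec {σ : State} {n : ℕ} (hn : σ.v .size = n) :
    writeOutput.cost σ ≤ 60 * (n + 1) ∧
      ∀ v < n, (writeOutput.run σ).a .inp v = σ.a .best v := by
  have h := loop_rule (e := var .size)
    (c := store .inp (var .idx) (get .best (var .idx)) ;; incr .idx)
    (σ := (assign .idx (lit 0)).run σ) (k := n) (t := 50)
    (fun i τ => τ.v .idx = i ∧ ∀ v < i, τ.a .inp v = σ.a .best v)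
    (by simp [eval, run, hn]) (by simp [run, eval])
    (by
      rintro i _ τ ⟨h1, h2⟩ _ ha
      have hbest : τ.a .best = σ.a .best := ha _ (by decide)
      refine ⟨by simp [cost, Expr.cost, incr], ?_, ?_⟩
      · simp [run, incr, eval, h1]
      · intro v hvi
        simp only [run, incr, eval, h1, Int.toNat_natCast, Function.update_self,
          Function.update_apply]
        split
        · rename_i hvi'
          rw [hvi', hbest]
        · exact h2 v (by omega))
  obtain ⟨c1, -, h2⟩ := h
  rw [writeOutput, cost_seq, run_seq]
  refine ⟨?_, h2⟩
  simp only [cost, Expr.cost] at c1 ⊢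
  omega

/-- The program finds a map which is at least as good as all candidates. -/
theorem program_spec {σ : State} {n k : ℕ} (hn : σ.a .inp 0 = n) (hk : σ.a .inp 1 = k) :
    ∃ m : ℕ, 0 < m ∧ k ≤ m ^ 8 ∧ (m = 1 ∨ (m - 1) ^ 8 < k) ∧
      program.cost σ ≤ 400 * (k + 1) ^ 5 + 200 * steps (m + 1) ^ 2 + 200 * (n + 1) +
        n * (700 * steps (m + 1) ^ 4 + 1100 * steps (m + 1) * (n + 1) ^ 3 + 3) ∧
      ∃ g : ℕ → ℤ, (∀ v < n, (program.run σ).a .inp v = g v) ∧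
        ∀ u < n, ∀ l < steps (m + 1),
          Dominated (σ.a .inp) n m u l (score₃ (σ.a .inp) n g 2 n) := by
  set σ₁ := readInput.run σ with hσ₁
  have hn₁ : σ₁.v .size = n := by simp [hσ₁, readInput, run, eval, hn]
  have hk₁ : σ₁.v .param = k := by simp [hσ₁, readInput, run, eval, hk]
  obtain ⟨c2, m, hm, hm0, hm1, hm2⟩ := findParts_spec hk₁
  set σ₂ := findParts.run σ₁ with hσ₂
  have hn₂ : σ₂.v .size = n := by rw [hσ₂, run_v_of_notMem _ _ (by decide), hn₁]
  obtain ⟨c3, r3⟩ := findWidth_spec hn₂ hm hm0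
  set σ₃ := findWidth.run σ₂ with hσ₃
  have hm₃ : σ₃.v .parts = m := by rw [hσ₃, run_v_of_notMem _ _ (by decide), hm]
  have hn₃ : σ₃.v .size = n := by rw [hσ₃, run_v_of_notMem _ _ (by decide), hn₂]
  obtain ⟨c4, r4, s4⟩ := findBound_spec hm₃
  set σ₄ := findBound.run σ₃ with hσ₄
  have henv₄ : Env n m (σ.a .inp) σ₄ := by
    refine ⟨?_, ?_, ?_, r4, s4, ?_⟩
    · rw [hσ₄, run_v_of_notMem _ _ (by decide), hn₃]
    · rw [hσ₄, run_v_of_notMem _ _ (by decide), hm₃]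
    · rw [hσ₄, run_v_of_notMem _ _ (by decide), r3]
    · rw [hσ₄, run_a_of_notMem _ _ (by decide), hσ₃, run_a_of_notMem _ _ (by decide), hσ₂,
        run_a_of_notMem _ _ (by decide), hσ₁, run_a_of_notMem _ _ (by decide)]
  have henv := henv₄.run initSearch (by decide) (by decide)
  set σ₅ := initSearch.run σ₄ with hσ₅
  have h := loop_rule (e := var .size) (c := tryCenter) (σ := σ₅) (k := n)
    (t := 700 * steps (m + 1) ^ 4 + 1100 * steps (m + 1) * (n + 1) ^ 3)
    (fun i τ => τ.v .center = i ∧ τ.v .start = (2 + i * (n * n) : ℕ) ∧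
      ∃ s : ℕ, τ.v .record = s ∧
        (∀ u < i, ∀ l < steps (m + 1), Dominated (σ.a .inp) n m u l s) ∧
        s ≤ score₃ (σ.a .inp) n (τ.a .best) 2 n)
    (by simp [eval, henv.size])
    ⟨by simp [hσ₅, initSearch, run, eval], by simp [hσ₅, initSearch, run, eval], 0,
      by simp [hσ₅, initSearch, run, eval], by simp, Nat.zero_le _⟩
    (by
      rintro i hi τ ⟨h1, h2, s, h3, h4, h5⟩ hv ha
      have hH : ∀ x ∈ [Var.size, .parts, .width, .places, .bound], x ∉ tryCenter.writes := by
        decide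
      have hτ : Env n m (σ.a .inp) τ :=
        henv.of_eq (fun x hx => hv x (hH x hx)) (ha _ (by decide))
      obtain ⟨c, g1, g2, t, g3, g4, g5, g6⟩ := tryCenter_spec hτ hm0 h1 h2 h3 h5
      refine ⟨c, g1, g2, t, g3, fun u hu l hl => ?_, g6⟩
      rcases Nat.lt_succ_iff_lt_or_eq.1 hu with hu' | hu'
      · exact (h4 u hu' l hl).mono g4
      · rw [hu']; exact g5 l hl)
  obtain ⟨c6, -, -, s, -, h4, h5⟩ := h
  have henv₆ := henv.run (loop (var .size) tryCenter) (by decide) (by decide)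
  set σ₆ := (loop (var .size) tryCenter).run σ₅ with hσ₆
  obtain ⟨c7, r7⟩ := writeOutput_spec henv₆.size
  refine ⟨m, hm0, hm1, hm2, ?_, σ₆.a .best, ?_, fun u hu l hl => (h4 u hu l hl).mono h5⟩
  · have c1 : readInput.cost σ ≤ 25 := by simp [readInput, cost, Expr.cost]
    have c5 : initSearch.cost σ₄ ≤ 10 := by simp [initSearch, cost, Expr.cost]
    rw [program, cost_seq, cost_seq, cost_seq, cost_seq, cost_seq, cost_seq, ← hσ₁, ← hσ₂, ← hσ₃,
      ← hσ₄, ← hσ₅, ← hσ₆]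
    simp only [Expr.cost] at c6
    omega
  · rw [program, run_seq, run_seq, run_seq, run_seq, run_seq, run_seq, ← hσ₁, ← hσ₂, ← hσ₃,
      ← hσ₄, ← hσ₅, ← hσ₆]
    exact r7

end Cmd
end LoopLang

/-! ### Correctness of the output and the time bound -/

namespace LLOC

open LoopLang

variable {n : ℕ}

theorem mul_add_inj {a b c d : ℕ} (hb : b < n) (hd : d < n) (h : a * n + b = c * n + d) :
    a = c ∧ b = d := by
  have h1 := congrArg (· / n) h
  have h2 := congrArg (· % n) h
  have hn : 0 < n := by omega
  simp only [mul_comm _ n, Nat.mul_add_div hn, Nat.mul_add_mod, Nat.div_eq_of_lt hb,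
    Nat.div_eq_of_lt hd, Nat.mod_eq_of_lt hb, Nat.mod_eq_of_lt hd, add_zero] at h1 h2
  exact ⟨h1, h2⟩

open Classical in
theorem input_cell (T : Constraints n) (k : ℕ) (u v w : Fin n) :
    input T k ((2 + (u : ℕ) * (n * n) + v * n + w : ℕ) : ℤ) = if (u, v, w) ∈ T then 1 else 0 := by
  unfold input
  rw [if_neg (by omega), if_neg (by omega)]
  refine if_congr ⟨?_, fun h => ⟨u, v, w, h, by push_cast; ring⟩⟩ rfl rfl
  rintro ⟨x, y, z, h, e⟩
  have e' : ((u : ℕ) * n + v) * n + w = ((x : ℕ) * n + y) * n + z := by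
    zify
    push_cast at e
    linear_combination e
  obtain ⟨e1, e2⟩ := mul_add_inj w.2 z.2 e'
  obtain ⟨e3, e4⟩ := mul_add_inj v.2 y.2 e1
  rwa [Fin.ext e3, Fin.ext e4, Fin.ext e2]

theorem input_cell_pos (T : Constraints n) (k : ℕ) (u v w : Fin n) :
    0 < input T k ((2 + (u : ℕ) * (n * n) + v * n + w : ℕ) : ℤ) ↔ (u, v, w) ∈ T := by
  rw [input_cell]
  split_ifs with h <;> simp [h]

theorem input_of_neg (T : Constraints n) (k : ℕ) {a : ℤ} (ha : a < 0) : input T k a = 0 := by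
  unfold input
  rw [if_neg (by omega), if_neg (by omega), if_neg]
  rintro ⟨u, v, w, -, rfl⟩
  have : 0 ≤ 2 + (((u : ℕ) : ℤ) * (n : ℤ) + ((v : ℕ) : ℤ)) * (n : ℤ) + ((w : ℕ) : ℤ) := by
    positivity
  omega

/-- The input as an array. -/
noncomputable def inputArray (T : Constraints n) (k : ℕ) : ℕ → ℤ := fun i => input T k i

/-- The initial state of the loop language. -/
noncomputable def initialState (T : Constraints n) (k : ℕ) : State :=
  ⟨fun _ => 0, fun A => if A = .inp then inputArray T k else 0⟩

/-- No preparation is needed: `inp` lies at the nonnegative addresses, and all variables and other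
arrays lie in negative cells, which are initially `0`. -/
theorem rep_initialState (T : Constraints n) (k : ℕ) : Rep (input T k) (initialState T k) where
  v x := input_of_neg T k (by unfold vaddr; omega)
  a A i := by
    cases A
    · rfl
    all_goals
      exact input_of_neg T k (by simp [Arr.addr, Arr.shift]; omega)

theorem countPos_inputArray (T : Constraints n) (k : ℕ) (u v : Fin n) :
    countPos (inputArray T k) (2 + (u : ℕ) * (n * n) + v * n) n = farCount T u v := by
  classical
  rw [countPos, farCount, Finset.card_filter, Finset.card_filter, Finset.sum_range]
  refine Finset.sum_congr rfl fun x _ => ?_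
  simp only [inputArray, input_cell_pos]

theorem bucketIn_inputArray (T : Constraints n) (k m : ℕ) (u v : Fin n) :
    bucketIn (inputArray T k) n m u v = bucketOf T m u v := by
  simp only [bucketIn, bucketOf, countPos_inputArray, Fin.ext_iff]

open Classical in
theorem score₃_inputArray (T : Constraints n) (k : ℕ) (G : ℕ → ℤ) :
    score₃ (inputArray T k) n G 2 n =
      (T.filter fun c => Satisfies (fun v : Fin n => (G v : ℝ)) c).card := by
  have h : T.filter (fun c => Satisfies (fun v : Fin n => (G v : ℝ)) c) = Finset.univ.filter
      fun c => c ∈ T ∧ Satisfies (fun v : Fin n => (G v : ℝ)) c := by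
    ext; simp
  rw [h, Finset.card_filter, Fintype.sum_prod_type]
  simp only [Fintype.sum_prod_type, score₃, score₂, score₁, Finset.sum_range]
  refine Finset.sum_congr rfl fun x _ => Finset.sum_congr rfl fun y _ =>
    Finset.sum_congr rfl fun z _ => if_congr (and_congr ?_ ?_) rfl rfl
  · exact input_cell_pos T k x y z
  · simp only [Satisfies]
    exact_mod_cast Iff.rfl

theorem card_violated_le_of_score₃_le {T : Constraints n} {k : ℕ} {G H : ℕ → ℤ}
    (h : score₃ (inputArray T k) n H 2 n ≤ score₃ (inputArray T k) n G 2 n) :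
    (violated T fun v => (G v : ℝ)).card ≤ (violated T fun v => (H v : ℝ)).card := by
  classical
  rw [score₃_inputArray, score₃_inputArray] at h
  have h1 := T.card_filter_add_card_filter_not (fun c => Satisfies (fun v : Fin n => (G v : ℝ)) c)
  have h2 := T.card_filter_add_card_filter_not (fun c => Satisfies (fun v : Fin n => (H v : ℝ)) c)
  unfold violated
  omega

/-- An output that scores as well as every code of every center is good. -/
theorem card_violated_le_of_dominated {T : Constraints n} (hT : IsDense T) (hn : 3 ≤ n) {d : ℝ}
    (hd0 : 0 < d) (hd : d ≤ 1 / 2) {f : Fin n → ℝ}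
    (hf : ((violated T f).card : ℝ) ≤ d ^ 8 * T.card) {m k : ℕ} (hm : 0 < m)
    (hm1 : 1 ≤ 2 * (m * d)) (hm2 : m * d ≤ 2) {g : ℕ → ℤ}
    (hg : ∀ u < n, ∀ l < steps (m + 1),
      Dominated (inputArray T k) n m u l (score₃ (inputArray T k) n g 2 n)) :
    ((violated T fun v => (g v : ℝ)).card : ℝ) ≤ 648 * d * T.card := by
  obtain ⟨u, F, hF⟩ := exists_placement hT hn hd0 hd hf hm1 hm2
  refine le_trans ?_ hF
  obtain ⟨S, hS, hSF⟩ := exists_greedy_pattern (m + 1) m.succ_pos F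
  -- With `B = m + 1`, the greedy choice ranges over the `B + 1 = m + 2` indices `0, …, B`.
  obtain ⟨l, hl, hlS⟩ := exists_decode m.succ_pos S hS (m + 2)
  have hl' : l < steps (m + 1) := by
    refine hl.trans_le ?_
    unfold steps
    calc (m + 1) ^ (4 * (m + 2)) ≤ (m + 1) ^ (4 * (m + 1) + 8) :=
          Nat.pow_le_pow_right (by omega) (by omega)
      _ ≤ _ := Nat.pow_le_pow_left (by omega) _
  obtain ⟨y, hy, hs⟩ := hg u u.2 l hl'
  -- The way in which the program breaks ties is irrelevant, since the pattern is realized by every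
  -- greedy sequence for `S`.
  have hyS := hSF y (hy.congr fun j hj => hlS j (by omega))
  refine Nat.cast_le.2 ((card_violated_le_of_score₃_le hs).trans (Finset.card_le_card ?_))
  intro c hc
  simp only [violated, Finset.mem_filter] at hc ⊢
  refine ⟨hc.1, fun h => hc.2 ?_⟩
  have := abs_sub_lt_abs_sub hyS (bucketOf_lt T hm u c.1) (bucketOf_lt T hm u c.2.1)
    (bucketOf_lt T hm u c.2.2) h
  simp only [Satisfies, bucketIn_inputArray]
  exact_mod_cast this

theorem card_eq_zero_of_lt {T : Constraints n} (hT : IsDense T) (hn : n < 3) : T.card = 0 := by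
  rw [Finset.card_eq_zero, Finset.eq_empty_iff_forall_notMem]
  rintro ⟨u, v, w⟩ h
  obtain ⟨h1, h2, h3⟩ := hT.distinct u v w h
  simp only [ne_eq, Fin.ext_iff] at h1 h2 h3
  omega

/-- The mixed term `n · N · n^3` is the source of `n ^ 7`: it is at most `n · n^6` if `N ≤ n^3`, and
at most `n · N^2` otherwise. -/
theorem cost_bound {n k m t : ℕ} (hn : 0 < n) (hk : k ≤ m ^ 8)
    (ht : t ≤ 400 * (k + 1) ^ 5 + 200 * steps (m + 1) ^ 2 + 200 * (n + 1) +
      n * (700 * steps (m + 1) ^ 4 + 1100 * steps (m + 1) * (n + 1) ^ 3 + 3)) :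
    t ≤ 9000 * n ^ 7 + 12000 * (n * steps (m + 1) ^ 5) := by
  have hkN : k + 1 ≤ steps (m + 1) := by
    have h1 : m ^ 8 < (m + 1) ^ 8 := Nat.pow_lt_pow_left (by omega) (by omega)
    have h2 : (m + 1) ^ 8 ≤ steps (m + 1) :=
      (Nat.pow_le_pow_left (by omega) 8).trans (Nat.pow_le_pow_right (by omega) (by omega))
    omega
  generalize steps (m + 1) = N at *
  have hN : 1 ≤ N := by omega
  have h1 : (k + 1) ^ 5 ≤ n * N ^ 5 :=
    (Nat.pow_le_pow_left hkN 5).trans (Nat.le_mul_of_pos_left _ hn)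
  have h2 : N ^ 2 ≤ n * N ^ 5 :=
    (Nat.pow_le_pow_right hN (by norm_num)).trans (Nat.le_mul_of_pos_left _ hn)
  have h3 : n ≤ n * N ^ 5 := Nat.le_mul_of_pos_right _ (by positivity)
  have h4 : n * N ^ 4 ≤ n * N ^ 5 :=
    Nat.mul_le_mul_left _ (Nat.pow_le_pow_right hN (by norm_num))
  have h5 : n * (N * (n + 1) ^ 3) ≤ 8 * (n ^ 7 + n * N ^ 5) := by
    have e1 : (n + 1) ^ 3 ≤ 8 * n ^ 3 := by
      calc (n + 1) ^ 3 ≤ (2 * n) ^ 3 := Nat.pow_le_pow_left (by omega) 3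
        _ = 8 * n ^ 3 := by ring
    have e2 : N * n ^ 3 ≤ n ^ 6 + N ^ 5 := by
      rcases le_total N (n ^ 3) with h | h
      · calc N * n ^ 3 ≤ n ^ 3 * n ^ 3 := Nat.mul_le_mul_right _ h
          _ = n ^ 6 := by ring
          _ ≤ _ := Nat.le_add_right _ _
      · calc N * n ^ 3 ≤ N * N := Nat.mul_le_mul_left _ h
          _ = N ^ 2 := by ring
          _ ≤ N ^ 5 := Nat.pow_le_pow_right hN (by norm_num)
          _ ≤ _ := Nat.le_add_left _ _
    calc n * (N * (n + 1) ^ 3) ≤ n * (N * (8 * n ^ 3)) := by gcongr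
      _ = 8 * (n * (N * n ^ 3)) := by ring
      _ ≤ 8 * (n * (n ^ 6 + N ^ 5)) := by gcongr
      _ = _ := by ring
  have e : n * (700 * N ^ 4 + 1100 * N * (n + 1) ^ 3 + 3) =
      700 * (n * N ^ 4) + 1100 * (n * (N * (n + 1) ^ 3)) + 3 * n := by ring
  omega

/-- The base of `steps` is at most `a^7` and its exponent at most `20 b`, which gives `140 b`. The
fifth power and `12000 ≤ 2^14` give `714 = 5 * 140 + 14`. -/
theorem steps_pow_le {a b : ℝ} (ha : 2 ≤ a) (hb1 : 1 ≤ b) (hba : b ≤ a) {m : ℕ}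
    (hm : (m : ℝ) ≤ b + 1) : 12000 * (steps (m + 1) : ℝ) ^ 5 ≤ a ^ (714 * b) := by
  have ha1 : 1 ≤ a := by linarith
  have ha0 : 0 < a := by linarith
  have h1 : (16 * (m + 1) : ℝ) ≤ a ^ (7 : ℝ) := by
    have h6 : (2 : ℝ) ^ 6 ≤ a ^ 6 := by gcongr
    have h7 : a ^ (7 : ℝ) = a ^ 6 * a := by
      rw [show (7 : ℝ) = ((7 : ℕ) : ℝ) by norm_num, Real.rpow_natCast]; ring
    rw [h7]
    nlinarith
  have h2 : (steps (m + 1) : ℝ) ≤ a ^ (140 * b) := by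
    unfold steps
    push_cast
    calc ((16 * (m + 1) : ℝ)) ^ (4 * (m + 1) + 8) ≤ (a ^ (7 : ℝ)) ^ (4 * (m + 1) + 8) := by gcongr
      _ = a ^ (7 * ((4 * (m + 1) + 8 : ℕ) : ℝ)) := by rw [Real.rpow_mul ha0.le, Real.rpow_natCast]
      _ ≤ a ^ (140 * b) := by
          apply Real.rpow_le_rpow_of_exponent_le ha1
          push_cast
          linarith
  have h3 : (12000 : ℝ) ≤ a ^ (14 * b) := by
    calc (12000 : ℝ) ≤ 2 ^ 14 := by norm_num
      _ ≤ a ^ 14 := by gcongr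
      _ = a ^ (14 : ℝ) := by
          rw [show (14 : ℝ) = ((14 : ℕ) : ℝ) by norm_num, Real.rpow_natCast]
      _ ≤ _ := Real.rpow_le_rpow_of_exponent_le ha1 (by linarith)
  calc 12000 * (steps (m + 1) : ℝ) ^ 5 ≤ a ^ (14 * b) * (a ^ (140 * b)) ^ 5 := by gcongr
    _ = a ^ (714 * b) := by
        rw [← Real.rpow_natCast (a ^ (140 * b)) 5, ← Real.rpow_mul ha0.le, ← Real.rpow_add ha0]
        congr 1
        push_cast
        ring

/-- The number of parts that the program chooses. -/
theorem parts_bounds {ε d : ℝ} (hε : 0 < ε) (hε1 : ε ≤ 1) (hd0 : 0 < d) (hd : d ^ 8 = ε) {m : ℕ}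
    (hm1 : ⌊1 / ε⌋₊ ≤ m ^ 8) (hm2 : m = 1 ∨ (m - 1) ^ 8 < ⌊1 / ε⌋₊) :
    (m : ℝ) ≤ 1 / d + 1 ∧ 1 ≤ 2 * (m * d) := by
  have hd8 : (1 / d) ^ 8 = 1 / ε := by rw [div_pow, one_pow, hd]
  have hpos : 0 < 1 / d := by positivity
  have ha : 1 ≤ 1 / ε := by rwa [le_div_iff₀ hε, one_mul]
  constructor
  · rcases hm2 with rfl | h
    · push_cast
      linarith
    · have h1 : (((m - 1 : ℕ) : ℝ)) ^ 8 ≤ (1 / d) ^ 8 := by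
        rw [hd8]
        have := Nat.floor_le (a := 1 / ε) (by linarith)
        refine le_trans ?_ this
        exact_mod_cast h.le
      have h2 := le_of_pow_le_pow_left₀ (by norm_num) hpos.le h1
      have h3 : (m : ℝ) ≤ ((m - 1 : ℕ) : ℝ) + 1 := by
        exact_mod_cast (by omega : m ≤ m - 1 + 1)
      linarith
  -- Rounding `1 / ε ≥ 1` down loses at most a factor 2, which the eighth root makes harmless.
  · have h1 : 1 / ε ≤ 2 * (m : ℝ) ^ 8 := by
      have h2 := Nat.lt_floor_add_one (1 / ε)
      have h3 : (1 : ℝ) ≤ (⌊1 / ε⌋₊ : ℝ) := by exact_mod_cast Nat.floor_pos.2 ha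
      have h4 : ((⌊1 / ε⌋₊ : ℕ) : ℝ) ≤ (m : ℝ) ^ 8 := by exact_mod_cast hm1
      linarith
    have h5 : (1 / d) ^ 8 ≤ (2 * (m : ℝ)) ^ 8 := by
      rw [hd8, mul_pow]
      have : (0 : ℝ) ≤ (m : ℝ) ^ 8 := by positivity
      linarith
    have h6 := le_of_pow_le_pow_left₀ (by norm_num) (by positivity) h5
    rw [div_le_iff₀ hd0] at h6
    linarith

/-- For `1 / ε` close to 1 the power of `1 / ε` absorbs no constant. But if `1 / ε < 2`, then `m =
1`, and the second term is a constant times `n`, charged to `n ^ 7`; hence `steps 2` in the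
constant. Otherwise `steps_pow_le` applies with `a = 1 / ε` and `b = 1 / d`. -/
theorem time_bound {ε d : ℝ} (hε : 0 < ε) (hε1 : ε ≤ 1) (hd0 : 0 < d) (hd : d ^ 8 = ε) {m n : ℕ}
    (hm0 : 0 < m) (hn : 0 < n) (hm : (m : ℝ) ≤ 1 / d + 1)
    (hm2 : m = 1 ∨ (m - 1) ^ 8 < ⌊1 / ε⌋₊) :
    (9000 * n ^ 7 + 12000 * (n * steps (m + 1) ^ 5) : ℝ) ≤
      (9000 + 12000 * (steps 2 : ℝ) ^ 5) * (n : ℝ) ^ 7 +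
        (1 / ε) ^ ((9000 + 12000 * (steps 2 : ℝ) ^ 5) / d) * n := by
  have ha : 1 ≤ 1 / ε := by rwa [le_div_iff₀ hε, one_mul]
  have hc : (0 : ℝ) ≤ 12000 * (steps 2 : ℝ) ^ 5 := by positivity
  have hn1 : (1 : ℝ) ≤ n := by exact_mod_cast hn
  rcases lt_or_ge (1 / ε) 2 with h | h
  · have hm1 : m = 1 := by
      refine hm2.elim id fun h' => ?_
      have h1 : ⌊1 / ε⌋₊ < 2 := (Nat.floor_lt (by linarith)).2 (by exact_mod_cast h)
      have h2 : m - 1 = 0 := by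
        by_contra h0
        have := Nat.one_le_pow 8 (m - 1) (by omega)
        omega
      omega
    subst hm1
    have h3 : (n : ℝ) ≤ (n : ℝ) ^ 7 := le_self_pow₀ hn1 (by norm_num)
    have h4 : 0 ≤ (1 / ε) ^ ((9000 + 12000 * (steps 2 : ℝ) ^ 5) / d) * n := by positivity
    have h5 : 12000 * (steps 2 : ℝ) ^ 5 * n ≤ 12000 * (steps 2 : ℝ) ^ 5 * (n : ℝ) ^ 7 := by gcongr
    have e : steps (1 + 1) = steps 2 := rfl
    rw [e]
    linarith
  · have hd1 : d ≤ 1 := by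
      by_contra hd1
      have := one_lt_pow₀ (not_le.1 hd1) (n := 8) (by norm_num)
      linarith
    have hb1 : 1 ≤ 1 / d := by rwa [le_div_iff₀ hd0, one_mul]
    have hb : 1 / d ≤ 1 / ε := by
      have : (1 / d) ^ 8 = 1 / ε := by rw [div_pow, one_pow, hd]
      rw [← this]
      exact le_self_pow₀ hb1 (by norm_num)
    have h1 := steps_pow_le h hb1 hb hm
    have h2 : (1 / ε) ^ (714 * (1 / d)) ≤
        (1 / ε) ^ ((9000 + 12000 * (steps 2 : ℝ) ^ 5) / d) := by
      apply Real.rpow_le_rpow_of_exponent_le ha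
      rw [mul_one_div]
      gcongr
      linarith
    have h3 : 12000 * (steps (m + 1) : ℝ) ^ 5 * n ≤
        (1 / ε) ^ ((9000 + 12000 * (steps 2 : ℝ) ^ 5) / d) * n := by
      have := h1.trans h2
      gcongr
    have h4 : 0 ≤ 12000 * (steps 2 : ℝ) ^ 5 * (n : ℝ) ^ 7 := by positivity
    linarith

theorem satisfiesFraction_of_dominated {T : Constraints n} (hT : IsDense T) {d : ℝ} (hd0 : 0 < d)
    {f : Fin n → ℝ} (hf : SatisfiesFraction T f (1 - d ^ 8)) {m k : ℕ} (hm : 0 < m)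
    (hm1 : (m : ℝ) ≤ 1 / d + 1) (hm2 : 1 ≤ 2 * (m * d)) {g : ℕ → ℤ}
    (hg : ∀ u < n, ∀ l < steps (m + 1),
      Dominated (inputArray T k) n m u l (score₃ (inputArray T k) n g 2 n)) {C : ℝ} (hC : 648 ≤ C) :
    SatisfiesFraction T (fun v => (g v : ℝ)) (1 - C * d) := by
  rw [satisfiesFraction_iff] at hf ⊢
  have hle : ((violated T fun u => (g u : ℝ)).card : ℝ) ≤ T.card := by
    classical
    exact_mod_cast Finset.card_filter_le _ _
  have hTc : (0 : ℝ) ≤ T.card := by positivity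
  rcases lt_or_ge n 3 with hn | hn
  · rw [card_eq_zero_of_lt hT hn] at hle ⊢
    simpa using hle
  -- For `d > 1 / 2` the claim is void, as `C * d ≥ 1`.
  rcases lt_or_ge (1 / 2) d with hd | hd
  · have h1 : 1 ≤ C * d := by nlinarith
    exact hle.trans (le_mul_of_one_le_left hTc h1)
  have hmd : m * d ≤ 2 := by
    have h : (1 / d + 1) * d = 1 + d := by field_simp
    have := mul_le_mul_of_nonneg_right hm1 hd0.le
    linarith
  refine (card_violated_le_of_dominated hT hn hd0 hd hf hm hm2 hmd hg).trans ?_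
  exact mul_le_mul_of_nonneg_right (mul_le_mul_of_nonneg_right hC hd0.le) hTc

/-- The memory after a run of the program, and the time. -/
theorem exists_exec_program (T : Constraints n) (k : ℕ) :
    ∃ t M, RAM.Exec (Cmd.program.comp 0) (input T k) t M ∧
      t ≤ Cmd.program.cost (initialState T k) ∧
      output n M = fun u : Fin n =>
        (((Cmd.program.run (initialState T k)).a .inp (u : ℕ) : ℤ) : ℝ) := by
  obtain ⟨t, M, ht, hM, hR, -⟩ := Cmd.program.comp_spec _ 0 _ (rep_initialState T k)
  refine ⟨t, M, hM, ht, funext fun u => ?_⟩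
  rw [← hR.a]
  rfl

end LLOC

theorem theorem1 :
    ∃ (P : RAM.Prog) (C : ℝ), 0 < C ∧
      ∀ (n : ℕ) (T : LLOC.Constraints n) (ε : ℝ),
        0 < n → LLOC.IsDense T → 0 < ε → ε ≤ 1 →
        (∃ f : Fin n → ℝ, LLOC.SatisfiesFraction T f (1 - ε)) →
        ∃ (t : ℕ) (M : RAM.Memory),
          RAM.Exec P (LLOC.input T ⌊1 / ε⌋₊) t M ∧
          (t : ℝ) ≤ C * (n : ℝ) ^ 7 + (1 / ε) ^ (C / ε ^ (1 / 8 : ℝ)) * (n : ℝ) ∧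
          LLOC.SatisfiesFraction T (LLOC.output n M) (1 - C * ε ^ (1 / 8 : ℝ)) := by
  have hc : (0 : ℝ) ≤ 12000 * (LLOC.steps 2 : ℝ) ^ 5 := by positivity
  -- One constant serves all purposes: it exceeds the factor 648 of the error and the exponent
  -- factor 714, and it covers the case `m = 1` of the time bound.
  refine ⟨LoopLang.Cmd.program.comp 0, 9000 + 12000 * (LLOC.steps 2 : ℝ) ^ 5, by linarith, ?_⟩
  rintro n T ε hn hT hε hε1 ⟨f, hf⟩
  have hd0 : 0 < ε ^ (1 / 8 : ℝ) := by positivity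
  have hd : (ε ^ (1 / 8 : ℝ)) ^ 8 = ε := by
    rw [← Real.rpow_natCast, ← Real.rpow_mul hε.le]
    norm_num
  generalize ε ^ (1 / 8 : ℝ) = d at hd0 hd
  obtain ⟨t, M, hM, ht, hout⟩ := LLOC.exists_exec_program T ⌊1 / ε⌋₊
  obtain ⟨m, hm0, hm1, hm2, hcost, g, hg, hdom⟩ :=
    LoopLang.Cmd.program_spec (σ := LLOC.initialState T ⌊1 / ε⌋₊) (n := n) (k := ⌊1 / ε⌋₊)
      rfl rfl
  obtain ⟨hmd, hmd'⟩ := LLOC.parts_bounds hε hε1 hd0 hd hm1 hm2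
  refine ⟨t, M, hM, ?_, ?_⟩
  · refine le_trans ?_ (LLOC.time_bound hε hε1 hd0 hd hm0 hn hmd hm2)
    exact_mod_cast LLOC.cost_bound hn hm1 (ht.trans hcost)
  · have hg' : LLOC.output n M = fun u : Fin n => (g u : ℝ) := by
      rw [hout]
      exact funext fun u => congrArg _ (hg u u.2)
    rw [hg']
    refine LLOC.satisfiesFraction_of_dominated hT hd0 (hd.symm ▸ hf) hm0 hmd hmd' hdom ?_
    linarith
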